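/- Let $\overline\rho>0$, $f\in C^1[0,\overline\rho]$ with $f(0)=0$, $h:=f'$, and $g\in C[0,\overline\rho]$. Consider the equation $$\rho_t+f(\rho)_x=\bigl(D(\rho)\rho_x\bigr)_x+g(\rho),\qquad \rho\in[0,\overline\rho].$$ **Hypotheses.** - (g) $g>0$ on $[0,\overline\rho)$ and $g(\overline\rho)=0$. - (D) $D\in C^1[0,\overline\rho]$, $D(\overline\rho)=0$ and $D>0$ on $(0,\overline\rho)$. - ($\tilde{\mathrm D}$) $D\in C[0,\overline\rho]\cap C^1[0,\overline\rho)$, $D(\overline\rho)=0$, $D>0$ on $(0,\overline\rho)$, $\dot D(\overline\rho)=-\infty$ (as a limit of difference quotients), and $\lim_{s\to\overline\rho^-}\frac{D(s)g(s)}{s-\overline\rho}$ exists in $(-\infty,0]$. **Definitions.** Let $I\subseteq\mathbb R$ be an open interval and $c\in\mathbb R$. A continuous, a.e. differentiable $\varphi:I\to[0,\overline\rho]$ is a *traveling-wave profile* with speed $c$ on $I$ if $D(\varphi)\varphi'\in L^1_{\rm loc}(I)$, this function is the weak derivative of $\int_0^{\varphi}D(s)\,ds$, and $$\int_I\bigl\{(D(\varphi)\varphi'-f(\varphi)+c\varphi)\psi'-g(\varphi)\psi\bigr\}\,d\xi=0\qquad\text{for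 all }\psi\in C_0^\infty(I).$$ It is - *strict* if $I\ne\mathbb R$ and $\varphi$ does not extend to a traveling-wave profile with speed $c$ on $\mathbb R$; - *classical* on an open set $J\subseteq I$ (on $J=I$ if no set is mentioned) if it is differentiable at every point of $J$, $D(\varphi)\varphi'$ is absolutely continuous on compact intervals contained in $J$, and $(D(\varphi)\varphi')'+(c-h(\varphi))\varphi'+g(\varphi)=0$ a.e. in $J$; - *sharp at $\ell$* if $g(\ell)=0$ and there is $\xi_0\in I$ with $\varphi(\xi_0)=\ell$ such that $\varphi$ is classical on $I\setminus\{\xi_0\}$ and not differentiable at $\xi_0$; *sharp* means sharp at some $\ell$. A *semi-wavefront profile from* (respectively *to*) $\overline\rho$ is a (weakly) monotone, non-constant traveling-wave profile defined on some $(-\infty,\varpi)$ (respectively $(\varpi,\infty)$), $\varpi\in\mathbb R$, with limit $\overline\rho$ at $-\infty$ (respectively $+\infty$). **Theorem.** Assume (g), and (D) or ($\tilde{\mathrm D}$). For every $c\in\mathbb R$: 1. There are classical or sharp semi-wavefront profiles with speed $c$ both from $\overline\rho$ and to $\overline\rho$. They are unique up to shifts: in each of the two cases there is one such profile $\varphi$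 for which every classical or sharp semi-wavefront profile with speed $c$ of the same kind is the restriction to its own half-line of a shift of $\varphi$. All of these profiles are strict. 2. Assume (D). Every classical or sharp semi-wavefront profile from $\overline\rho$ with speed $c$ is sharp at $\overline\rho$ if $c<h(\overline\rho)$, and classical if $c>h(\overline\rho)$. Every classical or sharp semi-wavefront profile to $\overline\rho$ with speed $c$ is classical if $c<h(\overline\rho)$, and sharp at $\overline\rho$ if $c>h(\overline\rho)$. If $c=h(\overline\rho)$ and $\dot D(\overline\rho)<0$, all of them are classical. 3. Under ($\tilde{\mathrm D}$) all classical or sharp semi-wavefront profiles from and to $\overline\rho$ are classical. Finally, if (D) holds, $c=h(\overline\rho)$ and $\dot D(\overline\rho)=0$, both types can occur: for every $\overline\rho>0$ there are $f,D,g$ satisfying the above assumptions, (D), (g) and $\dot D(\overline\rho)=0$ for which, with $c=h(\overline\rho)$, there are classical semi-wavefront profiles from and to $\overline\rho$, and there are other such $f,D,g$ for which there are semi-wavefront profiles from and to $\overline\rho$ that are sharp at $\overline\rho$. -/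

import Mathlib

open Set Filter MeasureTheory
open scoped Topology ContDiff

noncomputable section

namespace SemiWavefront

/-! The equation is `ρ_t + f(ρ)_x = (D(ρ) ρ_x)_x + g(ρ)` for densities `ρ ∈ [0, R]`.
The coefficients are functions on `ℝ` of which only the values on `[0, R]` matter. -/

/-- Standing assumptions on the convective term and on the source term. -/
structure Standing (R : ℝ) (f g : ℝ → ℝ) : Prop where
  f_contDiff : ContDiffOn ℝ 1 f (Icc 0 R)
  f_zero : f 0 = 0
  g_continuous : ContinuousOn g (Icc 0 R)

/-- The derivative `h = f'` on `[0, R]` (one-sided at the end points). -/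
def advSpeed (R : ℝ) (f : ℝ → ℝ) (s : ℝ) : ℝ := derivWithin f (Icc 0 R) s

/-- Condition (g). -/
structure CondG (R : ℝ) (g : ℝ → ℝ) : Prop where
  pos : ∀ s ∈ Ico 0 R, 0 < g s
  zero : g R = 0

/-- Condition (D), including `D ∈ C¹[0, R]`. -/
structure CondD (R : ℝ) (D : ℝ → ℝ) : Prop where
  contDiff : ContDiffOn ℝ 1 D (Icc 0 R)
  zero : D R = 0
  pos : ∀ s ∈ Ioo 0 R, 0 < D s

/-- Condition (D̃), including `D ∈ C[0, R] ∩ C¹[0, R)`; the derivative of `D` at `R` is `-∞`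
and `D g / (· - R)` has a finite nonpositive left limit at `R`. -/
structure CondDTilde (R : ℝ) (D g : ℝ → ℝ) : Prop where
  continuous : ContinuousOn D (Icc 0 R)
  contDiff : ContDiffOn ℝ 1 D (Ico 0 R)
  zero : D R = 0
  pos : ∀ s ∈ Ioo 0 R, 0 < D s
  deriv_end : Tendsto (fun s => (D s - D R) / (s - R)) (𝓝[<] R) atBot
  limit : ∃ l : ℝ, l ≤ 0 ∧ Tendsto (fun s => D s * g s / (s - R)) (𝓝[<] R) (𝓝 l)

/-- The diffusive term `D(φ) φ'`. -/
def flux (D φ : ℝ → ℝ) (ξ : ℝ) : ℝ := D (φ ξ) * deriv φ ξ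

/-- `φ` is, on the open interval `I`, the profile of a traveling-wave solution with speed `c`.
The locally integrable function `D(φ) φ'` is the derivative of `∫₀^φ D` in the weak sense
(field `flux_weak`), so that no singular part (as for Cantor's function) is lost; for classical
and for sharp profiles this field is a consequence of the other requirements. -/
structure IsTravelingWave (R : ℝ) (f D g : ℝ → ℝ) (c : ℝ) (I : Set ℝ) (φ : ℝ → ℝ) : Prop where
  isOpen : IsOpen I
  ordConnected : I.OrdConnected
  mapsTo : MapsTo φ I (Icc 0 R)
  continuous : ContinuousOn φ I
  ae_differentiable : ∀ᵐ ξ ∂volume.restrict I, DifferentiableAt ℝ φ ξ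
  flux_locallyIntegrable : LocallyIntegrableOn (flux D φ) I
  flux_weak : ∀ a ∈ I, ∀ b ∈ I,
    (∫ s in (φ a)..(φ b), D s) = ∫ ξ in a..b, flux D φ ξ
  weak_eq : ∀ ψ : ℝ → ℝ, ContDiff ℝ ∞ ψ → HasCompactSupport ψ → tsupport ψ ⊆ I →
    ∫ ξ in I, ((flux D φ ξ - f (φ ξ) + c * φ ξ) * deriv ψ ξ - g (φ ξ) * ψ ξ) = 0

/-- `φ` is classical on the open set `J`: it is differentiable, `D(φ) φ'` is absolutely
continuous on the compact intervals contained in `J`, and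
`(D(φ) φ')' + (c - h(φ)) φ' + g(φ) = 0` a.e. in `J`. -/
structure IsClassicalOn (R : ℝ) (f D g : ℝ → ℝ) (c : ℝ) (J : Set ℝ) (φ : ℝ → ℝ) : Prop where
  differentiable : ∀ ξ ∈ J, DifferentiableAt ℝ φ ξ
  flux_ac : ∀ a b : ℝ, uIcc a b ⊆ J → AbsolutelyContinuousOnInterval (flux D φ) a b
  ae_eq : ∀ᵐ ξ ∂volume.restrict J,
    deriv (flux D φ) ξ + (c - advSpeed R f (φ ξ)) * deriv φ ξ + g (φ ξ) = 0

/-- `φ` is sharp at `l` on the open interval `I`. -/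
def IsSharpAt (R : ℝ) (f D g : ℝ → ℝ) (c : ℝ) (I : Set ℝ) (φ : ℝ → ℝ) (l : ℝ) : Prop :=
  g l = 0 ∧ ∃ ξ₀ ∈ I, φ ξ₀ = l ∧ IsClassicalOn R f D g c (I \ {ξ₀}) φ ∧
    ¬ DifferentiableAt ℝ φ ξ₀

/-- `φ` is classical or sharp (at some value). -/
def IsClassicalOrSharp (R : ℝ) (f D g : ℝ → ℝ) (c : ℝ) (I : Set ℝ) (φ : ℝ → ℝ) : Prop :=
  IsClassicalOn R f D g c I φ ∨ ∃ l, IsSharpAt R f D g c I φ l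

/-- `φ`, defined in `I`, is strict: `I ≠ ℝ` and `φ` does not extend to (the profile of) a
traveling-wave solution on the whole of `ℝ`. -/
def IsStrict (R : ℝ) (f D g : ℝ → ℝ) (c : ℝ) (I : Set ℝ) (φ : ℝ → ℝ) : Prop :=
  I ≠ univ ∧ ¬ ∃ φ' : ℝ → ℝ, IsTravelingWave R f D g c univ φ' ∧ EqOn φ' φ I

/-- Weakly monotone and not identically constant on `I`. -/
def IsMonotonicNonconst (I : Set ℝ) (φ : ℝ → ℝ) : Prop :=
  (MonotoneOn φ I ∨ AntitoneOn φ I) ∧ ∃ ξ₁ ∈ I, ∃ ξ₂ ∈ I, φ ξ₁ ≠ φ ξ₂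

/-- `φ` is, on `(-∞, w)`, the profile of a semi-wavefront solution from `l`. -/
structure IsSemiWavefrontFrom (R : ℝ) (f D g : ℝ → ℝ) (c l w : ℝ) (φ : ℝ → ℝ) : Prop where
  wave : IsTravelingWave R f D g c (Iio w) φ
  mem : l ∈ Icc 0 R
  zero : g l = 0
  monotonic : IsMonotonicNonconst (Iio w) φ
  tendsto : Tendsto φ atBot (𝓝 l)

/-- `φ` is, on `(w, ∞)`, the profile of a semi-wavefront solution to `l`. -/
structure IsSemiWavefrontTo (R : ℝ) (f D g : ℝ → ℝ) (c l w : ℝ) (φ : ℝ → ℝ) : Prop where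
  wave : IsTravelingWave R f D g c (Ioi w) φ
  mem : l ∈ Icc 0 R
  zero : g l = 0
  monotonic : IsMonotonicNonconst (Ioi w) φ
  tendsto : Tendsto φ atTop (𝓝 l)

/-- Classical or sharp semi-wavefront profile from `R` on `(-∞, w)`. -/
def ProfileFrom (R : ℝ) (f D g : ℝ → ℝ) (c w : ℝ) (φ : ℝ → ℝ) : Prop :=
  IsSemiWavefrontFrom R f D g c R w φ ∧ IsClassicalOrSharp R f D g c (Iio w) φ

/-- Classical or sharp semi-wavefront profile to `R` on `(w, ∞)`. -/
def ProfileTo (R : ℝ) (f D g : ℝ → ℝ) (c w : ℝ) (φ : ℝ → ℝ) : Prop :=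
  IsSemiWavefrontTo R f D g c R w φ ∧ IsClassicalOrSharp R f D g c (Ioi w) φ

end SemiWavefront

end

/-! Along a decreasing profile `φ` from `R` the quantity `y = -D(φ) φ'`, viewed as a function of the
density `s = φ`, solves the singular terminal value problem `y' = c - h - D g / y`, `y(R) = 0`.
Replacing `y` by `max y δ` in the denominator gives problems whose solutions decrease, as `δ ↓ 0`,
to a positive solution of the singular one; the profile is then the inverse of the travel time
`∫ D / y`, which is bounded near `s = 0`.

For an arbitrary wave, let `Z` be the continuous representative of `D(φ) φ'`. While `0 < φ < R`,
the deviation `Z + y(φ)` has nonincreasing absolute value. It vanishes where `φ` leaves the value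
`R`, and if `φ` only approaches `R` as `ξ → -∞` a nonzero deviation would keep `Z` away from zero
on a half-line and make `∫₀^φ D` unbounded. Hence `Z = -y(φ)`, which forces `φ` to be a shift of
the profile just constructed. If a semi-wavefront extended to the whole line, `Z` would stay
negative from some point on, but such a wave can neither remain positive nor reach `0`.

The profile leaves the value `R` with the slope `-lim_{s → R} y / D`, or only approaches it as
`ξ → -∞`; so it is classical if `y = o(D)` at `R` and sharp if `δ D ≤ y` near `R` for some `δ > 0`,
and comparing `y` with multiples of `D`, respectively of `R - s`, decides between the two. The
reflection `ξ ↦ -ξ`, `f ↦ -f`, `c ↦ -c` exchanges profiles from and to `R`. -/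

noncomputable section

namespace SemiWavefront

theorem hasDerivAt_integral_of_continuousOn {E : Type*} [NormedAddCommGroup E] [NormedSpace ℝ E]
    [CompleteSpace E] {I : Set ℝ} {u : ℝ → E} {a x : ℝ} (hI : IsOpen I) (hIc : I.OrdConnected)
    (hu : ContinuousOn u I) (ha : a ∈ I) (hx : x ∈ I) :
    HasDerivAt (fun x => ∫ t in a..x, u t) (u x) x :=
  intervalIntegral.integral_hasDerivAt_right
    (hu.mono (hIc.uIcc_subset ha hx)).intervalIntegrable
    (hu.stronglyMeasurableAtFilter hI x hx) (hu.continuousAt (hI.mem_nhds hx))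

theorem nonpos_of_deriv_nonneg_of_pos {G G' : ℝ → ℝ} {a b : ℝ} (hcont : ContinuousOn G (Icc a b))
    (hderiv : ∀ s ∈ Ioo a b, HasDerivAt G (G' s) s) (hend : G b ≤ 0)
    (hmono : ∀ s ∈ Ioo a b, 0 < G s → 0 ≤ G' s) : ∀ s ∈ Icc a b, G s ≤ 0 := by
  intro s hs
  by_contra! hpos
  let Z := Icc s b ∩ G ⁻¹' Iic 0
  have hGs : ContinuousOn G (Icc s b) := hcont.mono (Icc_subset_Icc_left hs.1)
  have hbdd : BddBelow Z := ⟨s, fun x hx => hx.1.1⟩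
  have ht : sInf Z ∈ Z := (hGs.preimage_isClosed_of_isClosed isClosed_Icc isClosed_Iic).csInf_mem
    ⟨b, ⟨hs.2, le_rfl⟩, hend⟩ hbdd
  set t := sInf Z
  have hpos_before : ∀ x ∈ Ico s t, 0 < G x := fun x hx => not_le.1 fun hx0 =>
    (csInf_le hbdd ⟨⟨hx.1, hx.2.le.trans ht.1.2⟩, hx0⟩).not_gt hx.2
  have hmonoOn : MonotoneOn G (Icc s t) := by
    refine monotoneOn_of_hasDerivWithinAt_nonneg (f' := G') (convex_Icc s t)
      (hGs.mono (Icc_subset_Icc_right ht.1.2)) ?_ ?_ <;> rw [interior_Icc] <;> intro x hx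
    · exact (hderiv x ⟨hs.1.trans_lt hx.1, hx.2.trans_le ht.1.2⟩).hasDerivWithinAt
    · exact hmono x ⟨hs.1.trans_lt hx.1, hx.2.trans_le ht.1.2⟩ (hpos_before x ⟨hx.1.le, hx.2⟩)
  exact (hpos.trans_le (hmonoOn (left_mem_Icc.2 ht.1.1) (right_mem_Icc.2 ht.1.1) ht.1.1)).not_ge
    ht.2

section SingularProblem

variable {a b : ℝ} {κ p y : ℝ → ℝ} {δ C P : ℝ}

/-- Solution on `[a, b]` of the terminal value problem `y' = κ - p / max y δ`, `y b = 0`, which for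
`0 < δ` is a regularization of the singular problem `y' = κ - p / y`. -/
structure IsTruncatedSolution (a b : ℝ) (κ p : ℝ → ℝ) (δ : ℝ) (y : ℝ → ℝ) : Prop where
  continuousOn : ContinuousOn y (Icc a b)
  terminal : y b = 0
  hasDerivAt : ∀ s ∈ Ioo a b, HasDerivAt y (κ s - p s / max (y s) δ) s

/-- Positive solution on `(a, b)` of the singular terminal value problem `y' = κ - p / y`,
`y b = 0`. It is only required to be bounded at `a`, where `p` may vanish. -/
structure IsSingularSolution (a b : ℝ) (κ p y : ℝ → ℝ) : Prop where
  continuousOn : ContinuousOn y (Ioc a b)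
  terminal : y b = 0
  pos : ∀ s ∈ Ioo a b, 0 < y s
  hasDerivAt : ∀ s ∈ Ioo a b, HasDerivAt y (κ s - p s / y s) s
  bounded : ∃ M, ∀ s ∈ Ioc a b, y s ≤ M

theorem abs_div_max_sub_div_max_le {q : ℝ} (hq : 0 ≤ q) (hqP : q ≤ P) (hδ : 0 < δ) (u v : ℝ) :
    |q / max u δ - q / max v δ| ≤ P / δ ^ 2 * |u - v| := by
  have hmax : ∀ x, 0 < max x δ := fun x => hδ.trans_le (le_max_right _ _)
  have hdiff : q / max u δ - q / max v δ = q * (max v δ - max u δ) / (max u δ * max v δ) := by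
    have := (hmax u).ne'
    have := (hmax v).ne'
    field_simp
  rw [hdiff, abs_div, abs_mul, abs_of_nonneg hq, abs_of_pos (mul_pos (hmax u) (hmax v)),
    div_mul_eq_mul_div, abs_sub_comm (max v δ)]
  have hP := hq.trans hqP
  refine div_le_div₀ (by positivity) ?_ (by positivity) ?_
  · exact mul_le_mul hqP (abs_max_sub_max_le_abs u v δ) (abs_nonneg _) hP
  · exact sq δ ▸ mul_le_mul (le_max_right _ _) (le_max_right _ _) hδ.le (hmax u).le

theorem exists_isTruncatedSolution (hab : a ≤ b) (hκ : ContinuousOn κ (Icc a b))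
    (hp : ContinuousOn p (Icc a b)) (hκC : ∀ s ∈ Icc a b, |κ s| ≤ C)
    (hp0 : ∀ s ∈ Icc a b, 0 ≤ p s) (hpP : ∀ s ∈ Icc a b, p s ≤ P) (hδ : 0 < δ) :
    ∃ y, IsTruncatedSolution a b κ p δ y := by
  have hb : b ∈ Icc a b := right_mem_Icc.2 hab
  have hC : 0 ≤ C := (abs_nonneg _).trans (hκC b hb)
  have hP : 0 ≤ P := (hp0 b hb).trans (hpP b hb)
  have _hlen := sub_nonneg.2 hab
  have hmax : ∀ x, 0 < max x δ := fun x => hδ.trans_le (le_max_right _ _)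
  have hpicard : IsPicardLindelof (fun s x => κ s - p s / max x δ) (⟨b, hb⟩ : Icc a b) (0 : ℝ)
      ⟨(C + P / δ) * (b - a), by positivity⟩ 0 ⟨C + P / δ, by positivity⟩
      ⟨P / δ ^ 2, by positivity⟩ := by
    refine ⟨fun t ht => ?_, fun x _ => hκ.sub (hp.div_const _), fun t ht x _ => ?_, ?_⟩
    · refine (LipschitzWith.of_dist_le_mul fun u v => ?_).lipschitzOnWith
      rw [Real.dist_eq, Real.dist_eq, sub_sub_sub_cancel_left, abs_sub_comm]
      exact abs_div_max_sub_div_max_le (hp0 t ht) (hpP t ht) hδ u v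
    · refine (abs_sub _ _).trans (add_le_add (hκC t ht) ?_)
      rw [abs_of_nonneg (div_nonneg (hp0 t ht) (hmax x).le)]
      exact div_le_div₀ hP (hpP t ht) hδ (le_max_right _ _)
    · change (C + P / δ) * max (b - b) (b - a) ≤ (C + P / δ) * (b - a) - 0
      simp [hab]
  obtain ⟨y, hyb, hy⟩ := hpicard.exists_eq_forall_mem_Icc_hasDerivWithinAt₀
  exact ⟨y, fun s hs => (hy s hs).continuousWithinAt, hyb, fun s hs =>
    (hy s (Ioo_subset_Icc_self hs)).hasDerivAt (Icc_mem_nhds hs.1 hs.2)⟩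

namespace IsTruncatedSolution

theorem le_of_le {δ' : ℝ} {y' : ℝ → ℝ} (h : IsTruncatedSolution a b κ p δ y)
    (h' : IsTruncatedSolution a b κ p δ' y') (hp0 : ∀ s ∈ Icc a b, 0 ≤ p s) (hδ : 0 < δ)
    (hle : δ ≤ δ') : ∀ s ∈ Icc a b, y' s ≤ y s := by
  intro s hs
  refine sub_nonpos.1 (nonpos_of_deriv_nonneg_of_pos (G := fun t => y' t - y t)
    (h'.continuousOn.sub h.continuousOn)
    (fun t ht => (h'.hasDerivAt t ht).sub (h.hasDerivAt t ht)) ?_ (fun t ht hpos => ?_) s hs)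
  · simp [h.terminal, h'.terminal]
  · have hmax : max (y t) δ ≤ max (y' t) δ' := max_le_max (by linarith) hle
    have : p t / max (y' t) δ' ≤ p t / max (y t) δ :=
      div_le_div_of_nonneg_left (hp0 t (Ioo_subset_Icc_self ht))
        (hδ.trans_le (le_max_right _ _)) hmax
    linarith

theorem neg_mul_le (h : IsTruncatedSolution a b κ p δ y) (hκC : ∀ s ∈ Icc a b, |κ s| ≤ C)
    (hp0 : ∀ s ∈ Icc a b, 0 ≤ p s) (hδ : 0 < δ) : ∀ s ∈ Icc a b, -(C * (b - s)) ≤ y s := by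
  intro s hs
  refine sub_nonpos.1 (nonpos_of_deriv_nonneg_of_pos (G := fun t => -(C * (b - t)) - y t)
    (G' := fun t => -(C * -1) - (κ t - p t / max (y t) δ))
    ((by fun_prop : Continuous fun t => -(C * (b - t))).continuousOn.sub h.continuousOn)
    (fun t ht => ((((hasDerivAt_id t).const_sub b).const_mul C).neg).sub (h.hasDerivAt t ht))
    (by simp [h.terminal]) (fun t ht _ => ?_) s hs)
  have ht' := Ioo_subset_Icc_self ht
  have := (abs_le.1 (hκC t ht')).2
  have : 0 ≤ p t / max (y t) δ := div_nonneg (hp0 t ht') (hδ.le.trans (le_max_right _ _))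
  linarith

theorem le_add_mul (h : IsTruncatedSolution a b κ p δ y) (hκC : ∀ s ∈ Icc a b, |κ s| ≤ C)
    (hpP : ∀ s ∈ Icc a b, p s ≤ P) (hP : 0 ≤ P) {ε : ℝ} (hε : 0 < ε) :
    ∀ s ∈ Icc a b, y s ≤ ε + (C + P / ε) * (b - s) := by
  intro s hs
  have hC : 0 ≤ C := (abs_nonneg _).trans (hκC s hs)
  refine sub_nonpos.1 (nonpos_of_deriv_nonneg_of_pos
    (G := fun t => y t - (ε + (C + P / ε) * (b - t)))
    (G' := fun t => (κ t - p t / max (y t) δ) - (C + P / ε) * -1)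
    (h.continuousOn.sub (by fun_prop : Continuous fun t => ε + (C + P / ε) * (b - t)).continuousOn)
    (fun t ht => (h.hasDerivAt t ht).sub
      ((((hasDerivAt_id t).const_sub b).const_mul (C + P / ε)).const_add ε))
    (by simp [h.terminal, hε.le]) (fun t ht hpos => ?_) s hs)
  have ht' := Ioo_subset_Icc_self ht
  have := (abs_le.1 (hκC t ht')).1
  have : 0 ≤ (C + P / ε) * (b - t) := mul_nonneg (by positivity) (sub_nonneg.2 ht.2.le)
  have hmax : ε ≤ max (y t) δ := le_max_of_le_left (by linarith)
  have : p t / max (y t) δ ≤ P / ε := div_le_div₀ hP (hpP t ht') hε hmax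
  linarith

/-- If `y` were below the line of slope `-K` through `(s, m)`, its slope would be at most `-K`
there, because `p / max y δ ≥ q / m ≥ C + K`; but the line is below `y` at `d`. -/
theorem le_of_le_div (h : IsTruncatedSolution a b κ p δ y) (hκC : ∀ s ∈ Icc a b, |κ s| ≤ C)
    (hδ : 0 < δ) {m q K s d : ℝ} (hδm : δ ≤ m) (has : a ≤ s) (hsd : s ≤ d) (hdb : d ≤ b)
    (hq : ∀ t ∈ Icc s d, q ≤ p t) (hq0 : 0 ≤ q) (hK : 0 ≤ K) (hCK : C + K ≤ q / m)
    (hend : m - K * (d - s) ≤ y d) : m ≤ y s := by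
  have hsub : Icc s d ⊆ Icc a b := Icc_subset_Icc has hdb
  have := nonpos_of_deriv_nonneg_of_pos (G := fun t => (m + K * (s - t)) - y t)
    (G' := fun t => K * -1 - (κ t - p t / max (y t) δ)) (a := s) (b := d)
    ((by fun_prop : Continuous fun t => m + K * (s - t)).continuousOn.sub
      (h.continuousOn.mono hsub))
    (fun t ht => ((((hasDerivAt_id t).const_sub s).const_mul K).const_add m).sub
      (h.hasDerivAt t ⟨has.trans_lt ht.1, ht.2.trans_le hdb⟩))
    (by linarith) (fun t ht hpos => ?_) s
    (left_mem_Icc.2 hsd)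
  · simpa using this
  · have ht' := Ioo_subset_Icc_self ht
    have : 0 ≤ K * (t - s) := mul_nonneg hK (sub_nonneg.2 ht.1.le)
    have : q / m ≤ p t / max (y t) δ :=
      div_le_div₀ (hq0.trans (hq t ht')) (hq t ht') (hδ.trans_le (le_max_right _ _))
        (max_le (by linarith) hδm)
    have := (abs_le.1 (hκC t (hsub ht'))).2
    linarith

end IsTruncatedSolution

theorem exists_pos_le_isTruncatedSolution (hp : ContinuousOn p (Icc a b))
    (hκC : ∀ s ∈ Icc a b, |κ s| ≤ C) (hp0 : ∀ s ∈ Icc a b, 0 ≤ p s)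
    (hppos : ∀ s ∈ Ioo a b, 0 < p s) {c d : ℝ} (hac : a < c) (hcd : c ≤ d) (hdb : d < b) :
    ∃ m > 0, ∀ δ, 0 < δ → δ ≤ m → ∀ y, IsTruncatedSolution a b κ p δ y →
      ∀ s ∈ Icc c d, m ≤ y s := by
  obtain ⟨e, hde, heb⟩ := exists_between hdb
  obtain ⟨x, hx, hmin⟩ := isCompact_Icc.exists_isMinOn (nonempty_Icc.2 (hcd.trans hde.le))
    (hp.mono (Icc_subset_Icc hac.le heb.le))
  have hpx : 0 < p x := hppos x ⟨hac.trans_le hx.1, hx.2.trans_lt heb⟩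
  have he : e ∈ Icc a b := ⟨by linarith, heb.le⟩
  have hC : 0 ≤ C := (abs_nonneg _).trans (hκC e he)
  have hlen : 0 < e - d := sub_pos.2 hde
  have _hlen' : 0 < b - e := sub_pos.2 heb
  let K := (C * (b - e) + 1) / (e - d)
  have hK : 0 < K := by positivity
  let m := min 1 (p x / (C + K))
  have hm : 0 < m := by positivity
  refine ⟨m, hm, fun δ hδ hδm y hy s hs => ?_⟩
  refine hy.le_of_le_div hκC hδ (q := p x) (K := K) hδm (hac.le.trans hs.1)
    (hs.2.trans hde.le) heb.le (fun t ht => hmin ⟨hs.1.trans ht.1, ht.2⟩) hpx.le hK.le ?_ ?_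
  · rw [le_div_iff₀ hm, mul_comm, ← le_div_iff₀ (by positivity)]
    exact min_le_right _ _
  · have hlow := hy.neg_mul_le hκC hp0 hδ e he
    have hKe : K * (e - d) = C * (b - e) + 1 := div_mul_cancel₀ _ hlen.ne'
    have : K * (e - d) ≤ K * (e - s) := mul_le_mul_of_nonneg_left (by linarith [hs.2]) hK.le
    linarith [min_le_left 1 (p x / (C + K))]

theorem norm_sub_div_le {k q u m : ℝ} (hk : |k| ≤ C) (hq : |q| ≤ P) (hm : 0 < m) (hmu : m ≤ u) :
    ‖k - q / u‖ ≤ C + P / m := by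
  refine (norm_sub_le _ _).trans (add_le_add hk ?_)
  rw [norm_div, Real.norm_of_nonneg (hm.le.trans hmu)]
  exact div_le_div₀ ((abs_nonneg q).trans hq) hq hm hmu

theorem exists_tendsto_isTruncatedSolution (hab : a ≤ b) (hκ : ContinuousOn κ (Icc a b))
    (hp : ContinuousOn p (Icc a b)) (hκC : ∀ s ∈ Icc a b, |κ s| ≤ C)
    (hp0 : ∀ s ∈ Icc a b, 0 ≤ p s) (hpP : ∀ s ∈ Icc a b, p s ≤ P) :
    ∃ (Y : ℕ → ℝ → ℝ) (y : ℝ → ℝ),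
      (∀ n : ℕ, IsTruncatedSolution a b κ p (1 / ((n : ℝ) + 1)) (Y n)) ∧
      ∀ s ∈ Icc a b, Tendsto (fun n => Y n s) atTop (𝓝 (y s)) := by
  have hδ : ∀ n : ℕ, (0 : ℝ) < 1 / ((n : ℝ) + 1) := fun n => Nat.one_div_pos_of_nat
  have hP : 0 ≤ P := (hp0 b (right_mem_Icc.2 hab)).trans (hpP b (right_mem_Icc.2 hab))
  choose Y hY using fun n : ℕ => exists_isTruncatedSolution hab hκ hp hκC hp0 hpP (hδ n)
  refine ⟨Y, fun s => ⨆ n, Y n s, hY, fun s hs => tendsto_atTop_ciSup (fun m n hmn => ?_) ?_⟩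
  · exact (hY n).le_of_le (hY m) hp0 (hδ n) (Nat.one_div_le_one_div hmn) s hs
  · exact ⟨1 + (C + P / 1) * (b - s), forall_mem_range.2 fun n =>
      (hY n).le_add_mul hκC hpP hP one_pos s hs⟩

theorem sub_eq_integral_of_tendsto_isTruncatedSolution {Y : ℕ → ℝ → ℝ} {δ : ℕ → ℝ}
    (hY : ∀ n, IsTruncatedSolution a b κ p (δ n) (Y n))
    (hlim : ∀ s ∈ Icc a b, Tendsto (fun n => Y n s) atTop (𝓝 (y s)))
    (hκ : ContinuousOn κ (Icc a b)) (hp : ContinuousOn p (Icc a b))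
    (hκC : ∀ s ∈ Icc a b, |κ s| ≤ C) (hpP : ∀ s ∈ Icc a b, |p s| ≤ P)
    {c d m : ℝ} (hac : a ≤ c) (hcd : c ≤ d) (hdb : d ≤ b) (hm : 0 < m)
    (hδm : ∀ᶠ n in atTop, δ n ≤ m) (hYm : ∀ᶠ n in atTop, ∀ s ∈ Icc c d, m ≤ Y n s) :
    y d - y c = ∫ s in c..d, (κ s - p s / y s) := by
  have hsub : Icc c d ⊆ Icc a b := Icc_subset_Icc hac hdb
  have hym : ∀ s ∈ Icc c d, m ≤ y s := fun s hs =>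
    ge_of_tendsto (hlim s (hsub hs)) (hYm.mono fun n hn => hn s hs)
  have hcont : ∀ᶠ n in atTop, ContinuousOn (fun s => κ s - p s / Y n s) (Icc c d) :=
    hYm.mono fun n hn => (hκ.mono hsub).sub ((hp.mono hsub).div ((hY n).continuousOn.mono hsub)
      fun s hs => (hm.trans_le (hn s hs)).ne')
  have hYint : ∀ᶠ n in atTop, ∫ s in c..d, (κ s - p s / Y n s) = Y n d - Y n c := by
    filter_upwards [hδm, hYm, hcont] with n hδn hYn hcn
    refine intervalIntegral.integral_eq_sub_of_hasDerivAt_of_le hcd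
      ((hY n).continuousOn.mono hsub) (fun s hs => ?_) (hcn.intervalIntegrable_of_Icc hcd)
    have := (hY n).hasDerivAt s ⟨hac.trans_lt hs.1, hs.2.trans_le hdb⟩
    rwa [max_eq_left (hδn.trans (hYn s (Ioo_subset_Icc_self hs)))] at this
  have hintlim : Tendsto (fun n => ∫ s in c..d, (κ s - p s / Y n s)) atTop
      (𝓝 (∫ s in c..d, (κ s - p s / y s))) := by
    refine intervalIntegral.tendsto_integral_filter_of_dominated_convergence
      (fun _ => C + P / m) ?_ ?_ intervalIntegrable_const ?_ <;> rw [uIoc_of_le hcd]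
    · exact hcont.mono fun n hn =>
        (hn.mono Ioc_subset_Icc_self).aestronglyMeasurable measurableSet_Ioc
    · filter_upwards [hYm] with n hYn
      refine Eventually.of_forall fun s hs => ?_
      have hs' := Ioc_subset_Icc_self hs
      exact norm_sub_div_le (hκC s (hsub hs')) (hpP s (hsub hs')) hm (hYn s hs')
    · refine Eventually.of_forall fun s hs => ?_
      have hs' := Ioc_subset_Icc_self hs
      exact tendsto_const_nhds.sub (tendsto_const_nhds.div (hlim s (hsub hs'))
        (hm.trans_le (hym s hs')).ne')
  exact tendsto_nhds_unique ((hlim d (hsub (right_mem_Icc.2 hcd))).sub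
    (hlim c (hsub (left_mem_Icc.2 hcd)))) (hintlim.congr' hYint)

theorem continuousOn_of_sub_eq_integral {F : ℝ → ℝ}
    (hy : ∀ c d, a < c → c ≤ d → d < b → y d - y c = ∫ s in c..d, F s)
    (hF : ∀ c d, a < c → c ≤ d → d < b → ∃ K, ∀ s ∈ Icc c d, ‖F s‖ ≤ K) :
    ContinuousOn y (Ioo a b) := by
  intro s hs
  obtain ⟨c, hac, hcs⟩ := exists_between hs.1
  obtain ⟨d, hsd, hdb⟩ := exists_between hs.2
  obtain ⟨K, hK⟩ := hF c d hac (hcs.trans hsd).le hdb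
  have hK0 : 0 ≤ K := (norm_nonneg _).trans (hK s ⟨hcs.le, hsd.le⟩)
  have hLip : LipschitzOnWith ⟨K, hK0⟩ y (Icc c d) := by
    refine LipschitzOnWith.of_dist_le_mul fun u hu v hv => ?_
    wlog huv : v ≤ u generalizing u v
    · rw [dist_comm (y u), dist_comm u]
      exact this v hv u hu (le_of_not_ge huv)
    rw [Real.dist_eq, Real.dist_eq, hy v u (hac.trans_le hv.1) huv (hu.2.trans_lt hdb)]
    change ‖∫ s in v..u, F s‖ ≤ K * |u - v|
    refine intervalIntegral.norm_integral_le_of_norm_le_const fun t ht => ?_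
    rw [uIoc_of_le huv] at ht
    exact hK t ⟨hv.1.trans ht.1.le, ht.2.trans hu.2⟩
  exact (hLip.continuousOn.continuousAt (Icc_mem_nhds hcs hsd)).continuousWithinAt

theorem hasDerivAt_of_sub_eq_integral {F : ℝ → ℝ} (hF : ContinuousOn F (Ioo a b))
    (hy : ∀ c d, a < c → c ≤ d → d < b → y d - y c = ∫ s in c..d, F s) :
    ∀ s ∈ Ioo a b, HasDerivAt y (F s) s := by
  intro s hs
  obtain ⟨c, hac, hcs⟩ := exists_between hs.1
  have hprim : y =ᶠ[𝓝 s] fun u => y c + ∫ t in c..u, F t := by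
    filter_upwards [Ioo_mem_nhds hcs hs.2] with u hu
    rw [← hy c u hac hu.1.le hu.2, add_sub_cancel]
  exact ((hasDerivAt_integral_of_continuousOn isOpen_Ioo ordConnected_Ioo hF ⟨hac, hcs.trans hs.2⟩
    hs).const_add _).congr_of_eventuallyEq hprim

theorem tendsto_nhdsLE_zero_of_le_add_mul (hab : a < b) (hy0 : ∀ s ∈ Ioc a b, 0 ≤ y s)
    (hle : ∀ ε > 0, ∃ A, ∀ s ∈ Ioc a b, y s ≤ ε + A * (b - s)) :
    Tendsto y (𝓝[≤] b) (𝓝 0) := by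
  have hIoc : Ioc a b ∈ 𝓝[≤] b := Ioc_mem_nhdsLE hab
  refine tendsto_order.2 ⟨fun x hx => ?_, fun ε hε => ?_⟩
  · filter_upwards [hIoc] with s hs using hx.trans_le (hy0 s hs)
  · obtain ⟨A, hA⟩ := hle (ε / 2) (half_pos hε)
    have hlim : Tendsto (fun s => ε / 2 + A * (b - s)) (𝓝[≤] b) (𝓝 (ε / 2)) := by
      have : Continuous fun s => ε / 2 + A * (b - s) := by fun_prop
      simpa using (this.tendsto b).mono_left nhdsWithin_le_nhds
    filter_upwards [hIoc, hlim.eventually (gt_mem_nhds (half_lt_self hε))] with s hs hs'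
    exact (hA s hs).trans_lt hs'

theorem isSingularSolution_of_sub_eq_integral (hab : a < b) (hκ : ContinuousOn κ (Icc a b))
    (hp : ContinuousOn p (Icc a b)) (hterm : y b = 0)
    (hle : ∀ ε > 0, ∃ A ≥ 0, ∀ s ∈ Icc a b, y s ≤ ε + A * (b - s))
    (hlow : ∀ c d, a < c → c ≤ d → d < b → ∃ m > 0, ∀ s ∈ Icc c d, m ≤ y s)
    (hint : ∀ c d, a < c → c ≤ d → d < b → y d - y c = ∫ s in c..d, (κ s - p s / y s)) :
    IsSingularSolution a b κ p y := by
  obtain ⟨C, hκC⟩ := isCompact_Icc.exists_bound_of_continuousOn hκ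
  obtain ⟨P, hpP⟩ := isCompact_Icc.exists_bound_of_continuousOn hp
  have hpos : ∀ s ∈ Ioo a b, 0 < y s := fun s hs =>
    have ⟨_, hm, h⟩ := hlow s s hs.1 le_rfl hs.2
    hm.trans_le (h s ⟨le_rfl, le_rfl⟩)
  have hcont : ContinuousOn y (Ioo a b) := by
    refine continuousOn_of_sub_eq_integral hint fun c d hac hcd hdb => ?_
    obtain ⟨m, hm, h⟩ := hlow c d hac hcd hdb
    refine ⟨C + P / m, fun s hs => ?_⟩
    have hs' : s ∈ Icc a b := ⟨hac.le.trans hs.1, hs.2.trans hdb.le⟩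
    exact norm_sub_div_le (hκC s hs') (hpP s hs') hm (h s hs)
  have hcontF : ContinuousOn (fun s => κ s - p s / y s) (Ioo a b) :=
    (hκ.mono Ioo_subset_Icc_self).sub ((hp.mono Ioo_subset_Icc_self).div hcont
      fun s hs => (hpos s hs).ne')
  have hcontb : ContinuousWithinAt y (Iic b) b := by
    rw [ContinuousWithinAt, hterm]
    refine tendsto_nhdsLE_zero_of_le_add_mul hab (fun s hs => ?_) fun ε hε => ?_
    · exact hs.2.eq_or_lt.elim (fun h => h ▸ hterm.ge) fun h => (hpos s ⟨hs.1, h⟩).le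
    · obtain ⟨A, -, hA⟩ := hle ε hε
      exact ⟨A, fun s hs => hA s (Ioc_subset_Icc_self hs)⟩
  obtain ⟨A, hA0, hA⟩ := hle 1 one_pos
  refine ⟨fun s hs => ?_, hterm, hpos, hasDerivAt_of_sub_eq_integral hcontF hint,
    1 + A * (b - a), fun s hs => (hA s (Ioc_subset_Icc_self hs)).trans ?_⟩
  · rcases hs.2.eq_or_lt with rfl | hsb
    · exact hcontb.mono Ioc_subset_Iic_self
    · exact (hcont.continuousAt (Ioo_mem_nhds hs.1 hsb)).continuousWithinAt
  · gcongr
    exact hs.1.le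

theorem exists_isSingularSolution (hab : a < b) (hκ : ContinuousOn κ (Icc a b))
    (hp : ContinuousOn p (Icc a b)) (hppos : ∀ s ∈ Ioo a b, 0 < p s) :
    ∃ y, IsSingularSolution a b κ p y := by
  obtain ⟨C, hκC⟩ := isCompact_Icc.exists_bound_of_continuousOn hκ
  obtain ⟨P, hpP⟩ := isCompact_Icc.exists_bound_of_continuousOn hp
  have hpP' : ∀ s ∈ Icc a b, p s ≤ P := fun s hs => (le_abs_self _).trans (hpP s hs)
  have hp0 : MapsTo p (Icc a b) (Ici 0) := by
    rw [← closure_Ioo hab.ne, ← isClosed_Ici.closure_eq]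
    exact MapsTo.closure_of_continuousOn (fun s hs => (hppos s hs).le)
      (by rwa [closure_Ioo hab.ne])
  have hb : b ∈ Icc a b := right_mem_Icc.2 hab.le
  have hP : 0 ≤ P := (norm_nonneg _).trans (hpP b hb)
  have hC : 0 ≤ C := (norm_nonneg _).trans (hκC b hb)
  obtain ⟨Y, y, hY, hlim⟩ := exists_tendsto_isTruncatedSolution hab.le hκ hp hκC hp0 hpP'
  have hYlow : ∀ c d, a < c → c ≤ d → d < b → ∃ m > 0,
      (∀ᶠ n : ℕ in atTop, 1 / ((n : ℝ) + 1) ≤ m) ∧ ∀ᶠ n in atTop, ∀ s ∈ Icc c d, m ≤ Y n s := by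
    intro c d hac hcd hdb
    obtain ⟨m, hm, h⟩ := exists_pos_le_isTruncatedSolution hp hκC hp0 hppos hac hcd hdb
    have hδ : ∀ᶠ n : ℕ in atTop, 1 / ((n : ℝ) + 1) ≤ m :=
      tendsto_one_div_add_atTop_nhds_zero_nat.eventually (ge_mem_nhds hm)
    exact ⟨m, hm, hδ, hδ.mono fun n hn => h _ Nat.one_div_pos_of_nat hn _ (hY n)⟩
  refine ⟨y, isSingularSolution_of_sub_eq_integral hab hκ hp ?_ (fun ε hε => ?_)
    (fun c d hac hcd hdb => ?_) fun c d hac hcd hdb => ?_⟩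
  · exact tendsto_nhds_unique (hlim b hb) (by simp only [(hY _).terminal, tendsto_const_nhds])
  · exact ⟨C + P / ε, by positivity, fun s hs => le_of_tendsto' (hlim s hs) fun n =>
      (hY n).le_add_mul hκC hpP' hP hε s hs⟩
  · obtain ⟨m, hm, -, h⟩ := hYlow c d hac hcd hdb
    exact ⟨m, hm, fun s hs => ge_of_tendsto (hlim s ⟨hac.le.trans hs.1, hs.2.trans hdb.le⟩)
      (h.mono fun n hn => hn s hs)⟩
  · obtain ⟨m, hm, hδm, hYm⟩ := hYlow c d hac hcd hdb
    exact sub_eq_integral_of_tendsto_isTruncatedSolution hY hlim hκ hp hκC hpP hac.le hcd hdb.le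
      hm hδm hYm

end SingularProblem

section TestFunctions

theorem integrable_mul_of_tsupport_subset {X : Type*} [TopologicalSpace X] [T2Space X]
    [MeasurableSpace X] [OpensMeasurableSpace X] {μ : Measure X} {I : Set X} {Q η : X → ℝ}
    (hQ : LocallyIntegrableOn Q I μ) (hη : Continuous η) (hηc : HasCompactSupport η)
    (hηI : tsupport η ⊆ I) : Integrable (fun x => Q x * η x) μ :=
  (integrableOn_iff_integrable_of_support_subset
    ((Function.support_mul_subset_right _ _).trans subset_closure)).1
    ((hQ.integrableOn_compact_subset hηI hηc).mul_continuousOn hη.continuousOn hηc)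

theorem setIntegral_mul_eq_integral_of_tsupport_subset {X : Type*} [TopologicalSpace X]
    [MeasurableSpace X] {μ : Measure X} {I : Set X} {Q η : X → ℝ} (hηI : tsupport η ⊆ I) :
    ∫ x in I, Q x * η x ∂μ = ∫ x, Q x * η x ∂μ :=
  setIntegral_eq_integral_of_forall_compl_eq_zero fun x hx => by
    rw [image_eq_zero_of_notMem_tsupport fun h => hx (hηI h), mul_zero]

variable {I : Set ℝ} {u u' Q θ ψ : ℝ → ℝ}

theorem hasDerivAt_mul_of_tsupport_subset (hu : ∀ x ∈ I, HasDerivAt u (u' x) x)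
    (hψ : Differentiable ℝ ψ) (hψI : tsupport ψ ⊆ I) (x : ℝ) :
    HasDerivAt (fun x => u x * ψ x) (u x * deriv ψ x + u' x * ψ x) x := by
  by_cases hx : x ∈ tsupport ψ
  · have := (hu x (hψI hx)).mul (hψ x).hasDerivAt
    rwa [add_comm] at this
  · have hprod : x ∉ tsupport fun x => u x * ψ x := fun h => hx (tsupport_mul_subset_right h)
    have hzero := HasDerivAt.of_notMem_tsupport (𝕜 := ℝ) hprod
    rwa [deriv_of_notMem_tsupport hx, image_eq_zero_of_notMem_tsupport hx, mul_zero, mul_zero,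
      add_zero]

theorem integral_mul_deriv_eq_neg_of_tsupport_subset (hI : IsOpen I)
    (hu : ∀ x ∈ I, HasDerivAt u (u' x) x) (hu' : ContinuousOn u' I) (hψ : ContDiff ℝ 1 ψ)
    (hψc : HasCompactSupport ψ) (hψI : tsupport ψ ⊆ I) :
    ∫ x, u x * deriv ψ x = -∫ x, u' x * ψ x := by
  have hcu : ContinuousOn u I := HasDerivAt.continuousOn hu
  have hlu : LocallyIntegrableOn u I := hcu.locallyIntegrableOn hI.measurableSet
  have hlu' : LocallyIntegrableOn u' I := hu'.locallyIntegrableOn hI.measurableSet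
  have huψ' := integrable_mul_of_tsupport_subset hlu (hψ.continuous_deriv le_rfl) hψc.deriv
    (tsupport_deriv_subset.trans hψI)
  have hu'ψ := integrable_mul_of_tsupport_subset hlu' hψ.continuous hψc hψI
  rw [← add_eq_zero_iff_eq_neg, ← integral_add huψ' hu'ψ]
  exact integral_eq_zero_of_hasDerivAt_of_integrable
    (hasDerivAt_mul_of_tsupport_subset hu (hψ.differentiable one_ne_zero) hψI) (huψ'.add hu'ψ)
    (integrable_mul_of_tsupport_subset hlu hψ.continuous hψc hψI)

theorem exists_isCompact_ordConnected_between {α : Type*} [ConditionallyCompleteLinearOrder α]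
    [TopologicalSpace α] [OrderTopology α] {K I : Set α} (hK : IsCompact K) (hI : I.OrdConnected)
    (hKI : K ⊆ I) : ∃ J, IsCompact J ∧ J.OrdConnected ∧ K ⊆ J ∧ J ⊆ I := by
  rcases K.eq_empty_or_nonempty with rfl | hne
  · exact ⟨∅, isCompact_empty, ordConnected_empty, le_rfl, empty_subset I⟩
  · exact ⟨Icc (sInf K) (sSup K), isCompact_Icc, ordConnected_Icc,
      subset_Icc_csInf_csSup hK.bddBelow hK.bddAbove,
      hI.out (hKI (hK.sInf_mem hne)) (hKI (hK.sSup_mem hne))⟩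

theorem exists_testFunction_deriv_eq (hI : I.OrdConnected) (hθ : ContDiff ℝ ∞ θ)
    (hθc : HasCompactSupport θ) (hθI : tsupport θ ⊆ I) (hint : ∫ x, θ x = 0) :
    ∃ ψ : ℝ → ℝ, ContDiff ℝ ∞ ψ ∧ HasCompactSupport ψ ∧ tsupport ψ ⊆ I ∧ deriv ψ = θ := by
  let ψ : ℝ → ℝ := fun x => ∫ t in Iic x, θ t
  have hθi : Integrable θ := hθ.continuous.integrable_of_hasCompactSupport hθc
  have hψ : ∀ x, HasDerivAt ψ (θ x) x := fun x => by
    have hψ_eq : ψ = fun x => ψ 0 + ∫ t in (0)..x, θ t := funext fun x =>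
      eq_add_of_sub_eq' (intervalIntegral.integral_Iic_sub_Iic hθi.integrableOn hθi.integrableOn)
    rw [hψ_eq]
    exact (hθ.continuous.integral_hasStrictDerivAt 0 x).hasDerivAt.const_add _
  have hderiv : deriv ψ = θ := funext fun x => (hψ x).deriv
  obtain ⟨J, hJ, hJc, hθJ, hJI⟩ := exists_isCompact_ordConnected_between hθc hI hθI
  have hsupp : Function.support ψ ⊆ J := by
    intro x hx
    have hleft : ∃ t ≤ x, θ t ≠ 0 := by
      by_contra! h
      exact hx (setIntegral_eq_zero_of_forall_eq_zero h)
    have hright : ∃ t, x < t ∧ θ t ≠ 0 := by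
      by_contra! h
      exact hx ((setIntegral_eq_integral_of_forall_compl_eq_zero fun t ht =>
        h t (not_le.1 ht)).trans hint)
    obtain ⟨s, hsx, hs⟩ := hleft
    obtain ⟨t, hxt, ht⟩ := hright
    exact hJc.out (hθJ (subset_tsupport θ hs)) (hθJ (subset_tsupport θ ht)) ⟨hsx, hxt.le⟩
  refine ⟨ψ, ?_, HasCompactSupport.of_support_subset_isCompact hJ hsupp,
    (closure_minimal hsupp hJ.isClosed).trans hJI, hderiv⟩
  rw [contDiff_infty_iff_deriv, hderiv]
  exact ⟨fun x => (hψ x).differentiableAt, hθ⟩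

theorem exists_testFunction_integral_eq_one {E : Type*} [NormedAddCommGroup E] [NormedSpace ℝ E]
    [FiniteDimensional ℝ E] [MeasurableSpace E] [BorelSpace E] (μ : Measure E)
    [IsLocallyFiniteMeasure μ] [μ.IsOpenPosMeasure] {U : Set E} (hU : IsOpen U)
    (hne : U.Nonempty) :
    ∃ χ : E → ℝ, ContDiff ℝ ∞ χ ∧ HasCompactSupport χ ∧ tsupport χ ⊆ U ∧ ∫ x, χ x ∂μ = 1 := by
  obtain ⟨x₀, hx₀⟩ := hne
  obtain ⟨r, hr, hball⟩ := Metric.nhds_basis_closedBall.mem_iff.1 (hU.mem_nhds hx₀)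
  let b : ContDiffBump x₀ := ⟨r / 2, r, half_pos hr, half_lt_self hr⟩
  exact ⟨b.normed μ, b.contDiff_normed, b.hasCompactSupport_normed,
    b.tsupport_normed_eq.trans_subset hball, b.integral_normed⟩

/-- With `m = ∫ η`, the test function `η - m χ` has integral zero, so it is the derivative of a test
function. -/
theorem integral_mul_eq_integral_mul_integral_mul (hIc : I.OrdConnected)
    (hQ : LocallyIntegrableOn Q I)
    (h : ∀ ψ : ℝ → ℝ, ContDiff ℝ ∞ ψ → HasCompactSupport ψ → tsupport ψ ⊆ I →
      ∫ x, Q x * deriv ψ x = 0)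
    {χ η : ℝ → ℝ} (hχ : ContDiff ℝ ∞ χ) (hχc : HasCompactSupport χ) (hχI : tsupport χ ⊆ I)
    (hχint : ∫ x, χ x = 1) (hη : ContDiff ℝ ∞ η) (hηc : HasCompactSupport η)
    (hηI : tsupport η ⊆ I) :
    ∫ x, Q x * η x = (∫ x, η x) * ∫ x, Q x * χ x := by
  let m := ∫ x, η x
  let θ : ℝ → ℝ := fun x => η x - m * χ x
  have hθint : ∫ x, θ x = 0 := by
    rw [integral_sub (hη.continuous.integrable_of_hasCompactSupport hηc)
      ((hχ.continuous.integrable_of_hasCompactSupport hχc).const_mul m), integral_const_mul, hχint,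
      mul_one, sub_self]
  have hmχI : tsupport (fun x => m * χ x) ⊆ I :=
    (tsupport_mul_subset_right (f := fun _ => m)).trans hχI
  obtain ⟨ψ, hψ, hψc, hψI, hψθ⟩ := exists_testFunction_deriv_eq (θ := θ) hIc
    (hη.sub (contDiff_const.mul hχ)) (hηc.sub (hχc.mul_left (f := fun _ => m)))
    ((tsupport_sub _ _).trans (union_subset hηI hmχI)) hθint
  have hQη := integrable_mul_of_tsupport_subset hQ hη.continuous hηc hηI
  have hQχ := integrable_mul_of_tsupport_subset hQ hχ.continuous hχc hχI
  rw [← sub_eq_zero, ← integral_const_mul, ← integral_sub hQη (hQχ.const_mul m),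
    ← h ψ hψ hψc hψI, hψθ]
  exact integral_congr_ae (.of_forall fun x => by simp only [θ]; ring)

theorem ae_eq_const_of_integral_mul_deriv_eq_zero (hI : IsOpen I) (hIc : I.OrdConnected)
    (hne : I.Nonempty) (hQ : LocallyIntegrableOn Q I)
    (h : ∀ ψ : ℝ → ℝ, ContDiff ℝ ∞ ψ → HasCompactSupport ψ → tsupport ψ ⊆ I →
      ∫ x, Q x * deriv ψ x = 0) :
    ∃ C, ∀ᵐ x, x ∈ I → Q x = C := by
  obtain ⟨χ, hχ, hχc, hχI, hχint⟩ := exists_testFunction_integral_eq_one volume hI hne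
  let C := ∫ x, Q x * χ x
  have hQC : LocallyIntegrableOn (fun x => Q x - C) I :=
    hQ.sub (continuous_const.locallyIntegrable.locallyIntegrableOn I)
  suffices hzero : ∀ᵐ x, x ∈ I → Q x - C = 0 from
    ⟨C, hzero.mono fun x hx hxI => sub_eq_zero.1 (hx hxI)⟩
  refine hI.ae_eq_zero_of_integral_contDiff_smul_eq_zero hQC fun η hη hηc hηI => ?_
  have hηi : Integrable η := hη.continuous.integrable_of_hasCompactSupport hηc
  have hQη := integrable_mul_of_tsupport_subset hQ hη.continuous hηc hηI
  calc ∫ x, η x • (Q x - C)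
      = ∫ x, Q x * η x - η x * C :=
        integral_congr_ae (.of_forall fun x => by simp only [smul_eq_mul]; ring)
    _ = (∫ x, Q x * η x) - (∫ x, η x) * C := by
        rw [integral_sub hQη (hηi.mul_const C), integral_mul_const]
    _ = 0 := sub_eq_zero.2
        (integral_mul_eq_integral_mul_integral_mul hIc hQ h hχ hχc hχI hχint hη hηc hηI)

end TestFunctions

section AbsoluteContinuity

variable {X Y : Type*} [PseudoMetricSpace X] [PseudoMetricSpace Y] {a b K M : ℝ}

theorem absolutelyContinuousOnInterval_of_dist_le {F : ℝ → X} {φ : ℝ → Y}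
    (hφ : AbsolutelyContinuousOnInterval φ a b)
    (h : ∀ x ∈ uIcc a b, ∀ y ∈ uIcc a b, dist (F x) (F y) ≤ K * dist (φ x) (φ y) + M * dist x y) :
    AbsolutelyContinuousOnInterval F a b := by
  have hid : AbsolutelyContinuousOnInterval (fun x : ℝ => x) a b :=
    (LipschitzWith.id.lipschitzOnWith (s := uIcc a b)).absolutelyContinuousOnInterval
  have hlim := (Tendsto.const_mul K hφ).add (Tendsto.const_mul M hid)
  simp only [mul_zero, add_zero] at hlim
  refine squeeze_zero' (.of_forall fun E => Finset.sum_nonneg fun _ _ => dist_nonneg) ?_ hlim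
  filter_upwards [inf_le_right (a := AbsolutelyContinuousOnInterval.totalLengthFilter)
    (mem_principal_self (AbsolutelyContinuousOnInterval.disjWithin a b))] with E hE
  rw [Finset.mul_sum, Finset.mul_sum, ← Finset.sum_add_distrib]
  exact Finset.sum_le_sum fun i hi => h _ (hE.1 i hi).1 _ (hE.1 i hi).2

theorem absolutelyContinuousOnInterval_of_integral_eq {F u : ℝ → ℝ}
    (hu : IntervalIntegrable u volume a b) (h : ∀ x ∈ uIcc a b, F x - F a = ∫ t in a..x, u t) :
    AbsolutelyContinuousOnInterval F a b :=
  absolutelyContinuousOnInterval_of_dist_le (K := 1) (M := 0)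
    (hu.absolutelyContinuousOnInterval_intervalIntegral left_mem_uIcc) fun x hx y hy => by
      simp [← h x hx, ← h y hy]

theorem absolutelyContinuousOnInterval_comp_neg {F : ℝ → ℝ}
    (h : AbsolutelyContinuousOnInterval F (-a) (-b)) :
    AbsolutelyContinuousOnInterval (fun x => F (-x)) a b := by
  have hint : IntervalIntegrable (fun t => -deriv F (-t)) volume a b := by
    simpa [Pi.neg_def] using (h.intervalIntegrable_deriv.comp_sub_left 0).neg
  refine absolutelyContinuousOnInterval_of_integral_eq hint fun x hx => ?_
  have hneg : -x ∈ uIcc (-a) (-b) := (image_neg_uIcc (a := a) (b := b)) ▸ mem_image_of_mem _ hx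
  rw [intervalIntegral.integral_neg, intervalIntegral.integral_comp_neg,
    intervalIntegral.integral_symm, neg_neg,
    (h.mono (uIcc_subset_uIcc left_mem_uIcc hneg)).integral_deriv_eq_sub]

theorem absolutelyContinuousOnInterval_of_antitoneOn {φ : ℝ → ℝ}
    (hanti : AntitoneOn φ (uIcc a b)) (hd : ∀ x ∈ uIcc a b, DifferentiableAt ℝ φ x) :
    AbsolutelyContinuousOnInterval φ a b := by
  have hint : IntervalIntegrable (deriv φ) volume a b := by
    simpa [Pi.neg_def] using hanti.neg.intervalIntegrable_deriv.neg
  refine absolutelyContinuousOnInterval_of_integral_eq hint fun x hx => ?_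
  have hsub : uIcc a x ⊆ uIcc a b := uIcc_subset_uIcc left_mem_uIcc hx
  exact (intervalIntegral.integral_eq_sub_of_hasDerivAt
    (fun t ht => (hd t (hsub ht)).hasDerivAt) (hint.mono_set hsub)).symm

end AbsoluteContinuity

/-- The assumptions on the coefficients shared by the cases (D) and (D̃), for the parts of the
theory that do not depend on how `D` vanishes at `R`. -/
structure IsAdmissible (R : ℝ) (f D g : ℝ → ℝ) : Prop where
  R_pos : 0 < R
  f_contDiffOn : ContDiffOn ℝ 1 f (Icc 0 R)
  g_continuousOn : ContinuousOn g (Icc 0 R)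
  g_pos : ∀ s ∈ Ico 0 R, 0 < g s
  g_right : g R = 0
  D_continuousOn : ContinuousOn D (Icc 0 R)
  D_right : D R = 0
  D_pos : ∀ s ∈ Ioo 0 R, 0 < D s

theorem Standing.isAdmissible {R : ℝ} {f D g : ℝ → ℝ} (hs : Standing R f g) (hR : 0 < R)
    (hg : CondG R g) (hD : CondD R D ∨ CondDTilde R D g) : IsAdmissible R f D g where
  R_pos := hR
  f_contDiffOn := hs.f_contDiff
  g_continuousOn := hs.g_continuous
  g_pos := hg.pos
  g_right := hg.zero
  D_continuousOn := hD.elim (fun h => h.contDiff.continuousOn) fun h => h.continuous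
  D_right := hD.elim (fun h => h.zero) fun h => h.zero
  D_pos := hD.elim (fun h => h.pos) fun h => h.pos

/-- The primitive `∫₀ˣ D` of the diffusivity; for an admissible `D` it is a strictly increasing
function of the density, whose derivative along a profile is the diffusive term. -/
def primD (D : ℝ → ℝ) (x : ℝ) : ℝ := ∫ s in (0 : ℝ)..x, D s

namespace IsAdmissible

variable {R : ℝ} {f D g : ℝ → ℝ} (A : IsAdmissible R f D g)
include A

theorem zero_mem : (0 : ℝ) ∈ Icc 0 R := left_mem_Icc.2 A.R_pos.le

theorem right_mem : R ∈ Icc 0 R := right_mem_Icc.2 A.R_pos.le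

theorem g_nonneg : ∀ s ∈ Icc 0 R, 0 ≤ g s := by
  intro s hs
  rcases hs.2.eq_or_lt with rfl | h
  · exact A.g_right.ge
  · exact (A.g_pos s ⟨hs.1, h⟩).le

theorem advSpeed_continuousOn : ContinuousOn (advSpeed R f) (Icc 0 R) :=
  A.f_contDiffOn.continuousOn_derivWithin (uniqueDiffOn_Icc A.R_pos) le_rfl

theorem f_hasDerivWithinAt {s : ℝ} (hs : s ∈ Icc 0 R) :
    HasDerivWithinAt f (advSpeed R f s) (Icc 0 R) s :=
  (A.f_contDiffOn.differentiableOn one_ne_zero s hs).hasDerivWithinAt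

theorem primD_sub {a b : ℝ} (ha : a ∈ Icc 0 R) (hb : b ∈ Icc 0 R) :
    primD D b - primD D a = ∫ s in a..b, D s :=
  have hint {t : ℝ} (ht : t ∈ Icc 0 R) : IntervalIntegrable D volume 0 t :=
    (A.D_continuousOn.mono (ordConnected_Icc.uIcc_subset A.zero_mem ht)).intervalIntegrable
  intervalIntegral.integral_interval_sub_left (hint hb) (hint ha)

theorem primD_hasDerivWithinAt {s : ℝ} (hs : s ∈ Icc 0 R) :
    HasDerivWithinAt (primD D) (D s) (Icc 0 R) s := by
  have := Fact.mk hs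
  exact intervalIntegral.integral_hasDerivWithinAt_right
    (A.D_continuousOn.mono (ordConnected_Icc.uIcc_subset A.zero_mem hs)).intervalIntegrable
    (A.D_continuousOn.stronglyMeasurableAtFilter_nhdsWithin measurableSet_Icc s)
    (A.D_continuousOn s hs)

theorem primD_hasStrictDerivAt {s : ℝ} (hs : s ∈ Ioo 0 R) :
    HasStrictDerivAt (primD D) (D s) s :=
  intervalIntegral.integral_hasStrictDerivAt_right
    (A.D_continuousOn.mono (ordConnected_Icc.uIcc_subset A.zero_mem
      (Ioo_subset_Icc_self hs))).intervalIntegrable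
    ((A.D_continuousOn.mono Ioo_subset_Icc_self).stronglyMeasurableAtFilter isOpen_Ioo s hs)
    (A.D_continuousOn.continuousAt (Icc_mem_nhds hs.1 hs.2))

theorem primD_continuousOn : ContinuousOn (primD D) (Icc 0 R) := by
  rw [← uIcc_of_le A.R_pos.le]
  refine intervalIntegral.continuousOn_primitive_interval ?_
  rw [uIcc_of_le A.R_pos.le]
  exact A.D_continuousOn.integrableOn_Icc

theorem primD_strictMonoOn : StrictMonoOn (primD D) (Icc 0 R) := by
  refine strictMonoOn_of_hasDerivWithinAt_pos (f' := D) (convex_Icc _ _) A.primD_continuousOn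
    (fun s hs => ?_) fun s hs => ?_ <;> rw [interior_Icc] at hs
  · exact (A.primD_hasStrictDerivAt hs).hasDerivAt.hasDerivWithinAt
  · exact A.D_pos s hs

theorem primD_nonneg {s : ℝ} (hs : s ∈ Icc 0 R) : 0 ≤ primD D s := by
  simpa [primD] using A.primD_strictMonoOn.monotoneOn A.zero_mem hs hs.1

end IsAdmissible

/-- The integrated form of the traveling-wave equation: `Z` is the continuous representative of
the diffusive term `D(φ) φ'`, that is, the derivative of `primD D ∘ φ`. -/
structure IsIntegratedWave (R : ℝ) (f D g : ℝ → ℝ) (c : ℝ) (I : Set ℝ) (φ Z : ℝ → ℝ) :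
    Prop where
  isOpen : IsOpen I
  ordConnected : I.OrdConnected
  mapsTo : MapsTo φ I (Icc 0 R)
  continuousOn : ContinuousOn φ I
  hasDerivAt : ∀ ξ ∈ I, HasDerivAt (fun η => primD D (φ η)) (Z ξ) ξ
  balance : ∀ a ∈ I, ∀ b ∈ I,
    Z b - Z a = (f (φ b) - c * φ b) - (f (φ a) - c * φ a) - ∫ ξ in a..b, g (φ ξ)

section IntegratedEquation

variable {R : ℝ} {f D g : ℝ → ℝ} {c : ℝ} {I : Set ℝ} {φ : ℝ → ℝ}

theorem IsTravelingWave.exists_flux_ae_eq (h : IsTravelingWave R f D g c I φ)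
    (A : IsAdmissible R f D g) {x₀ : ℝ} (hx₀ : x₀ ∈ I) :
    ∃ C, ∀ᵐ ξ, ξ ∈ I →
      flux D φ ξ = C + (f (φ ξ) - c * φ ξ) - ∫ t in x₀..ξ, g (φ t) := by
  have hI := h.isOpen.measurableSet
  have hgφ : ContinuousOn (fun ξ => g (φ ξ)) I := A.g_continuousOn.comp h.continuous h.mapsTo
  have hfφ : ContinuousOn (fun ξ => f (φ ξ)) I :=
    A.f_contDiffOn.continuousOn.comp h.continuous h.mapsTo
  have hG : ∀ ξ ∈ I, HasDerivAt (fun ξ => ∫ t in x₀..ξ, g (φ t)) (g (φ ξ)) ξ := fun ξ hξ =>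
    hasDerivAt_integral_of_continuousOn h.isOpen h.ordConnected hgφ hx₀ hξ
  have hGloc := (HasDerivAt.continuousOn hG).locallyIntegrableOn (μ := volume) hI
  have hP : LocallyIntegrableOn (fun ξ => flux D φ ξ - f (φ ξ) + c * φ ξ) I :=
    (h.flux_locallyIntegrable.sub (hfφ.locallyIntegrableOn hI)).add
      ((h.continuous.const_mul c).locallyIntegrableOn hI)
  obtain ⟨C, hC⟩ := ae_eq_const_of_integral_mul_deriv_eq_zero h.isOpen h.ordConnected ⟨x₀, hx₀⟩
    (hP.add hGloc) fun ψ hψ hψc hψI => by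
      have hψ' : tsupport (deriv ψ) ⊆ I := tsupport_deriv_subset.trans hψI
      have hPi := integrable_mul_of_tsupport_subset hP (hψ.continuous_deriv (by simp))
        hψc.deriv hψ'
      have hGi := integrable_mul_of_tsupport_subset hGloc (hψ.continuous_deriv (by simp))
        hψc.deriv hψ'
      have hgi := integrable_mul_of_tsupport_subset (hgφ.locallyIntegrableOn (μ := volume) hI)
        hψ.continuous hψc hψI
      have hparts := integral_mul_deriv_eq_neg_of_tsupport_subset h.isOpen hG hgφ
        (hψ.of_le (by simp)) hψc hψI
      have hweak := h.weak_eq ψ hψ hψc hψI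
      rw [integral_sub hPi.integrableOn hgi.integrableOn,
        setIntegral_mul_eq_integral_of_tsupport_subset hψ',
        setIntegral_mul_eq_integral_of_tsupport_subset hψI] at hweak
      simp only [Pi.add_apply, add_mul _ _ (deriv ψ _)]
      rw [integral_add (by simpa only [add_mul] using hPi) hGi, hparts]
      simpa only [add_mul, sub_eq_add_neg] using hweak
  refine ⟨C, hC.mono fun ξ hξ hξI => ?_⟩
  have := hξ hξI
  simp only [Pi.add_apply] at this
  linarith

theorem IsTravelingWave.exists_isIntegratedWave (h : IsTravelingWave R f D g c I φ)
    (A : IsAdmissible R f D g) (hne : I.Nonempty) : ∃ Z, IsIntegratedWave R f D g c I φ Z := by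
  obtain ⟨x₀, hx₀⟩ := hne
  obtain ⟨C, hC⟩ := h.exists_flux_ae_eq A hx₀
  set Z : ℝ → ℝ := fun ξ => C + (f (φ ξ) - c * φ ξ) - ∫ t in x₀..ξ, g (φ t) with hZ
  have hgφ : ContinuousOn (fun ξ => g (φ ξ)) I := A.g_continuousOn.comp h.continuous h.mapsTo
  have hZc : ContinuousOn Z I :=
    (continuousOn_const.add ((A.f_contDiffOn.continuousOn.comp h.continuous h.mapsTo).sub
      (h.continuous.const_mul c))).sub (HasDerivAt.continuousOn fun ξ hξ =>
        hasDerivAt_integral_of_continuousOn h.isOpen h.ordConnected hgφ hx₀ hξ)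
  refine ⟨Z, h.isOpen, h.ordConnected, h.mapsTo, h.continuous, fun ξ hξ => ?_, fun a ha b hb => ?_⟩
  · refine ((hasDerivAt_integral_of_continuousOn h.isOpen h.ordConnected hZc hx₀ hξ).const_add
      (primD D (φ x₀))).congr_of_eventuallyEq ?_
    filter_upwards [h.isOpen.mem_nhds hξ] with η hη
    have hflux : ∫ ξ in x₀..η, flux D φ ξ = ∫ ξ in x₀..η, Z ξ :=
      intervalIntegral.integral_congr_ae <| hC.mono fun t ht hts =>
        ht (h.ordConnected.uIcc_subset hx₀ hη (uIoc_subset_uIcc hts))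
    rw [← hflux, ← h.flux_weak x₀ hx₀ η hη, ← A.primD_sub (h.mapsTo hx₀) (h.mapsTo hη)]
    ring
  · have hint : ∀ t ∈ I, IntervalIntegrable (fun ξ => g (φ ξ)) volume x₀ t := fun t ht =>
      (hgφ.mono (h.ordConnected.uIcc_subset hx₀ ht)).intervalIntegrable
    simp only [hZ]
    linarith [intervalIntegral.integral_interval_sub_left (hint b hb) (hint a ha)]

namespace IsIntegratedWave

variable {Z : ℝ → ℝ}

theorem mono {J : Set ℝ} (h : IsIntegratedWave R f D g c I φ Z)
    (hJ : IsOpen J) (hJc : J.OrdConnected) (hJI : J ⊆ I) : IsIntegratedWave R f D g c J φ Z where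
  isOpen := hJ
  ordConnected := hJc
  mapsTo := h.mapsTo.mono_left hJI
  continuousOn := h.continuousOn.mono hJI
  hasDerivAt := fun ξ hξ => h.hasDerivAt ξ (hJI hξ)
  balance := fun a ha b hb => h.balance a (hJI ha) b (hJI hb)

theorem eventually_mapsTo (h : IsIntegratedWave R f D g c I φ Z) {ξ : ℝ} (hξ : ξ ∈ I) :
    ∀ᶠ η in 𝓝 ξ, φ η ∈ Icc 0 R :=
  mem_of_superset (h.isOpen.mem_nhds hξ) h.mapsTo

theorem hasDerivAt_density (h : IsIntegratedWave R f D g c I φ Z) (A : IsAdmissible R f D g)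
    {ξ : ℝ} (hξ : ξ ∈ I) (hφ : φ ξ ∈ Ioo 0 R) : HasDerivAt φ (Z ξ / D (φ ξ)) ξ := by
  have hs := A.primD_hasStrictDerivAt hφ
  have hD := (A.D_pos _ hφ).ne'
  have hd := (hs.to_localInverse hD).hasDerivAt.comp ξ (h.hasDerivAt ξ hξ)
  rw [inv_mul_eq_div] at hd
  refine hd.congr_of_eventuallyEq ?_
  have hinv := (hs.hasStrictFDerivAt_equiv hD).eventually_left_inverse
  exact ((h.continuousOn.continuousAt (h.isOpen.mem_nhds hξ)).eventually hinv).mono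
    fun η hη => hη.symm

theorem eventually_flux_eq (h : IsIntegratedWave R f D g c I φ Z) {ξ : ℝ} (hξ : ξ ∈ I) :
    Z =ᶠ[𝓝 ξ] fun η => Z ξ + (((f (φ η) - c * φ η) - (f (φ ξ) - c * φ ξ)) -
      ∫ t in ξ..η, g (φ t)) := by
  filter_upwards [h.isOpen.mem_nhds hξ] with η hη
  linarith [h.balance ξ hξ η hη]

theorem hasDerivAt_integral_source (h : IsIntegratedWave R f D g c I φ Z)
    (A : IsAdmissible R f D g) {ξ : ℝ} (hξ : ξ ∈ I) :
    HasDerivAt (fun η => ∫ t in ξ..η, g (φ t)) (g (φ ξ)) ξ :=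
  hasDerivAt_integral_of_continuousOn h.isOpen h.ordConnected
    (A.g_continuousOn.comp h.continuousOn h.mapsTo) hξ hξ

theorem continuousOn_flux (h : IsIntegratedWave R f D g c I φ Z) (A : IsAdmissible R f D g) :
    ContinuousOn Z I := by
  intro ξ hξ
  have hfφ : ContinuousOn (fun ξ => f (φ ξ) - c * φ ξ) I :=
    (A.f_contDiffOn.continuousOn.comp h.continuousOn h.mapsTo).sub (h.continuousOn.const_mul c)
  have hfφξ := hfφ.continuousAt (h.isOpen.mem_nhds hξ)
  exact ((continuousAt_const.add ((hfφξ.sub continuousAt_const).sub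
    (h.hasDerivAt_integral_source A hξ).continuousAt)).congr
      (h.eventually_flux_eq hξ).symm).continuousWithinAt

theorem hasDerivAt_flux (h : IsIntegratedWave R f D g c I φ Z) (A : IsAdmissible R f D g)
    {ξ φ' : ℝ} (hξ : ξ ∈ I) (hφ : HasDerivAt φ φ' ξ) :
    HasDerivAt Z ((advSpeed R f (φ ξ) - c) * φ' - g (φ ξ)) ξ := by
  have hf : HasDerivAt (fun η => f (φ η)) (advSpeed R f (φ ξ) * φ') ξ :=
    (A.f_hasDerivWithinAt (h.mapsTo hξ)).comp_hasDerivAt ξ hφ (h.eventually_mapsTo hξ)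
  have := ((((hf.sub (hφ.const_mul c)).sub_const (f (φ ξ) - c * φ ξ)).sub
    (h.hasDerivAt_integral_source A hξ)).const_add (Z ξ))
  rw [← sub_mul] at this
  exact this.congr_of_eventuallyEq (h.eventually_flux_eq hξ)

theorem flux_eq_of_differentiableAt (h : IsIntegratedWave R f D g c I φ Z)
    (A : IsAdmissible R f D g) {ξ : ℝ} (hξ : ξ ∈ I) (hφ : DifferentiableAt ℝ φ ξ) :
    flux D φ ξ = Z ξ :=
  ((A.primD_hasDerivWithinAt (h.mapsTo hξ)).comp_hasDerivAt ξ hφ.hasDerivAt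
    (h.eventually_mapsTo hξ)).unique (h.hasDerivAt ξ hξ)

theorem flux_eq_zero_of_eq_zero (h : IsIntegratedWave R f D g c I φ Z) (A : IsAdmissible R f D g)
    {ξ : ℝ} (hξ : ξ ∈ I) (hφ : φ ξ = 0) : Z ξ = 0 := by
  refine IsLocalMin.hasDerivAt_eq_zero ?_ (h.hasDerivAt ξ hξ)
  filter_upwards [h.isOpen.mem_nhds hξ] with η hη
  rw [hφ]
  exact A.primD_strictMonoOn.monotoneOn A.zero_mem (h.mapsTo hη) (h.mapsTo hη).1

theorem flux_eq_zero_of_eq_right (h : IsIntegratedWave R f D g c I φ Z)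
    (A : IsAdmissible R f D g) {ξ : ℝ} (hξ : ξ ∈ I) (hφ : φ ξ = R) : Z ξ = 0 := by
  refine IsLocalMax.hasDerivAt_eq_zero ?_ (h.hasDerivAt ξ hξ)
  filter_upwards [h.isOpen.mem_nhds hξ] with η hη
  rw [hφ]
  exact A.primD_strictMonoOn.monotoneOn (h.mapsTo hη) A.right_mem (h.mapsTo hη).2

theorem flux_nonpos_of_antitoneOn (h : IsIntegratedWave R f D g c I φ Z)
    (A : IsAdmissible R f D g) (hanti : AntitoneOn φ I) : ∀ ξ ∈ I, Z ξ ≤ 0 := by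
  intro ξ hξ
  have hprim : AntitoneOn (fun η => primD D (φ η)) I :=
    MonotoneOn.comp_AntitoneOn (t := Icc 0 R) A.primD_strictMonoOn.monotoneOn hanti h.mapsTo
  have hnonpos := hprim.derivWithin_nonpos (x := ξ)
  rwa [derivWithin_of_isOpen h.isOpen hξ, (h.hasDerivAt ξ hξ).deriv] at hnonpos

theorem antitoneOn_of_flux_nonpos (h : IsIntegratedWave R f D g c I φ Z)
    (A : IsAdmissible R f D g) {S : Set ℝ} (hS : Convex ℝ S) (hSI : S ⊆ I)
    (hZ : ∀ ξ ∈ interior S, Z ξ ≤ 0) : AntitoneOn φ S := by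
  have hprim : AntitoneOn (fun η => primD D (φ η)) S :=
    antitoneOn_of_hasDerivWithinAt_nonpos hS
      (fun ξ hξ => (h.hasDerivAt ξ (hSI hξ)).continuousAt.continuousWithinAt)
      (fun ξ hξ => (h.hasDerivAt ξ (hSI (interior_subset hξ))).hasDerivWithinAt) hZ
  exact fun a ha b hb hab => (A.primD_strictMonoOn.le_iff_le (h.mapsTo (hSI hb))
    (h.mapsTo (hSI ha))).1 (hprim ha hb hab)

theorem strictAntiOn_of_flux_neg (h : IsIntegratedWave R f D g c I φ Z)
    (A : IsAdmissible R f D g) {S : Set ℝ} (hS : Convex ℝ S) (hSI : S ⊆ I)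
    (hZ : ∀ ξ ∈ interior S, Z ξ < 0) : StrictAntiOn φ S := by
  have hprim : StrictAntiOn (fun η => primD D (φ η)) S :=
    strictAntiOn_of_hasDerivWithinAt_neg hS
      (fun ξ hξ => (h.hasDerivAt ξ (hSI hξ)).continuousAt.continuousWithinAt)
      (fun ξ hξ => (h.hasDerivAt ξ (hSI (interior_subset hξ))).hasDerivWithinAt) hZ
  exact fun a ha b hb hab => (A.primD_strictMonoOn.lt_iff_lt (h.mapsTo (hSI hb))
    (h.mapsTo (hSI ha))).1 (hprim ha hb hab)

theorem mul_sub_le_primD (h : IsIntegratedWave R f D g c I φ Z) (A : IsAdmissible R f D g)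
    {a b e : ℝ} (hab : a ≤ b) (hI : Icc a b ⊆ I) (hZ : ∀ ξ ∈ Icc a b, Z ξ ≤ -e) :
    e * (b - a) ≤ primD D R := by
  have ha : a ∈ Icc a b := left_mem_Icc.2 hab
  have hb : b ∈ Icc a b := right_mem_Icc.2 hab
  have hdrop : primD D (φ b) - primD D (φ a) ≤ -e * (b - a) :=
    Convex.image_sub_le_mul_sub_of_deriv_le (convex_Icc a b)
      (fun x hx => (h.hasDerivAt x (hI hx)).continuousAt.continuousWithinAt)
      (fun x hx => (h.hasDerivAt x
        (hI (interior_subset hx))).differentiableAt.differentiableWithinAt)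
      (fun x hx => (h.hasDerivAt x (hI (interior_subset hx))).deriv ▸ hZ x (interior_subset hx))
      a ha b hb hab
  have hφa := h.mapsTo (hI ha)
  linarith [A.primD_nonneg (h.mapsTo (hI hb)),
    A.primD_strictMonoOn.monotoneOn hφa A.right_mem hφa.2]

theorem integral_source_pos (h : IsIntegratedWave R f D g c I φ Z) (A : IsAdmissible R f D g)
    {a b : ℝ} (hab : a < b) (hI : Icc a b ⊆ I) (hlt : ∀ ξ ∈ Ioo a b, φ ξ < R) :
    0 < ∫ ξ in a..b, g (φ ξ) := by
  have hgφ : ContinuousOn (fun ξ => g (φ ξ)) (uIcc a b) := by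
    rw [uIcc_of_le hab.le]
    exact (A.g_continuousOn.comp h.continuousOn h.mapsTo).mono hI
  exact intervalIntegral.intervalIntegral_pos_of_pos_on hgφ.intervalIntegrable
    (fun x hx => A.g_pos _ ⟨(h.mapsTo (hI (Ioo_subset_Icc_self hx))).1, hlt x hx⟩) hab

theorem pos_of_antitoneOn (h : IsIntegratedWave R f D g c I φ Z) (A : IsAdmissible R f D g)
    (hanti : AntitoneOn φ I) : ∀ ξ ∈ I, 0 < φ ξ := by
  intro ξ hξ
  refine (h.mapsTo hξ).1.lt_of_ne' fun h0 => ?_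
  obtain ⟨b, hξb, hb⟩ := mem_nhdsGE_iff_exists_Icc_subset.1
    (mem_nhdsWithin_of_mem_nhds (h.isOpen.mem_nhds hξ))
  have hz : ∀ η ∈ Icc ξ b, φ η = 0 := fun η hη =>
    le_antisymm (h0 ▸ hanti hξ (hb hη) hη.1) (h.mapsTo (hb hη)).1
  have hφb := hz b (right_mem_Icc.2 (le_of_lt hξb))
  have hbI := hb (right_mem_Icc.2 (le_of_lt hξb))
  have hint := h.integral_source_pos A hξb hb fun η hη =>
    hz η (Ioo_subset_Icc_self hη) ▸ A.R_pos
  have hbal := h.balance ξ hξ b hbI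
  rw [h.flux_eq_zero_of_eq_zero A hξ h0, h.flux_eq_zero_of_eq_zero A hbI hφb, h0, hφb] at hbal
  linarith

theorem hasDerivAt_flux_sub_convection (h : IsIntegratedWave R f D g c I φ Z)
    (A : IsAdmissible R f D g) {ξ : ℝ} (hξ : ξ ∈ I) :
    HasDerivAt (fun η => Z η - f (φ η) + c * φ η) (-g (φ ξ)) ξ := by
  refine ((h.hasDerivAt_integral_source A hξ).neg.const_add
    (Z ξ - f (φ ξ) + c * φ ξ)).congr_of_eventuallyEq ?_
  filter_upwards [h.eventually_flux_eq hξ] with η hη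
  simp only [Pi.neg_apply]
  rw [hη]
  ring

theorem integral_weak_eq (h : IsIntegratedWave R f D g c I φ Z) (A : IsAdmissible R f D g)
    {ψ : ℝ → ℝ} (hψ : ContDiff ℝ 1 ψ) (hψc : HasCompactSupport ψ) (hψI : tsupport ψ ⊆ I) :
    ∫ ξ in I, ((Z ξ - f (φ ξ) + c * φ ξ) * deriv ψ ξ - g (φ ξ) * ψ ξ) = 0 := by
  have hI := h.isOpen.measurableSet
  have hψ' : tsupport (deriv ψ) ⊆ I := tsupport_deriv_subset.trans hψI
  have hgφ : ContinuousOn (fun ξ => g (φ ξ)) I := A.g_continuousOn.comp h.continuousOn h.mapsTo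
  have hU : ∀ ξ ∈ I, HasDerivAt (fun η => Z η - f (φ η) + c * φ η) (-g (φ ξ)) ξ := fun ξ hξ =>
    h.hasDerivAt_flux_sub_convection A hξ
  have hUi := integrable_mul_of_tsupport_subset
    ((HasDerivAt.continuousOn hU).locallyIntegrableOn (μ := volume) hI)
    (hψ.continuous_deriv le_rfl) hψc.deriv hψ'
  have hgi := integrable_mul_of_tsupport_subset (hgφ.locallyIntegrableOn (μ := volume) hI)
    hψ.continuous hψc hψI
  have hparts := integral_mul_deriv_eq_neg_of_tsupport_subset h.isOpen hU hgφ.neg hψ hψc hψI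
  simp only [neg_mul, integral_neg, neg_neg] at hparts
  rw [integral_sub hUi.integrableOn hgi.integrableOn,
    setIntegral_mul_eq_integral_of_tsupport_subset hψ',
    setIntegral_mul_eq_integral_of_tsupport_subset hψI, hparts, sub_self]

theorem isTravelingWave (h : IsIntegratedWave R f D g c I φ Z) (A : IsAdmissible R f D g)
    (hd : ∀ᵐ ξ ∂volume.restrict I, DifferentiableAt ℝ φ ξ) : IsTravelingWave R f D g c I φ := by
  have hI := h.isOpen.measurableSet
  have hZ := h.continuousOn_flux A
  have hflux : ∀ᵐ ξ, ξ ∈ I → flux D φ ξ = Z ξ := by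
    filter_upwards [(ae_restrict_iff' hI).1 hd] with ξ hφ hξ
    exact h.flux_eq_of_differentiableAt A hξ (hφ hξ)
  refine ⟨h.isOpen, h.ordConnected, h.mapsTo, h.continuousOn, hd,
    (hZ.locallyIntegrableOn hI).congr ((ae_restrict_iff' hI).2 (hflux.mono fun ξ hξ hξI =>
      (hξ hξI).symm)), fun a ha b hb => ?_, fun ψ hψ hψc hψI => ?_⟩
  · have hab : uIcc a b ⊆ I := h.ordConnected.uIcc_subset ha hb
    rw [← A.primD_sub (h.mapsTo ha) (h.mapsTo hb),
      intervalIntegral.integral_congr_ae (hflux.mono fun ξ hξ hξab =>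
        hξ (hab (uIoc_subset_uIcc hξab)))]
    exact (intervalIntegral.integral_eq_sub_of_hasDerivAt (fun ξ hξ => h.hasDerivAt ξ (hab hξ))
      (hZ.mono hab).intervalIntegrable).symm
  · rw [← h.integral_weak_eq A (hψ.of_le (by simp)) hψc hψI]
    refine setIntegral_congr_ae hI (hflux.mono fun ξ hξ hξI => ?_)
    rw [hξ hξI]

theorem exists_dist_flux_le (h : IsIntegratedWave R f D g c I φ Z) (A : IsAdmissible R f D g) :
    ∃ K M, ∀ a ∈ I, ∀ b ∈ I, dist (Z a) (Z b) ≤ K * dist (φ a) (φ b) + M * dist a b := by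
  obtain ⟨K, hK⟩ := A.f_contDiffOn.exists_lipschitzOnWith one_ne_zero (convex_Icc _ _)
    isCompact_Icc
  obtain ⟨M, hM⟩ := isCompact_Icc.exists_bound_of_continuousOn A.g_continuousOn
  refine ⟨K + |c|, M, fun a ha b hb => ?_⟩
  have hf := hK.dist_le_mul _ (h.mapsTo ha) _ (h.mapsTo hb)
  have hg : |∫ ξ in b..a, g (φ ξ)| ≤ M * |a - b| :=
    intervalIntegral.norm_integral_le_of_norm_le_const fun ξ hξ =>
      hM _ (h.mapsTo (h.ordConnected.uIcc_subset hb ha (uIoc_subset_uIcc hξ)))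
  simp only [Real.dist_eq] at hf ⊢
  calc |Z a - Z b|
      = |f (φ a) - f (φ b) - c * (φ a - φ b) - ∫ ξ in b..a, g (φ ξ)| := by
        rw [h.balance b hb a ha]; ring_nf
    _ ≤ |f (φ a) - f (φ b)| + |c * (φ a - φ b)| + |∫ ξ in b..a, g (φ ξ)| :=
        (abs_sub _ _).trans (add_le_add_left (abs_sub _ _) _)
    _ ≤ (K + |c|) * |φ a - φ b| + M * |a - b| := by
        rw [abs_mul, add_mul]
        gcongr

theorem isClassicalOn (h : IsIntegratedWave R f D g c I φ Z) (A : IsAdmissible R f D g)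
    (hanti : AntitoneOn φ I) {J : Set ℝ} (hJ : IsOpen J) (hJI : J ⊆ I)
    (hd : ∀ ξ ∈ J, DifferentiableAt ℝ φ ξ) : IsClassicalOn R f D g c J φ := by
  have hflux : EqOn (flux D φ) Z J := fun ξ hξ =>
    h.flux_eq_of_differentiableAt A (hJI hξ) (hd ξ hξ)
  refine ⟨hd, fun a b hab => ?_, (ae_restrict_iff' hJ.measurableSet).2 (ae_of_all _ fun ξ hξ => ?_)⟩
  · obtain ⟨K, M, hKM⟩ := h.exists_dist_flux_le A
    refine absolutelyContinuousOnInterval_of_dist_le (K := K) (M := M)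
      (absolutelyContinuousOnInterval_of_antitoneOn
        (hanti.mono (hab.trans hJI)) fun ξ hξ => hd ξ (hab hξ)) fun a ha b hb => ?_
    rw [hflux (hab ha), hflux (hab hb)]
    exact hKM a (hJI (hab ha)) b (hJI (hab hb))
  · rw [(hflux.eventuallyEq_of_mem (hJ.mem_nhds hξ)).deriv_eq,
      (h.hasDerivAt_flux A (hJI hξ) (hd ξ hξ).hasDerivAt).deriv]
    ring

end IsIntegratedWave

end IntegratedEquation

/-- The first-order problem for `y = -D(φ) φ'` as a function of the density, along a decreasing
profile from `R`. -/
abbrev IsPhase (R : ℝ) (f D g : ℝ → ℝ) (c : ℝ) (y : ℝ → ℝ) : Prop :=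
  IsSingularSolution 0 R (fun s => c - advSpeed R f s) (fun s => D s * g s) y

theorem IsAdmissible.exists_isPhase {R : ℝ} {f D g : ℝ → ℝ} (A : IsAdmissible R f D g) (c : ℝ) :
    ∃ y, IsPhase R f D g c y :=
  exists_isSingularSolution A.R_pos (continuousOn_const.sub A.advSpeed_continuousOn)
    (A.D_continuousOn.mul A.g_continuousOn)
    fun s hs => mul_pos (A.D_pos s hs) (A.g_pos s (Ioo_subset_Ico_self hs))

namespace IsIntegratedWave

section Deviation

variable {R : ℝ} {f D g : ℝ → ℝ} {c : ℝ} {I : Set ℝ} {φ Z y : ℝ → ℝ}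

theorem hasDerivAt_deviation (h : IsIntegratedWave R f D g c I φ Z)
    (A : IsAdmissible R f D g) (hy : IsPhase R f D g c y) {ξ : ℝ} (hξ : ξ ∈ I)
    (hφ : φ ξ ∈ Ioo 0 R) :
    HasDerivAt (fun η => Z η + y (φ η)) (-(g (φ ξ) / y (φ ξ)) * (Z ξ + y (φ ξ))) ξ := by
  have hd := (h.hasDerivAt_flux A hξ (h.hasDerivAt_density A hξ hφ)).add
    ((hy.hasDerivAt _ hφ).comp ξ (h.hasDerivAt_density A hξ hφ))
  have hD := (A.D_pos _ hφ).ne'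
  have hy0 := (hy.pos _ hφ).ne'
  refine hd.congr_deriv ?_
  field_simp
  ring

theorem antitoneOn_abs_deviation (h : IsIntegratedWave R f D g c I φ Z)
    (A : IsAdmissible R f D g) (hy : IsPhase R f D g c y) {S : Set ℝ} (hS : Convex ℝ S)
    (hSI : S ⊆ I) (hpos : ∀ ξ ∈ S, 0 < φ ξ) (hlt : ∀ ξ ∈ interior S, φ ξ < R) :
    AntitoneOn (fun η => |Z η + y (φ η)|) S := by
  have hφ : ∀ ξ ∈ interior S, φ ξ ∈ Ioo 0 R := fun ξ hξ =>
    ⟨hpos ξ (interior_subset hξ), hlt ξ hξ⟩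
  suffices hsq : AntitoneOn (fun η => (Z η + y (φ η)) ^ 2) S from
    fun a ha b hb hab => sq_le_sq.1 (hsq ha hb hab)
  refine antitoneOn_of_hasDerivWithinAt_nonpos hS
    (f' := fun ξ => 2 * (Z ξ + y (φ ξ)) * (-(g (φ ξ) / y (φ ξ)) * (Z ξ + y (φ ξ))))
    ?_ (fun ξ hξ => ?_) fun ξ hξ => ?_
  · exact (((h.continuousOn_flux A).mono hSI).add (hy.continuousOn.comp (h.continuousOn.mono hSI)
      fun ξ hξ => ⟨hpos ξ hξ, (h.mapsTo (hSI hξ)).2⟩)).pow 2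
  · have hd := (h.hasDerivAt_deviation A hy (hSI (interior_subset hξ)) (hφ ξ hξ)).pow 2
    simp only [Nat.cast_ofNat, Nat.add_one_sub_one, pow_one] at hd
    exact hd.hasDerivWithinAt
  · have hrate : 0 ≤ g (φ ξ) / y (φ ξ) :=
      div_nonneg (A.g_nonneg _ (Ioo_subset_Icc_self (hφ ξ hξ))) (hy.pos _ (hφ ξ hξ)).le
    linarith [mul_nonneg hrate (sq_nonneg (Z ξ + y (φ ξ)))]

theorem flux_eq_neg_phase_of_eq_right (h : IsIntegratedWave R f D g c I φ Z)
    (A : IsAdmissible R f D g) (hy : IsPhase R f D g c y) {a ξ : ℝ} (haξ : a ≤ ξ)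
    (hI : Icc a ξ ⊆ I) (ha : φ a = R) (hpos : ∀ η ∈ Icc a ξ, 0 < φ η)
    (hlt : ∀ η ∈ Ioo a ξ, φ η < R) : Z ξ = -y (φ ξ) := by
  have hmem : a ∈ Icc a ξ := left_mem_Icc.2 haξ
  have hdev := h.antitoneOn_abs_deviation A hy (convex_Icc a ξ) hI hpos
    (interior_Icc (a := a) ▸ hlt) hmem (right_mem_Icc.2 haξ) haξ
  simp only [ha, hy.terminal, h.flux_eq_zero_of_eq_right A (hI hmem) ha, add_zero, abs_zero,
    abs_nonpos_iff] at hdev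
  exact eq_neg_of_add_eq_zero_left hdev

/-- A nonzero deviation at `ξ` would keep `Z` away from `0` on a whole left half-line, along which
`primD D ∘ φ` cannot stay bounded. -/
theorem flux_eq_neg_phase_of_forall_lt (h : IsIntegratedWave R f D g c I φ Z)
    (A : IsAdmissible R f D g) (hy : IsPhase R f D g c y) {ξ : ℝ} (hI : Iic ξ ⊆ I)
    (hZ : ∀ η ≤ ξ, Z η ≤ 0) (hφ : ∀ η ≤ ξ, φ η ∈ Ioo 0 R) (hlim : Tendsto φ atBot (𝓝 R)) :
    Z ξ = -y (φ ξ) := by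
  by_contra hne
  set e := |Z ξ + y (φ ξ)|
  have hepos : 0 < e := abs_pos.2 fun h0 => hne (eq_neg_of_add_eq_zero_left h0)
  have hdev := h.antitoneOn_abs_deviation A hy (convex_Iic ξ) hI (fun η hη => (hφ η hη).1)
    fun η hη => (hφ η (interior_subset (s := Iic ξ) hη)).2
  have hyφ : Tendsto (fun η => y (φ η)) atBot (𝓝 0) := by
    have hφ' : Tendsto φ atBot (𝓝[Ioc 0 R] R) := tendsto_nhdsWithin_iff.2
      ⟨hlim, mem_of_superset (Iic_mem_atBot ξ) fun η hη => Ioo_subset_Ioc_self (hφ η hη)⟩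
    exact hy.terminal ▸ (hy.continuousOn R ⟨A.R_pos, le_rfl⟩).tendsto.comp hφ'
  obtain ⟨b, hb⟩ := eventually_atBot.1
    ((hyφ.eventually (gt_mem_nhds hepos)).and (Iic_mem_atBot ξ))
  have hZe : ∀ η ≤ b, Z η ≤ -e := by
    intro η hη
    obtain ⟨hye, hηξ⟩ := hb η hη
    have hle : e ≤ |Z η + y (φ η)| := hdev hηξ self_mem_Iic hηξ
    have := hZ η hηξ
    have := hy.pos (φ η) (hφ η hηξ)
    rcases le_abs.1 hle with h' | h' <;> linarith
  have hL := A.primD_nonneg A.right_mem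
  have hlen : e * (b - (b - (primD D R + 1) / e)) = primD D R + 1 := by
    field_simp
    ring
  have := h.mul_sub_le_primD A (a := b - (primD D R + 1) / e) (sub_le_self b (by positivity))
    (fun η hη => hI (hη.2.trans (hb b le_rfl).2)) fun η hη => hZe η hη.2
  linarith

theorem flux_eq_neg_phase (h : IsIntegratedWave R f D g c I φ Z) (A : IsAdmissible R f D g)
    (hy : IsPhase R f D g c y) (hanti : AntitoneOn φ I) (hlim : Tendsto φ atBot (𝓝 R)) {ξ : ℝ}
    (hI : Iic ξ ⊆ I) : Z ξ = -y (φ ξ) := by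
  have hpos := h.pos_of_antitoneOn A hanti
  have hne_lt {η : ℝ} (hη : η ≤ ξ) (hR : φ η ≠ R) : φ η < R := (h.mapsTo (hI hη)).2.lt_of_ne hR
  by_cases htouch : ∃ η ≤ ξ, φ η = R
  · have hclosed : IsClosed (Iic ξ ∩ φ ⁻¹' {R}) :=
      (h.continuousOn.mono hI).preimage_isClosed_of_isClosed isClosed_Iic isClosed_singleton
    have hbdd : BddAbove (Iic ξ ∩ φ ⁻¹' {R}) := ⟨ξ, fun x hx => hx.1⟩
    obtain ⟨haξ, ha⟩ := hclosed.csSup_mem htouch hbdd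
    refine h.flux_eq_neg_phase_of_eq_right A hy haξ (fun η hη => hI hη.2) ha
      (fun η hη => hpos η (hI hη.2)) fun η hη => hne_lt hη.2.le fun hR => ?_
    exact (le_csSup hbdd ⟨hη.2.le, hR⟩).not_gt hη.1
  · push Not at htouch
    exact h.flux_eq_neg_phase_of_forall_lt A hy hI
      (fun η hη => h.flux_nonpos_of_antitoneOn A hanti η (hI hη))
      (fun η hη => ⟨hpos η (hI hη), hne_lt hη (htouch η hη)⟩) hlim

end Deviation

end IsIntegratedWave

theorem forall_neg_of_hasDerivAt_neg_of_first_zero {u : ℝ → ℝ} {a b : ℝ}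
    (hu : ContinuousOn u (Ico a b)) (ha : u a < 0)
    (hderiv : ∀ τ ∈ Ioo a b, (∀ x ∈ Ico a τ, u x < 0) → u τ = 0 → ∃ u' < 0, HasDerivAt u u' τ) :
    ∀ x ∈ Ico a b, u x < 0 := by
  intro x hx
  by_contra! hux
  have hsub : Icc a x ⊆ Ico a b := fun t ht => ⟨ht.1, ht.2.trans_lt hx.2⟩
  obtain ⟨τ, ⟨⟨haτ, hτx⟩, hτ0⟩, hτmin⟩ : ∃ τ, IsLeast (Icc a x ∩ u ⁻¹' Ici 0) τ :=
    (isCompact_Icc.of_isClosed_subset ((hu.mono hsub).preimage_isClosed_of_isClosed isClosed_Icc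
      isClosed_Ici) inter_subset_left).exists_isLeast ⟨x, ⟨hx.1, le_rfl⟩, hux⟩
  have hneg : ∀ t ∈ Ico a τ, u t < 0 := fun t ht => by
    by_contra! h0
    exact (hτmin ⟨⟨ht.1, ht.2.le.trans hτx⟩, h0⟩).not_gt ht.2
  have haτ : a < τ := haτ.lt_of_ne fun h => ha.not_ge (h ▸ hτ0)
  have hneg' : ∀ᶠ t in 𝓝[<] τ, u t < 0 :=
    mem_of_superset (Ico_mem_nhdsLT haτ) hneg
  have huτ : u τ = 0 := by
    have hcont : ContinuousAt u τ := (hu.mono Ioo_subset_Ico_self).continuousAt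
      (Ioo_mem_nhds haτ (hτx.trans_lt hx.2))
    exact le_antisymm (le_of_tendsto (hcont.tendsto.mono_left nhdsWithin_le_nhds)
      (hneg'.mono fun t ht => ht.le)) hτ0
  obtain ⟨u', hu'neg, hu'⟩ := hderiv τ ⟨haτ, hτx.trans_lt hx.2⟩ hneg huτ
  have hslope : Tendsto (slope u τ) (𝓝[<] τ) (𝓝 u') :=
    (hasDerivAt_iff_tendsto_slope.1 hu').mono_left (nhdsWithin_mono τ fun t ht => ne_of_lt ht)
  refine hu'neg.not_ge (ge_of_tendsto hslope ?_)
  filter_upwards [hneg', self_mem_nhdsWithin] with t ht htτ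
  rw [slope_def_field, huτ]
  exact div_nonneg_of_nonpos (by linarith) (sub_nonpos.2 (le_of_lt htτ))

namespace IsIntegratedWave

section GlobalWave

variable {R : ℝ} {f D g : ℝ → ℝ} {c : ℝ} {I : Set ℝ} {φ Z : ℝ → ℝ} {ξ₀ : ℝ}

theorem flux_neg_of_pos (h : IsIntegratedWave R f D g c I φ Z) (A : IsAdmissible R f D g) {b : ℝ}
    (hI : Ico ξ₀ b ⊆ I) (hZ : Z ξ₀ < 0) (hR : φ ξ₀ < R) (hpos : ∀ ξ ∈ Ico ξ₀ b, 0 < φ ξ) :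
    ∀ ξ ∈ Ico ξ₀ b, Z ξ < 0 := by
  refine forall_neg_of_hasDerivAt_neg_of_first_zero ((h.continuousOn_flux A).mono hI) hZ ?_
  intro τ hτ hneg hZτ
  have hsub : Icc ξ₀ τ ⊆ I := fun x hx => hI ⟨hx.1, hx.2.trans_lt hτ.2⟩
  have hanti : AntitoneOn φ (Icc ξ₀ τ) := h.antitoneOn_of_flux_nonpos A (convex_Icc _ _) hsub
    fun x hx => (hneg x (Ioo_subset_Ico_self (interior_Icc (a := ξ₀) ▸ hx))).le
  have hφ : φ τ ∈ Ioo 0 R := ⟨hpos τ (Ioo_subset_Ico_self hτ),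
    (hanti (left_mem_Icc.2 hτ.1.le) (right_mem_Icc.2 hτ.1.le) hτ.1.le).trans_lt hR⟩
  have hτI := hI (Ioo_subset_Ico_self hτ)
  have hd := h.hasDerivAt_flux A hτI (h.hasDerivAt_density A hτI hφ)
  rw [hZτ, zero_div, mul_zero, zero_sub] at hd
  exact ⟨_, neg_neg_of_pos (A.g_pos _ (Ioo_subset_Ico_self hφ)), hd⟩

theorem antitoneOn_of_pos (h : IsIntegratedWave R f D g c I φ Z) (A : IsAdmissible R f D g)
    {b : ℝ} (hI : Ico ξ₀ b ⊆ I) (hZ : Z ξ₀ < 0) (hR : φ ξ₀ < R)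
    (hpos : ∀ ξ ∈ Ico ξ₀ b, 0 < φ ξ) : AntitoneOn φ (Ico ξ₀ b) :=
  h.antitoneOn_of_flux_nonpos A (convex_Ico _ _) hI fun ξ hξ =>
    (h.flux_neg_of_pos A hI hZ hR hpos ξ (interior_subset hξ)).le

theorem convection_sub_lt_of_eq_zero (h : IsIntegratedWave R f D g c I φ Z)
    (A : IsAdmissible R f D g) {τ : ℝ} (hI : Icc ξ₀ τ ⊆ I) (hξτ : ξ₀ < τ) (hZ : Z ξ₀ < 0)
    (hR : φ ξ₀ < R) (hpos : ∀ ξ ∈ Ico ξ₀ τ, 0 < φ ξ) (hτ : φ τ = 0) :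
    ∀ s ∈ Ioc 0 (φ ξ₀), f s - f 0 < c * s := by
  rintro s ⟨hs0, hs⟩
  have hI' : Ico ξ₀ τ ⊆ I := Ico_subset_Icc_self.trans hI
  have hanti := h.antitoneOn_of_pos A hI' hZ hR hpos
  obtain ⟨ξ, hξ, rfl⟩ := intermediate_value_Icc' hξτ.le (h.continuousOn.mono hI)
    (⟨hτ ▸ hs0.le, hs⟩ : s ∈ Icc (φ τ) (φ ξ₀))
  have hξ' : ξ ∈ Ico ξ₀ τ := ⟨hξ.1, hξ.2.lt_of_ne fun he => hs0.ne' (he ▸ hτ)⟩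
  have hτI := hI (right_mem_Icc.2 hξτ.le)
  have hbal := h.balance ξ (hI hξ) τ hτI
  have hint := h.integral_source_pos A hξ'.2 ((Icc_subset_Icc_left hξ.1).trans hI) fun x hx =>
    (hanti (left_mem_Ico.2 hξτ) ⟨hξ.1.trans hx.1.le, hx.2⟩ (hξ.1.trans hx.1.le)).trans_lt hR
  have hZξ := h.flux_neg_of_pos A hI' hZ hR hpos ξ hξ'
  rw [h.flux_eq_zero_of_eq_zero A hτI hτ, hτ] at hbal
  linarith

/-- To the right of a zero of `φ` the balance would make the flux negative, so that `φ` would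
become negative. -/
theorem density_ne_zero_of_convection_sub_le (h : IsIntegratedWave R f D g c I φ Z)
    (A : IsAdmissible R f D g) {δ τ : ℝ} (hδ : 0 < δ) (hf : ∀ s ∈ Icc 0 δ, f s - f 0 ≤ c * s)
    (hτ : τ ∈ I) : φ τ ≠ 0 := by
  intro hφτ
  have hnhds : ∀ᶠ ξ in 𝓝[≥] τ, ξ ∈ I ∧ φ ξ < min δ R :=
    eventually_nhdsWithin_of_eventually_nhds ((h.isOpen.eventually_mem hτ).and
      ((h.continuousOn.continuousAt (h.isOpen.mem_nhds hτ)).eventually_lt_const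
        (hφτ ▸ lt_min hδ A.R_pos)))
  obtain ⟨b, hτb, hb⟩ := mem_nhdsGE_iff_exists_Icc_subset.1 hnhds
  have hτb : τ < b := hτb
  have hI : Icc τ b ⊆ I := fun ξ hξ => (hb hξ).1
  have hneg : ∀ ξ ∈ Ioc τ b, Z ξ < 0 := by
    intro ξ hξ
    have hξb : Icc τ ξ ⊆ Icc τ b := Icc_subset_Icc_right hξ.2
    have hφξ := hb (hξb (right_mem_Icc.2 hξ.1.le))
    have hbal := h.balance τ hτ ξ hφξ.1
    have hint := h.integral_source_pos A hξ.1 (hξb.trans hI) fun x hx =>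
      (hb (hξb (Ioo_subset_Icc_self hx))).2.trans_le (min_le_right δ R)
    have := hf (φ ξ) ⟨(h.mapsTo hφξ.1).1, (hφξ.2.trans_le (min_le_left δ R)).le⟩
    rw [h.flux_eq_zero_of_eq_zero A hτ hφτ, hφτ] at hbal
    linarith
  have hlt := h.strictAntiOn_of_flux_neg A (convex_Icc τ b) hI
    (fun ξ hξ => hneg ξ (Ioo_subset_Ioc_self (interior_Icc (a := τ) ▸ hξ)))
    (left_mem_Icc.2 hτb.le) (right_mem_Icc.2 hτb.le) hτb
  exact (hφτ ▸ hlt).not_ge (h.mapsTo (hI (right_mem_Icc.2 hτb.le))).1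

theorem tendsto_flux_atTop_of_antitoneOn (h : IsIntegratedWave R f D g c I φ Z)
    (A : IsAdmissible R f D g) (hI : Ici ξ₀ ⊆ I) (hR : φ ξ₀ < R) (hanti : AntitoneOn φ (Ici ξ₀)) :
    Tendsto Z atTop atBot := by
  have h₀ : ξ₀ ∈ I := hI self_mem_Ici
  obtain ⟨s₀, hs₀, hmin⟩ := isCompact_Icc.exists_isMinOn (nonempty_Icc.2 (h.mapsTo h₀).1)
    (A.g_continuousOn.mono (Icc_subset_Icc_right hR.le))
  have hm : 0 < g s₀ := A.g_pos s₀ ⟨hs₀.1, hs₀.2.trans_lt hR⟩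
  obtain ⟨Q, hQ⟩ : ∃ Q, ∀ s ∈ Icc 0 R, |f s - c * s| ≤ Q :=
    isCompact_Icc.exists_bound_of_continuousOn
      (A.f_contDiffOn.continuousOn.sub (continuousOn_id.const_mul c))
  have hlin : Tendsto (fun ξ => 2 * Q - g s₀ * (ξ - ξ₀)) atTop atBot :=
    tendsto_atBot_add_const_left _ _ (tendsto_neg_atTop_atBot.comp
      ((tendsto_atTop_add_const_right _ _ tendsto_id).const_mul_atTop hm))
  refine tendsto_atBot_mono' _ (eventually_ge_atTop ξ₀ |>.mono fun ξ hξ => ?_)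
    (tendsto_atBot_add_const_left _ (Z ξ₀) hlin)
  have hξI : Icc ξ₀ ξ ⊆ I := Icc_subset_Ici_self.trans hI
  have hint : g s₀ * (ξ - ξ₀) ≤ ∫ t in ξ₀..ξ, g (φ t) := by
    have := intervalIntegral.integral_mono_on (μ := volume) hξ intervalIntegrable_const
      (((A.g_continuousOn.comp h.continuousOn h.mapsTo).mono
        ((uIcc_of_le hξ).trans_subset hξI)).intervalIntegrable) (f := fun _ => g s₀)
      fun t ht => hmin ⟨(h.mapsTo (hξI ht)).1, hanti self_mem_Ici ht.1 ht.1⟩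
    rwa [intervalIntegral.integral_const, smul_eq_mul, mul_comm] at this
  have hξ' := hI hξ
  have := h.balance ξ₀ h₀ ξ hξ'
  have := abs_le.1 (hQ _ (h.mapsTo hξ'))
  have := abs_le.1 (hQ _ (h.mapsTo h₀))
  linarith

theorem flux_nonneg_of_lt_right (h : IsIntegratedWave R f D g c I φ Z) (A : IsAdmissible R f D g)
    (hI : Ici ξ₀ ⊆ I) (hR : φ ξ₀ < R) : 0 ≤ Z ξ₀ := by
  by_contra! hZ
  have h0 : 0 < φ ξ₀ := (h.mapsTo (hI self_mem_Ici)).1.lt_of_ne' fun he =>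
    hZ.ne (h.flux_eq_zero_of_eq_zero A (hI self_mem_Ici) he)
  by_cases hzero : ∃ ξ, ξ₀ ≤ ξ ∧ φ ξ = 0
  · have hclosed : IsClosed (Ici ξ₀ ∩ φ ⁻¹' {0}) :=
      (h.continuousOn.mono hI).preimage_isClosed_of_isClosed isClosed_Ici isClosed_singleton
    have hbdd : BddBelow (Ici ξ₀ ∩ φ ⁻¹' {0}) := ⟨ξ₀, fun x hx => hx.1⟩
    obtain ⟨hξτ, hτ⟩ := hclosed.csInf_mem hzero hbdd
    refine h.density_ne_zero_of_convection_sub_le A h0 (fun s hs => ?_) (hI hξτ) hτ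
    rcases hs.1.eq_or_lt with rfl | hs0
    · simp
    · refine (h.convection_sub_lt_of_eq_zero A (Icc_subset_Ici_self.trans hI)
        (lt_of_le_of_ne hξτ fun he => h0.ne' (he ▸ hτ)) hZ hR (fun ξ hξ => ?_) hτ s
        ⟨hs0, hs.2⟩).le
      exact (h.mapsTo (hI hξ.1)).1.lt_of_ne' fun he => (csInf_le hbdd ⟨hξ.1, he⟩).not_gt hξ.2
  · push Not at hzero
    have hanti : AntitoneOn φ (Ici ξ₀) := fun a ha b hb hab =>
      h.antitoneOn_of_pos A (b := b + 1) (Ico_subset_Ici_self.trans hI) hZ hR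
        (fun t ht => (h.mapsTo (hI ht.1)).1.lt_of_ne' (hzero t ht.1))
        ⟨ha, hab.trans_lt (lt_add_one b)⟩ ⟨hb, lt_add_one b⟩ hab
    have hlim := h.tendsto_flux_atTop_of_antitoneOn A hI hR hanti
    obtain ⟨a, ha⟩ := eventually_atTop.1
      ((hlim.eventually (eventually_le_atBot (-1))).and (eventually_ge_atTop ξ₀))
    have hL := A.primD_nonneg A.right_mem
    have := h.mul_sub_le_primD A (a := a) (b := a + (primD D R + 1)) (e := 1) (by linarith)
      (fun ξ hξ => hI (ha ξ hξ.1).2) fun ξ hξ => (ha ξ hξ.1).1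
    linarith

end GlobalWave

end IsIntegratedWave

namespace IsSemiWavefrontFrom

variable {R : ℝ} {f D g : ℝ → ℝ} {c : ℝ} {φ y : ℝ → ℝ} {w : ℝ}

theorem antitoneOn (h : IsSemiWavefrontFrom R f D g c R w φ) : AntitoneOn φ (Iio w) := by
  obtain ⟨hmono | hanti, ξ₁, h₁, ξ₂, h₂, hne⟩ := h.monotonic
  · have hconst : ∀ ξ < w, φ ξ = R := fun ξ hξ =>
      le_antisymm (h.wave.mapsTo hξ).2 <| le_of_tendsto h.tendsto <|
        mem_of_superset (Iic_mem_atBot ξ) fun η hη => hmono (lt_of_le_of_lt hη hξ) hξ hη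
    exact absurd ((hconst ξ₁ h₁).trans (hconst ξ₂ h₂).symm) hne
  · exact hanti

theorem exists_lt (h : IsSemiWavefrontFrom R f D g c R w φ) : ∃ ξ < w, φ ξ < R := by
  obtain ⟨_, ξ₁, h₁, ξ₂, h₂, hne⟩ := h.monotonic
  by_contra! hcon
  exact hne ((le_antisymm (h.wave.mapsTo h₁).2 (hcon ξ₁ h₁)).trans
    (le_antisymm (h.wave.mapsTo h₂).2 (hcon ξ₂ h₂)).symm)

theorem isIntegratedWave (h : IsSemiWavefrontFrom R f D g c R w φ)
    (A : IsAdmissible R f D g) (hy : IsPhase R f D g c y) :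
    IsIntegratedWave R f D g c (Iio w) φ (fun ξ => -y (φ ξ)) := by
  obtain ⟨Z, hZ⟩ := h.wave.exists_isIntegratedWave A nonempty_Iio
  have hflux : ∀ ξ ∈ Iio w, Z ξ = -y (φ ξ) := fun ξ hξ =>
    hZ.flux_eq_neg_phase A hy h.antitoneOn h.tendsto (Iic_subset_Iio.2 hξ)
  exact ⟨hZ.isOpen, hZ.ordConnected, hZ.mapsTo, hZ.continuousOn,
    fun ξ hξ => hflux ξ hξ ▸ hZ.hasDerivAt ξ hξ,
    fun a ha b hb => hflux a ha ▸ hflux b hb ▸ hZ.balance a ha b hb⟩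

theorem isStrict (h : IsSemiWavefrontFrom R f D g c R w φ) (A : IsAdmissible R f D g) :
    IsStrict R f D g c (Iio w) φ := by
  refine ⟨fun he => lt_irrefl w (he ▸ mem_univ w : w ∈ Iio w), ?_⟩
  rintro ⟨φ', hφ', heq⟩
  obtain ⟨y, hy⟩ := A.exists_isPhase c
  obtain ⟨Z, hZ⟩ := hφ'.exists_isIntegratedWave A univ_nonempty
  obtain ⟨ξ, hξ, hlt⟩ := h.exists_lt
  have hanti : AntitoneOn φ' (Iio w) := h.antitoneOn.congr heq.symm
  have hlim : Tendsto φ' atBot (𝓝 R) :=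
    h.tendsto.congr' (heq.symm.eventuallyEq_of_mem (Iio_mem_atBot w))
  have hZ' := hZ.mono isOpen_Iio ordConnected_Iio (subset_univ (Iio w))
  have hflux := hZ'.flux_eq_neg_phase A hy hanti hlim (Iic_subset_Iio.2 hξ)
  have hltR : φ' ξ < R := (heq hξ).symm ▸ hlt
  have hpos := hy.pos (φ' ξ) ⟨hZ'.pos_of_antitoneOn A hanti ξ hξ, hltR⟩
  exact (hZ.flux_nonneg_of_lt_right A (subset_univ (Ici ξ)) hltR).not_gt (by linarith)

end IsSemiWavefrontFrom

section Profile

theorem subsingleton_frontier_of_isLowerSet {α : Type*} [LinearOrder α] [TopologicalSpace α]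
    [OrderTopology α] {s : Set α} (hs : IsLowerSet s) : (frontier s).Subsingleton := by
  have hnot_lt {a b : α} (ha : a ∈ frontier s) (hb : b ∈ frontier s) : ¬a < b := fun hab => by
    obtain ⟨t, hat, hts⟩ := mem_closure_iff_nhds.1 hb.1 _ (Ioi_mem_nhds hab)
    exact ha.2 (mem_interior_iff_mem_nhds.2
      (mem_of_superset (Iio_mem_nhds hat) fun x hx => hs (le_of_lt hx) hts))
  exact fun a ha b hb => le_antisymm (not_lt.1 (hnot_lt hb ha)) (not_lt.1 (hnot_lt ha hb))

theorem hasDerivAt_of_hasDerivAt_off_countable {E : Type*} [NormedAddCommGroup E]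
    [NormedSpace ℝ E] [CompleteSpace E] {F F' : ℝ → E} {I S : Set ℝ} (hI : IsOpen I)
    (hIc : I.OrdConnected) (hS : S.Countable) (hF : ContinuousOn F I) (hF' : ContinuousOn F' I)
    (hd : ∀ x ∈ I, x ∉ S → HasDerivAt F (F' x) x) : ∀ x ∈ I, HasDerivAt F (F' x) x := by
  intro x hx
  refine ((hasDerivAt_integral_of_continuousOn hI hIc hF' hx hx).const_add
    (F x)).congr_of_eventuallyEq ?_
  filter_upwards [hI.mem_nhds hx] with b hb
  have hsub : uIcc x b ⊆ I := hIc.uIcc_subset hx hb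
  rw [integral_eq_of_hasDerivAt_off_countable F F' hS (hF.mono hsub)
    (fun t ht => hd t (hsub (Ioo_subset_Icc_self ht.1)) ht.2) (hF'.mono hsub).intervalIntegrable]
  abel

/-- The time that the profile with phase function `y` takes to get from density `R / 2` to
density `s`. -/
def travelTime (R : ℝ) (D y : ℝ → ℝ) (s : ℝ) : ℝ := ∫ t in s..(R / 2), D t / y t

/-- The profile with phase function `y` normalized by the value `R / 2` at time `0`, as a
generalized inverse of the travel time: it equals `R` before the infimum of the travel times
and `0` (junk value of `sSup ∅`) after their supremum `endTime R D y`. -/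
def profile (R : ℝ) (D y : ℝ → ℝ) (ξ : ℝ) : ℝ := sSup {s ∈ Ioo 0 R | ξ ≤ travelTime R D y s}

/-- The time until which `profile R D y` solves the equation, with a positive density. -/
def endTime (R : ℝ) (D y : ℝ → ℝ) : ℝ := sSup (travelTime R D y '' Ioo 0 R)

theorem bddAbove_superlevel_travelTime (R : ℝ) (D y : ℝ → ℝ) (ξ : ℝ) :
    BddAbove {s ∈ Ioo 0 R | ξ ≤ travelTime R D y s} :=
  ⟨R, fun _ hs => hs.1.2.le⟩

theorem le_profile {R : ℝ} {D y : ℝ → ℝ} {s ξ : ℝ} (hs : s ∈ Ioo 0 R)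
    (h : ξ ≤ travelTime R D y s) : s ≤ profile R D y ξ :=
  le_csSup (bddAbove_superlevel_travelTime R D y ξ) ⟨hs, h⟩

theorem travelTime_lt_of_profile_lt {R : ℝ} {D y : ℝ → ℝ} {s ξ : ℝ} (hs : s ∈ Ioo 0 R)
    (h : profile R D y ξ < s) : travelTime R D y s < ξ :=
  lt_of_not_ge fun hle => h.not_ge (le_profile hs hle)

namespace IsAdmissible

variable {R : ℝ} {f D g : ℝ → ℝ} (A : IsAdmissible R f D g) (y : ℝ → ℝ)
include A

theorem half_mem : R / 2 ∈ Ioo 0 R := ⟨half_pos A.R_pos, half_lt_self A.R_pos⟩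

theorem profile_mem (ξ : ℝ) : profile R D y ξ ∈ Icc 0 R :=
  ⟨Real.sSup_nonneg fun _ hs => hs.1.1.le, Real.sSup_le (fun _ hs => hs.1.2.le) A.R_pos.le⟩

theorem profile_antitone : Antitone (profile R D y) := by
  intro a b hab
  rcases ({s ∈ Ioo 0 R | b ≤ travelTime R D y s}).eq_empty_or_nonempty with he | hne
  · rw [profile, he, Real.sSup_empty]
    exact (A.profile_mem y a).1
  · exact csSup_le_csSup (bddAbove_superlevel_travelTime R D y a) hne
      fun s hs => ⟨hs.1, hab.trans hs.2⟩

theorem profile_pos {ξ : ℝ} (hξ : ξ < endTime R D y) : 0 < profile R D y ξ := by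
  obtain ⟨_, ⟨s, hs, rfl⟩, h⟩ := exists_lt_of_lt_csSup
    ((nonempty_Ioo.2 A.R_pos).image (travelTime R D y)) hξ
  exact hs.1.trans_le (le_profile hs h.le)

theorem tendsto_profile_atBot : Tendsto (profile R D y) atBot (𝓝 R) := by
  refine tendsto_order.2 ⟨fun a ha => ?_, fun a ha => Eventually.of_forall fun ξ =>
    (A.profile_mem y ξ).2.trans_lt ha⟩
  obtain ⟨s, hs, hsR⟩ := exists_between (max_lt ha A.R_pos)
  have hs' : s ∈ Ioo 0 R := ⟨(le_max_right _ _).trans_lt hs, hsR⟩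
  filter_upwards [Iic_mem_atBot (travelTime R D y s)] with ξ hξ
  exact ((le_max_left _ _).trans_lt hs).trans_le (le_profile hs' hξ)

theorem isLowerSet_profile_preimage_right : IsLowerSet (profile R D y ⁻¹' {R}) :=
  fun _ b hba ha => le_antisymm (A.profile_mem y b).2
    ((mem_singleton_iff.1 ha).ge.trans (A.profile_antitone y hba))

theorem profile_mem_Ioo_of_mem_frontier {y : ℝ → ℝ} {ξ η : ℝ}
    (hξ : ξ ∈ frontier (profile R D y ⁻¹' {R})) (hη : η ∈ Ioo ξ (endTime R D y)) :
    profile R D y η ∈ Ioo 0 R := by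
  refine ⟨A.profile_pos y hη.2, (A.profile_mem y η).2.lt_of_ne fun hR => hξ.2 ?_⟩
  exact mem_interior_iff_mem_nhds.2 (mem_of_superset (Iio_mem_nhds hη.1) fun _ ht =>
    A.isLowerSet_profile_preimage_right y (le_of_lt ht) hR)

end IsAdmissible

namespace IsPhase

variable {R : ℝ} {f D g : ℝ → ℝ} {c : ℝ} {y : ℝ → ℝ} {s ξ : ℝ} (hy : IsPhase R f D g c y)

include hy in
theorem nonneg (hs : s ∈ Ioc 0 R) : 0 ≤ y s := by
  rcases hs.2.eq_or_lt with rfl | h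
  · exact hy.terminal.ge
  · exact (hy.pos s ⟨hs.1, h⟩).le

variable (A : IsAdmissible R f D g)
include hy A

theorem slowness_pos (hs : s ∈ Ioo 0 R) : 0 < D s / y s :=
  div_pos (A.D_pos s hs) (hy.pos s hs)

theorem slowness_continuousOn : ContinuousOn (fun t => D t / y t) (Ioo 0 R) :=
  (A.D_continuousOn.mono Ioo_subset_Icc_self).div (hy.continuousOn.mono Ioo_subset_Ioc_self)
    fun s hs => (hy.pos s hs).ne'

theorem travelTime_hasDerivAt (hs : s ∈ Ioo 0 R) :
    HasDerivAt (travelTime R D y) (-(D s / y s)) s := by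
  have hc := hy.slowness_continuousOn A
  exact intervalIntegral.integral_hasDerivAt_left
    (hc.mono (ordConnected_Ioo.uIcc_subset hs A.half_mem)).intervalIntegrable
    (hc.stronglyMeasurableAtFilter isOpen_Ioo s hs) (hc.continuousAt (Ioo_mem_nhds hs.1 hs.2))

theorem travelTime_continuousOn : ContinuousOn (travelTime R D y) (Ioo 0 R) :=
  HasDerivAt.continuousOn fun _ hs => hy.travelTime_hasDerivAt A hs

theorem travelTime_strictAntiOn : StrictAntiOn (travelTime R D y) (Ioo 0 R) :=
  strictAntiOn_of_hasDerivWithinAt_neg (convex_Ioo 0 R) (hy.travelTime_continuousOn A)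
    (fun _ hs => (hy.travelTime_hasDerivAt A (interior_subset hs)).hasDerivWithinAt)
    (fun _ hs => neg_neg_of_pos (hy.slowness_pos A (interior_subset hs)))

theorem exists_deriv_le_sub_mul_slowness :
    ∃ m > 0, ∃ C ≥ 0, ∀ t ∈ Ioc 0 (R / 2), deriv y t ≤ C - m * (D t / y t) := by
  have hhalf := A.half_mem
  obtain ⟨C, hC⟩ := isCompact_Icc.exists_bound_of_continuousOn
    (continuousOn_const.sub A.advSpeed_continuousOn :
      ContinuousOn (fun s => c - advSpeed R f s) (Icc 0 R))
  obtain ⟨s₀, hs₀, hmin⟩ := isCompact_Icc.exists_isMinOn (nonempty_Icc.2 hhalf.1.le)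
    (A.g_continuousOn.mono (Icc_subset_Icc_right hhalf.2.le))
  refine ⟨g s₀, A.g_pos s₀ ⟨hs₀.1, hs₀.2.trans_lt hhalf.2⟩, C,
    (norm_nonneg _).trans (hC 0 A.zero_mem), fun t ht => ?_⟩
  have htR : t ∈ Ioo 0 R := ⟨ht.1, ht.2.trans_lt hhalf.2⟩
  have hconv : c - advSpeed R f t ≤ C := (le_abs_self _).trans (hC t (Ioo_subset_Icc_self htR))
  have hsource : g s₀ * (D t / y t) ≤ D t * g t / y t := by
    rw [mul_comm (D t), mul_div_assoc]
    exact mul_le_mul_of_nonneg_right (hmin ⟨ht.1.le, ht.2⟩) (hy.slowness_pos A htR).le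
  rw [(hy.hasDerivAt t htR).deriv]
  linarith

theorem exists_travelTime_le : ∃ B, ∀ s ∈ Ioc 0 (R / 2), travelTime R D y s ≤ B := by
  have hhalf := A.half_mem
  have hsub : Ioc 0 (R / 2) ⊆ Ioo 0 R := fun t ht => ⟨ht.1, ht.2.trans_lt hhalf.2⟩
  obtain ⟨M, hM⟩ := hy.bounded
  obtain ⟨m, hm, C, hC, hderiv⟩ := hy.exists_deriv_le_sub_mul_slowness A
  have hd : ∀ t ∈ Ioc 0 (R / 2), HasDerivAt (fun t => m * travelTime R D y t + (C * t - y t))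
      (m * -(D t / y t) + (C - deriv y t)) t := fun t ht =>
    ((hy.travelTime_hasDerivAt A (hsub ht)).const_mul m).add
      ((hasDerivAt_const_mul C).sub (hy.hasDerivAt t (hsub ht)).differentiableAt.hasDerivAt)
  have hmono : MonotoneOn (fun t => m * travelTime R D y t + (C * t - y t)) (Ioc 0 (R / 2)) :=
    monotoneOn_of_hasDerivWithinAt_nonneg (convex_Ioc _ _) (HasDerivAt.continuousOn hd)
      (fun t ht => (hd t (interior_subset ht)).hasDerivWithinAt)
      (fun t ht => by linarith [hderiv t (interior_subset ht)])
  refine ⟨(M + C * (R / 2)) / m, fun s hs => (le_div_iff₀ hm).2 ?_⟩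
  have hle := hmono hs (right_mem_Ioc.2 hhalf.1) hs.2
  simp only [travelTime, intervalIntegral.integral_same, mul_zero, zero_add] at hle ⊢
  linarith [hM s ⟨hs.1, (hsub hs).2.le⟩, hy.nonneg (Ioo_subset_Ioc_self hhalf),
    mul_nonneg hC hs.1.le]

theorem bddAbove_travelTime : BddAbove (travelTime R D y '' Ioo 0 R) := by
  obtain ⟨B, hB⟩ := hy.exists_travelTime_le A
  refine ⟨B, forall_mem_image.2 fun s hs => ?_⟩
  rcases le_total s (R / 2) with h | h
  · exact hB s ⟨hs.1, h⟩
  · exact ((hy.travelTime_strictAntiOn A).antitoneOn A.half_mem hs h).trans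
      (hB _ (right_mem_Ioc.2 A.half_mem.1))

theorem travelTime_lt_endTime (hs : s ∈ Ioo 0 R) : travelTime R D y s < endTime R D y := by
  obtain ⟨t, ht0, hts⟩ := exists_between hs.1
  have ht : t ∈ Ioo 0 R := ⟨ht0, hts.trans hs.2⟩
  exact (hy.travelTime_strictAntiOn A ht hs hts).trans_le
    (le_csSup (hy.bddAbove_travelTime A) (mem_image_of_mem _ ht))

theorem profile_travelTime (hs : s ∈ Ioo 0 R) : profile R D y (travelTime R D y s) = s :=
  IsGreatest.csSup_eq ⟨⟨hs, le_rfl⟩, fun _ ht =>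
    ((hy.travelTime_strictAntiOn A).le_iff_ge hs ht.1).1 ht.2⟩

theorem lt_travelTime_of_lt_profile (hs : s ∈ Ioo 0 R) (h : s < profile R D y ξ) :
    ξ < travelTime R D y s := by
  refine lt_of_not_ge fun hle => h.not_ge ?_
  exact (A.profile_antitone y hle).trans_eq (hy.profile_travelTime A hs)

theorem profile_continuous : Continuous (profile R D y) := by
  refine continuous_iff_continuousAt.2 fun ξ => tendsto_order.2 ⟨fun a ha => ?_, fun b hb => ?_⟩
  · rcases lt_or_ge a 0 with ha0 | ha0
    · exact Eventually.of_forall fun η => ha0.trans_le (A.profile_mem y η).1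
    obtain ⟨s, has, hsξ⟩ := exists_between ha
    have hs : s ∈ Ioo 0 R := ⟨ha0.trans_lt has, hsξ.trans_le (A.profile_mem y ξ).2⟩
    filter_upwards [Iio_mem_nhds (hy.lt_travelTime_of_lt_profile A hs hsξ)] with η hη
    exact has.trans_le (le_profile hs (le_of_lt hη))
  · rcases lt_or_ge R b with hbR | hbR
    · exact Eventually.of_forall fun η => (A.profile_mem y η).2.trans_lt hbR
    obtain ⟨s, hξs, hsb⟩ := exists_between hb
    have hs : s ∈ Ioo 0 R := ⟨(A.profile_mem y ξ).1.trans_lt hξs, hsb.trans_le hbR⟩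
    filter_upwards [Ioi_mem_nhds (travelTime_lt_of_profile_lt hs hξs)] with η hη
    exact ((A.profile_antitone y (le_of_lt hη)).trans_eq (hy.profile_travelTime A hs)).trans_lt hsb

theorem travelTime_profile (h : profile R D y ξ ∈ Ioo 0 R) :
    travelTime R D y (profile R D y ξ) = ξ := by
  obtain ⟨s₁, h0s₁, hs₁⟩ := exists_between h.1
  obtain ⟨s₂, hs₂, hs₂R⟩ := exists_between h.2
  have hs₁' : s₁ ∈ Ioo 0 R := ⟨h0s₁, hs₁.trans h.2⟩
  have hs₂' : s₂ ∈ Ioo 0 R := ⟨h.1.trans hs₂, hs₂R⟩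
  obtain ⟨s, hs, rfl⟩ := isPreconnected_Ioo.intermediate_value hs₂' hs₁'
    (hy.travelTime_continuousOn A)
    ⟨(travelTime_lt_of_profile_lt hs₂' hs₂).le, (hy.lt_travelTime_of_lt_profile A hs₁' hs₁).le⟩
  rw [hy.profile_travelTime A hs]

theorem profile_hasDerivAt (h : profile R D y ξ ∈ Ioo 0 R) :
    HasDerivAt (profile R D y) (-(y (profile R D y ξ) / D (profile R D y ξ))) ξ := by
  have hcont := (hy.profile_continuous A).continuousAt (x := ξ)
  have := HasDerivAt.of_local_left_inverse hcont (hy.travelTime_hasDerivAt A h)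
    (neg_ne_zero.2 (hy.slowness_pos A h).ne')
    (mem_of_superset (hcont.preimage_mem_nhds (Ioo_mem_nhds h.1 h.2))
      fun _ hη => hy.travelTime_profile A hη)
  rwa [inv_neg, inv_div] at this

theorem phase_profile_continuousOn :
    ContinuousOn (fun ξ => -y (profile R D y ξ)) (Iio (endTime R D y)) :=
  (hy.continuousOn.comp (hy.profile_continuous A).continuousOn
    fun ξ hξ => ⟨A.profile_pos y hξ, (A.profile_mem y ξ).2⟩).neg

theorem isClosed_profile_preimage_right : IsClosed (profile R D y ⁻¹' {R}) :=
  isClosed_singleton.preimage (hy.profile_continuous A)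

theorem profile_mem_Ioo_or_eventuallyEq (hξ : ξ < endTime R D y)
    (hne : ξ ∉ frontier (profile R D y ⁻¹' {R})) :
    profile R D y ξ ∈ Ioo 0 R ∨ profile R D y =ᶠ[𝓝 ξ] fun _ => R := by
  rcases (A.profile_mem y ξ).2.eq_or_lt with he | hlt
  · rw [(hy.isClosed_profile_preimage_right A).frontier_eq] at hne
    exact Or.inr (mem_interior_iff_mem_nhds.1 (not_not.1 fun hint => hne ⟨he, hint⟩))
  · exact Or.inl ⟨A.profile_pos y hξ, hlt⟩

theorem profile_differentiableAt (hξ : ξ < endTime R D y)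
    (hne : ξ ∉ frontier (profile R D y ⁻¹' {R})) : DifferentiableAt ℝ (profile R D y) ξ := by
  rcases hy.profile_mem_Ioo_or_eventuallyEq A hξ hne with h | h
  · exact (hy.profile_hasDerivAt A h).differentiableAt
  · exact h.differentiableAt_iff.2 (differentiableAt_const R)

theorem flux_profile (hξ : ξ < endTime R D y) :
    flux D (profile R D y) ξ = -y (profile R D y ξ) := by
  rcases (A.profile_mem y ξ).2.eq_or_lt with he | hlt
  · rw [flux, he, A.D_right, hy.terminal, zero_mul, neg_zero]
  · have hmem : profile R D y ξ ∈ Ioo 0 R := ⟨A.profile_pos y hξ, hlt⟩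
    rw [flux, (hy.profile_hasDerivAt A hmem).deriv, mul_neg, mul_div_cancel₀ _ (A.D_pos _ hmem).ne']

theorem phase_profile_hasDerivAt (hξ : ξ < endTime R D y)
    (hne : ξ ∉ frontier (profile R D y ⁻¹' {R})) :
    HasDerivAt (fun η => -y (profile R D y η)) ((advSpeed R f (profile R D y ξ) - c)
      * deriv (profile R D y) ξ - g (profile R D y ξ)) ξ := by
  rcases hy.profile_mem_Ioo_or_eventuallyEq A hξ hne with h | h
  · have hd := hy.profile_hasDerivAt A h
    refine ((hy.hasDerivAt _ h).comp ξ hd).neg.congr_deriv ?_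
    have := (A.D_pos _ h).ne'
    have := (hy.pos _ h).ne'
    rw [hd.deriv]
    field_simp
    ring
  · rw [h.deriv_eq, h.self_of_nhds, deriv_const, A.g_right, mul_zero, sub_zero]
    exact (hasDerivAt_const ξ (-y R)).congr_of_eventuallyEq (h.fun_comp fun s => -y s)

theorem primD_profile_hasDerivAt : ∀ ξ ∈ Iio (endTime R D y),
    HasDerivAt (fun η => primD D (profile R D y η)) (-y (profile R D y ξ)) ξ := by
  refine hasDerivAt_of_hasDerivAt_off_countable isOpen_Iio ordConnected_Iio
    (subsingleton_frontier_of_isLowerSet (A.isLowerSet_profile_preimage_right y)).countable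
    (A.primD_continuousOn.comp_continuous (hy.profile_continuous A)
      (A.profile_mem y)).continuousOn (hy.phase_profile_continuousOn A) fun ξ hξ hne => ?_
  rw [← hy.flux_profile A hξ]
  exact (A.primD_hasDerivWithinAt (A.profile_mem y ξ)).comp_hasDerivAt ξ
    (hy.profile_differentiableAt A hξ hne).hasDerivAt (Eventually.of_forall (A.profile_mem y))

theorem profile_balance {a b : ℝ} (ha : a < endTime R D y) (hb : b < endTime R D y) :
    -y (profile R D y b) - -y (profile R D y a) =
      (f (profile R D y b) - c * profile R D y b) - (f (profile R D y a) - c * profile R D y a)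
        - ∫ ξ in a..b, g (profile R D y ξ) := by
  have hsub : uIcc a b ⊆ Iio (endTime R D y) := ordConnected_Iio.uIcc_subset ha hb
  have hP := hy.profile_continuous A
  have hbal := integral_eq_of_hasDerivAt_off_countable
    (fun ξ => -y (profile R D y ξ) - (f (profile R D y ξ) - c * profile R D y ξ))
    (fun ξ => -g (profile R D y ξ)) (a := a) (b := b)
    (subsingleton_frontier_of_isLowerSet (A.isLowerSet_profile_preimage_right y)).countable
    (((hy.phase_profile_continuousOn A).mono hsub).sub
      ((A.f_contDiffOn.continuousOn.comp_continuous hP (A.profile_mem y)).sub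
        (continuous_const.mul hP)).continuousOn)
    (fun ξ hξ => by
      have hξw : ξ < endTime R D y := hsub (Ioo_subset_Icc_self hξ.1)
      have hd := (hy.profile_differentiableAt A hξw hξ.2).hasDerivAt
      refine ((hy.phase_profile_hasDerivAt A hξw hξ.2).sub
        (((A.f_hasDerivWithinAt (A.profile_mem y ξ)).comp_hasDerivAt ξ hd
          (Eventually.of_forall (A.profile_mem y))).sub (hd.const_mul c))).congr_deriv ?_
      ring)
    ((A.g_continuousOn.comp_continuous hP (A.profile_mem y)).neg.intervalIntegrable _ _)
  rw [intervalIntegral.integral_neg] at hbal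
  linarith

theorem isIntegratedWave_profile : IsIntegratedWave R f D g c (Iio (endTime R D y))
    (profile R D y) (fun ξ => -y (profile R D y ξ)) where
  isOpen := isOpen_Iio
  ordConnected := ordConnected_Iio
  mapsTo := fun ξ _ => A.profile_mem y ξ
  continuousOn := (hy.profile_continuous A).continuousOn
  hasDerivAt := hy.primD_profile_hasDerivAt A
  balance := fun _ ha _ hb => hy.profile_balance A ha hb

theorem isSemiWavefrontFrom_profile :
    IsSemiWavefrontFrom R f D g c R (endTime R D y) (profile R D y) where
  wave := by
    refine (hy.isIntegratedWave_profile A).isTravelingWave A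
      ((ae_restrict_iff' measurableSet_Iio).2 ?_)
    have hcountable :=
      (subsingleton_frontier_of_isLowerSet (A.isLowerSet_profile_preimage_right y)).countable
    filter_upwards [hcountable.ae_notMem volume] with ξ hne hξ
    exact hy.profile_differentiableAt A hξ hne
  mem := A.right_mem
  zero := A.g_right
  monotonic := by
    refine ⟨Or.inr ((A.profile_antitone y).antitoneOn _), ?_⟩
    obtain ⟨s, hs, hsR⟩ := exists_between A.half_mem.2
    have hs' : s ∈ Ioo 0 R := ⟨A.half_mem.1.trans hs, hsR⟩
    refine ⟨_, hy.travelTime_lt_endTime A hs', _, hy.travelTime_lt_endTime A A.half_mem, ?_⟩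
    rw [hy.profile_travelTime A hs', hy.profile_travelTime A A.half_mem]
    exact hs.ne'
  tendsto := A.tendsto_profile_atBot y

end IsPhase

namespace IsSemiWavefrontFrom

variable {R : ℝ} {f D g : ℝ → ℝ} {c w : ℝ} {y φ : ℝ → ℝ}
  (h : IsSemiWavefrontFrom R f D g c R w φ) (hy : IsPhase R f D g c y)
  (A : IsAdmissible R f D g)
include h hy A

theorem exists_travelTime_eq_sub :
    ∃ s, ∀ ξ < w, φ ξ < R → travelTime R D y (φ ξ) = ξ - s := by
  have hI := h.isIntegratedWave A hy
  have hanti := h.antitoneOn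
  obtain ⟨ξ₁, hξ₁⟩ := h.exists_lt
  set S := Iio w ∩ φ ⁻¹' Iio R
  have hSo : IsOpen S := hI.continuousOn.isOpen_inter_preimage isOpen_Iio isOpen_Iio
  have hSc : S.OrdConnected := ⟨fun a ha b hb x hx =>
    ⟨hx.2.trans_lt hb.1, (hanti ha.1 (hx.2.trans_lt hb.1) hx.1).trans_lt ha.2⟩⟩
  have hd : ∀ ξ ∈ S, HasDerivAt (fun η => travelTime R D y (φ η) - η) 0 ξ := by
    intro ξ hξ
    have hmem : φ ξ ∈ Ioo 0 R := ⟨hI.pos_of_antitoneOn A hanti ξ hξ.1, hξ.2⟩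
    refine (((hy.travelTime_hasDerivAt A hmem).comp ξ
      (hI.hasDerivAt_density A hξ.1 hmem)).sub (hasDerivAt_id ξ)).congr_deriv ?_
    have := (A.D_pos _ hmem).ne'
    have := (hy.pos _ hmem).ne'
    field_simp
    ring
  refine ⟨ξ₁ - travelTime R D y (φ ξ₁), fun ξ hξ hlt => ?_⟩
  have hconst := hSo.is_const_of_deriv_eq_zero hSc.isPreconnected
    (fun x hx => (hd x hx).differentiableAt.differentiableWithinAt)
    (fun x hx => (hd x hx).deriv) ⟨hξ, hlt⟩ hξ₁
  linarith

theorem exists_eq_profile_sub :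
    ∃ s, w ≤ endTime R D y + s ∧ ∀ ξ < w, φ ξ = profile R D y (ξ - s) := by
  obtain ⟨s, hs⟩ := h.exists_travelTime_eq_sub hy A
  have hpos := (h.isIntegratedWave A hy).pos_of_antitoneOn A h.antitoneOn
  obtain ⟨ξ₁, hξ₁, hlt₁⟩ := h.exists_lt
  refine ⟨s, le_of_forall_lt fun ξ hξ => ?_, fun ξ hξ => ?_⟩
  · have hm : max ξ ξ₁ < w := max_lt hξ hξ₁
    have hmR : φ (max ξ ξ₁) < R := (h.antitoneOn hξ₁ hm (le_max_right _ _)).trans_lt hlt₁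
    have hend := hy.travelTime_lt_endTime A ⟨hpos _ hm, hmR⟩
    rw [hs _ hm hmR] at hend
    linarith [le_max_left ξ ξ₁]
  rcases (h.wave.mapsTo hξ).2.eq_or_lt with he | hlt
  · refine he.trans (le_antisymm (le_of_forall_lt fun a ha => ?_) (A.profile_mem y _).2)
    obtain ⟨σ, hσ, hσR⟩ := exists_between (max_lt ha hlt₁)
    have hξξ₁ : ξ ≤ ξ₁ := le_of_not_gt fun hgt =>
      (hlt₁.trans_eq he.symm).not_ge (h.antitoneOn hξ₁ hξ hgt.le)
    obtain ⟨η, hη, rfl⟩ := intermediate_value_Icc' hξξ₁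
      (h.wave.continuous.mono fun x hx => hx.2.trans_lt hξ₁)
      (⟨((le_max_right _ _).trans_lt hσ).le, hσR.le.trans_eq he.symm⟩ : σ ∈ Icc (φ ξ₁) (φ ξ))
    have hηw : η < w := hη.2.trans_lt hξ₁
    refine ((le_max_left _ _).trans_lt hσ).trans_le (le_profile ⟨hpos η hηw, hσR⟩ ?_)
    rw [hs η hηw hσR]
    linarith [hη.1]
  · rw [← hs ξ hξ hlt, hy.profile_travelTime A ⟨hpos ξ hξ, hlt⟩]

end IsSemiWavefrontFrom

end Profile

section Regularity

theorem tendsto_nhdsLT_of_continuousOn_Icc {α β : Type*} [LinearOrder α] [TopologicalSpace α]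
    [OrderClosedTopology α] [TopologicalSpace β] {u : α → β} {a b : α} (hab : a < b)
    (hu : ContinuousOn u (Icc a b)) : Tendsto u (𝓝[<] b) (𝓝 (u b)) :=
  ((continuousWithinAt_Icc_iff_Iic hab).1 (hu b (right_mem_Icc.2 hab.le))).mono Iio_subset_Iic_self

theorem eventually_le_of_eventually_deriv_le {u v u' v' : ℝ → ℝ} {a b : ℝ} (hab : a < b)
    (hu : ContinuousOn u (Ioc a b)) (hv : ContinuousOn v (Ioc a b)) (hb : u b ≤ v b)
    (hu' : ∀ᶠ s in 𝓝[<] b, HasDerivAt u (u' s) s) (hv' : ∀ᶠ s in 𝓝[<] b, HasDerivAt v (v' s) s)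
    (hle : ∀ᶠ s in 𝓝[<] b, v s < u s → v' s ≤ u' s) : ∀ᶠ s in 𝓝[<] b, u s ≤ v s := by
  obtain ⟨r, hrb, hr⟩ := (mem_nhdsLT_iff_exists_Ioo_subset' hab).1
    (hu'.and (hv'.and (hle.and (Ioo_mem_nhdsLT hab))))
  filter_upwards [Ioo_mem_nhdsLT hrb] with s hs
  have hsub : Icc s b ⊆ Ioc a b := Icc_subset_Ioc_left (hr hs).2.2.2.1
  have hr' : ∀ t ∈ Ioo s b, t ∈ Ioo r b := fun t ht => ⟨hs.1.trans ht.1, ht.2⟩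
  exact sub_nonpos.1 (nonpos_of_deriv_nonneg_of_pos ((hu.mono hsub).sub (hv.mono hsub))
    (fun t ht => (hr (hr' t ht)).1.sub (hr (hr' t ht)).2.1) (sub_nonpos.2 hb)
    (fun t ht hpos => sub_nonneg.2 ((hr (hr' t ht)).2.2.1 (sub_pos.1 hpos))) s
    (left_mem_Icc.2 hs.2.le))

namespace CondD

variable {R : ℝ} {D : ℝ → ℝ} (hD : CondD R D)
include hD

theorem hasDerivAt {s : ℝ} (hs : s ∈ Ioo 0 R) : HasDerivAt D (derivWithin D (Icc 0 R) s) s :=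
  (hD.contDiff.differentiableOn one_ne_zero s
    (Ioo_subset_Icc_self hs)).hasDerivWithinAt.hasDerivAt (Icc_mem_nhds hs.1 hs.2)

theorem tendsto_derivWithin (hR : 0 < R) : Tendsto (derivWithin D (Icc 0 R)) (𝓝[<] R)
    (𝓝 (derivWithin D (Icc 0 R) R)) :=
  tendsto_nhdsLT_of_continuousOn_Icc hR
    (hD.contDiff.continuousOn_derivWithin (uniqueDiffOn_Icc hR) le_rfl)

theorem derivWithin_nonpos (hR : 0 < R) : derivWithin D (Icc 0 R) R ≤ 0 := by
  have hd := (hD.contDiff.differentiableOn one_ne_zero R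
    (right_mem_Icc.2 hR.le)).hasDerivWithinAt.mono Ioo_subset_Icc_self
  rw [hasDerivWithinAt_iff_tendsto_slope' right_notMem_Ioo, nhdsWithin_Ioo_eq_nhdsLT hR] at hd
  refine le_of_tendsto hd ?_
  filter_upwards [Ioo_mem_nhdsLT hR] with s hs
  rw [slope_def_field, hD.zero, sub_zero]
  exact div_nonpos_of_nonneg_of_nonpos (hD.pos s hs).le (sub_nonpos.2 hs.2.le)

end CondD

namespace IsPhase

variable {R : ℝ} {f D g : ℝ → ℝ} {c : ℝ} {y : ℝ → ℝ} {ξ δ : ℝ} (hy : IsPhase R f D g c y)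
  (A : IsAdmissible R f D g)
include hy A

theorem eventually_le_mul (hD : CondD R D) {ε : ℝ} (hε : 0 < ε)
    (hlt : ε * derivWithin D (Icc 0 R) R < c - advSpeed R f R) :
    ∀ᶠ s in 𝓝[<] R, y s ≤ ε * D s := by
  refine eventually_le_of_eventually_deriv_le A.R_pos hy.continuousOn
    (v' := fun s => ε * derivWithin D (Icc 0 R) s)
    ((A.D_continuousOn.mono Ioc_subset_Icc_self).const_mul ε)
    (by rw [hy.terminal, A.D_right, mul_zero])
    (eventually_of_mem (Ioo_mem_nhdsLT A.R_pos) hy.hasDerivAt)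
    (eventually_of_mem (Ioo_mem_nhdsLT A.R_pos) fun s hs => (hD.hasDerivAt hs).const_mul ε) ?_
  have hleft := (hD.tendsto_derivWithin A.R_pos).const_mul ε
  have hright := ((tendsto_nhdsLT_of_continuousOn_Icc A.R_pos A.advSpeed_continuousOn).const_sub
    c).sub ((tendsto_nhdsLT_of_continuousOn_Icc A.R_pos A.g_continuousOn).div_const ε)
  rw [A.g_right, zero_div, sub_zero] at hright
  filter_upwards [hleft.eventually_lt hright hlt, Ioo_mem_nhdsLT A.R_pos] with s hs hsR hys
  have hsource : D s * g s / y s ≤ g s / ε := by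
    rw [div_le_div_iff₀ (hy.pos s hsR) hε]
    linarith [mul_le_mul_of_nonneg_left hys.le (A.g_nonneg s (Ioo_subset_Icc_self hsR))]
  linarith

theorem eventually_mul_le (hD : CondD R D)
    (hlt : c - advSpeed R f R < δ * derivWithin D (Icc 0 R) R) :
    ∀ᶠ s in 𝓝[<] R, δ * D s ≤ y s := by
  refine eventually_le_of_eventually_deriv_le A.R_pos
    (u' := fun s => δ * derivWithin D (Icc 0 R) s)
    ((A.D_continuousOn.mono Ioc_subset_Icc_self).const_mul δ) hy.continuousOn
    (by rw [hy.terminal, A.D_right, mul_zero])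
    (eventually_of_mem (Ioo_mem_nhdsLT A.R_pos) fun s hs => (hD.hasDerivAt hs).const_mul δ)
    (eventually_of_mem (Ioo_mem_nhdsLT A.R_pos) hy.hasDerivAt) ?_
  have hleft := (tendsto_nhdsLT_of_continuousOn_Icc A.R_pos A.advSpeed_continuousOn).const_sub c
  filter_upwards [hleft.eventually_lt ((hD.tendsto_derivWithin A.R_pos).const_mul δ) hlt,
    Ioo_mem_nhdsLT A.R_pos] with s hs hsR _
  have hsource : 0 ≤ D s * g s / y s := div_nonneg (mul_nonneg (A.D_pos s hsR).le
    (A.g_nonneg s (Ioo_subset_Icc_self hsR))) (hy.pos s hsR).le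
  linarith

theorem exists_eventually_mul_le (hD : CondD R D) (hc : c < advSpeed R f R) :
    ∃ δ > 0, ∀ᶠ s in 𝓝[<] R, δ * D s ≤ y s := by
  have hlim : Tendsto (fun δ => δ * derivWithin D (Icc 0 R) R) (𝓝[>] 0) (𝓝 0) :=
    ((continuous_mul_const _).tendsto' 0 0 (zero_mul _)).mono_left nhdsWithin_le_nhds
  obtain ⟨δ, hlt, hδ⟩ := ((hlim.eventually (lt_mem_nhds (sub_neg.2 hc))).and
    self_mem_nhdsWithin).exists
  exact ⟨δ, hδ, hy.eventually_mul_le A hD hlt⟩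

theorem exists_eventually_le_mul_sub (hD : CondDTilde R D g) :
    ∃ M, ∀ᶠ s in 𝓝[<] R, y s ≤ M * (R - s) := by
  obtain ⟨l, hl0, hl⟩ := hD.limit
  obtain ⟨C, hC⟩ := isCompact_Icc.exists_bound_of_continuousOn
    (continuousOn_const.sub A.advSpeed_continuousOn :
      ContinuousOn (fun s => c - advSpeed R f s) (Icc 0 R))
  have hC0 : 0 ≤ C := (norm_nonneg _).trans (hC 0 A.zero_mem)
  refine ⟨C + (1 - l), eventually_le_of_eventually_deriv_le A.R_pos hy.continuousOn
    (v' := fun _ => (C + (1 - l)) * -1) (by fun_prop) (by rw [hy.terminal, sub_self, mul_zero])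
    (eventually_of_mem (Ioo_mem_nhdsLT A.R_pos) hy.hasDerivAt)
    (Eventually.of_forall fun s => ((hasDerivAt_id s).const_sub R).const_mul _) ?_⟩
  filter_upwards [hl.eventually (lt_mem_nhds (sub_one_lt l)), Ioo_mem_nhdsLT A.R_pos]
    with s hlt hs hys
  have hRs : 0 < R - s := sub_pos.2 hs.2
  rw [lt_div_iff_of_neg (sub_neg.2 hs.2)] at hlt
  have hRy : R - s ≤ y s := by
    linarith [mul_nonneg (show 0 ≤ C - l by linarith) hRs.le]
  have hsource : D s * g s / y s ≤ 1 - l := by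
    rw [div_le_iff₀ (hy.pos s hs)]
    linarith [mul_le_mul_of_nonneg_left hRy (show 0 ≤ 1 - l by linarith)]
  have hconv : -C ≤ c - advSpeed R f s := (abs_le.1 (hC s (Ioo_subset_Icc_self hs))).1
  linarith

theorem eventually_le_mul_of_condDTilde (hD : CondDTilde R D g) {ε : ℝ} (hε : 0 < ε) :
    ∀ᶠ s in 𝓝[<] R, y s ≤ ε * D s := by
  obtain ⟨M, hM⟩ := hy.exists_eventually_le_mul_sub A hD
  filter_upwards [hM, hD.deriv_end.eventually (eventually_le_atBot (-(M / ε))),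
    Ioo_mem_nhdsLT A.R_pos] with s hys hslope hs
  rw [A.D_right, sub_zero, div_le_iff_of_neg (sub_neg.2 hs.2)] at hslope
  calc y s ≤ M * (R - s) := hys
    _ = ε * (-(M / ε) * (s - R)) := by field_simp; ring
    _ ≤ ε * D s := mul_le_mul_of_nonneg_left hslope hε.le

theorem tendsto_profile_nhdsGT (hξ : ξ ∈ frontier (profile R D y ⁻¹' {R}))
    (hξw : ξ < endTime R D y) : Tendsto (profile R D y) (𝓝[>] ξ) (𝓝[<] R) := by
  have hR : profile R D y ξ = R := (hy.isClosed_profile_preimage_right A).frontier_subset hξ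
  refine tendsto_nhdsWithin_iff.2 ⟨?_, ?_⟩
  · exact ((hy.profile_continuous A).tendsto' ξ R hR).mono_left nhdsWithin_le_nhds
  · filter_upwards [Ioo_mem_nhdsGT hξw] with η hη
    exact (A.profile_mem_Ioo_of_mem_frontier hξ hη).2

theorem tendsto_deriv_profile_nhdsGT (hsmall : ∀ ε > 0, ∀ᶠ s in 𝓝[<] R, y s ≤ ε * D s)
    (hξ : ξ ∈ frontier (profile R D y ⁻¹' {R})) (hξw : ξ < endTime R D y) :
    Tendsto (deriv (profile R D y)) (𝓝[>] ξ) (𝓝 0) := by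
  have hratio : Tendsto (fun s => y s / D s) (𝓝[<] R) (𝓝 0) := by
    refine tendsto_order.2 ⟨fun a ha => ?_, fun a ha => ?_⟩
    · filter_upwards [Ioo_mem_nhdsLT A.R_pos] with s hs
      exact ha.trans (div_pos (hy.pos s hs) (A.D_pos s hs))
    · filter_upwards [Ioo_mem_nhdsLT A.R_pos, hsmall (a / 2) (half_pos ha)] with s hs hle
      exact ((div_le_iff₀ (A.D_pos s hs)).2 hle).trans_lt (half_lt_self ha)
  have hlim := (hratio.comp (hy.tendsto_profile_nhdsGT A hξ hξw)).neg
  rw [neg_zero] at hlim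
  refine hlim.congr' ?_
  filter_upwards [Ioo_mem_nhdsGT hξw] with η hη
  exact (hy.profile_hasDerivAt A (A.profile_mem_Ioo_of_mem_frontier hξ hη)).deriv.symm

theorem profile_differentiableAt_of_eventually_le
    (hsmall : ∀ ε > 0, ∀ᶠ s in 𝓝[<] R, y s ≤ ε * D s) (hξw : ξ < endTime R D y) :
    DifferentiableAt ℝ (profile R D y) ξ := by
  by_cases hξ : ξ ∈ frontier (profile R D y ⁻¹' {R})
  swap
  · exact hy.profile_differentiableAt A hξw hξ
  have hR : profile R D y ξ = R := (hy.isClosed_profile_preimage_right A).frontier_subset hξ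
  have hleft : HasDerivWithinAt (profile R D y) 0 (Iic ξ) ξ :=
    (hasDerivWithinAt_const ξ (Iic ξ) R).congr_of_mem
      (fun η hη => A.isLowerSet_profile_preimage_right y hη hR) self_mem_Iic
  have hright : HasDerivWithinAt (profile R D y) 0 (Ici ξ) ξ :=
    hasDerivWithinAt_Ici_of_tendsto_deriv
      (fun η hη => (hy.profile_hasDerivAt A
        (A.profile_mem_Ioo_of_mem_frontier hξ hη)).differentiableAt.differentiableWithinAt)
      (hy.profile_continuous A).continuousWithinAt (Ioo_mem_nhdsGT hξw)
      (hy.tendsto_deriv_profile_nhdsGT A hsmall hξ hξw)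
  have hboth := hleft.union hright
  rw [Iic_union_Ici, hasDerivWithinAt_univ] at hboth
  exact hboth.differentiableAt

theorem exists_le_travelTime (hδ : 0 < δ) (hlarge : ∀ᶠ s in 𝓝[<] R, δ * D s ≤ y s) :
    ∃ B, ∀ s ∈ Ioo 0 R, B ≤ travelTime R D y s := by
  obtain ⟨r, hrR, hr⟩ := mem_nhdsLT_iff_exists_Ico_subset.1
    (hlarge.and (Ioo_mem_nhdsLT A.R_pos))
  have hd : ∀ s ∈ Ico r R, HasDerivAt (fun s => travelTime R D y s + s / δ)
      (-(D s / y s) + 1 / δ) s := fun s hs =>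
    (hy.travelTime_hasDerivAt A (hr hs).2).add ((hasDerivAt_id s).div_const δ)
  have hmono : MonotoneOn (fun s => travelTime R D y s + s / δ) (Ico r R) :=
    monotoneOn_of_hasDerivWithinAt_nonneg (convex_Ico r R) (HasDerivAt.continuousOn hd)
      (fun s hs => (hd s (interior_subset hs)).hasDerivWithinAt) fun s hs => by
        obtain ⟨hle, hs'⟩ := hr (interior_subset hs)
        rw [neg_add_eq_sub, sub_nonneg, div_le_div_iff₀ (hy.pos s hs') hδ]
        linarith
  have hrr : r ∈ Ico r R := left_mem_Ico.2 hrR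
  refine ⟨travelTime R D y r + r / δ - R / δ, fun s hs => ?_⟩
  rcases le_total r s with hrs | hsr
  · have hle : travelTime R D y r + r / δ ≤ travelTime R D y s + s / δ := hmono hrr ⟨hrs, hs.2⟩ hrs
    linarith [div_le_div_of_nonneg_right hs.2.le hδ.le]
  · linarith [(hy.travelTime_strictAntiOn A).antitoneOn hs (hr hrr).2 hsr,
      div_le_div_of_nonneg_right (le_of_lt hrR) hδ.le]

theorem exists_mem_frontier_of_le_travelTime {B : ℝ} (hB : ∀ s ∈ Ioo 0 R, B ≤ travelTime R D y s) :
    ∃ ξ < endTime R D y, ξ ∈ frontier (profile R D y ⁻¹' {R}) := by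
  have hhalf := A.half_mem
  have hBR : profile R D y B = R := by
    refine le_antisymm (A.profile_mem y B).2 (le_of_forall_lt fun a ha => ?_)
    obtain ⟨s, has, hsR⟩ := exists_between (max_lt ha A.R_pos)
    have hs : s ∈ Ioo 0 R := ⟨(le_max_right a 0).trans_lt has, hsR⟩
    exact ((le_max_left a 0).trans_lt has).trans_le (le_profile hs (hB s hs))
  have hhalfR : travelTime R D y (R / 2) ∉ profile R D y ⁻¹' {R} := fun h =>
    hhalf.2.ne ((hy.profile_travelTime A hhalf).symm.trans h)
  obtain ⟨ξ, hξ⟩ := nonempty_frontier_iff.2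
    ⟨(⟨B, hBR⟩ : (profile R D y ⁻¹' {R}).Nonempty), fun h => hhalfR (h.symm ▸ mem_univ _)⟩
  have hR : profile R D y ξ = R := (hy.isClosed_profile_preimage_right A).frontier_subset hξ
  refine ⟨ξ, lt_of_le_of_lt (le_of_not_gt fun hlt => ?_) (hy.travelTime_lt_endTime A hhalf), hξ⟩
  exact hhalfR (A.isLowerSet_profile_preimage_right y hlt.le hR)

theorem eventually_slope_profile_le (hlarge : ∀ᶠ s in 𝓝[<] R, δ * D s ≤ y s)
    (hξ : ξ ∈ frontier (profile R D y ⁻¹' {R})) (hξw : ξ < endTime R D y) :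
    ∀ᶠ η in 𝓝[>] ξ, slope (profile R D y) ξ η ≤ -δ := by
  obtain ⟨u, hu, hsub⟩ := (mem_nhdsGT_iff_exists_Ioo_subset' hξw).1
    (((hy.tendsto_profile_nhdsGT A hξ hξw).eventually hlarge).and (Ioo_mem_nhdsGT hξw))
  filter_upwards [Ioo_mem_nhdsGT hu] with η hη
  have hd : ∀ t ∈ interior (Icc ξ η), HasDerivAt (profile R D y)
      (-(y (profile R D y t) / D (profile R D y t))) t ∧
      -(y (profile R D y t) / D (profile R D y t)) ≤ -δ := fun t ht => by
    rw [interior_Icc] at ht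
    obtain ⟨hle, ht'⟩ := hsub ⟨ht.1, ht.2.trans hη.2⟩
    have hmem := A.profile_mem_Ioo_of_mem_frontier hξ ht'
    exact ⟨hy.profile_hasDerivAt A hmem, neg_le_neg ((le_div_iff₀ (A.D_pos _ hmem)).2 hle)⟩
  rw [slope_def_field, div_le_iff₀ (sub_pos.2 hη.1)]
  exact (convex_Icc ξ η).image_sub_le_mul_sub_of_deriv_le (hy.profile_continuous A).continuousOn
    (fun t ht => (hd t ht).1.differentiableAt.differentiableWithinAt)
    (fun t ht => (hd t ht).1.deriv.trans_le (hd t ht).2)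
    ξ (left_mem_Icc.2 hη.1.le) η (right_mem_Icc.2 hη.1.le) hη.1.le

theorem exists_not_differentiableAt_profile (hδ : 0 < δ)
    (hlarge : ∀ᶠ s in 𝓝[<] R, δ * D s ≤ y s) :
    ∃ ξ < endTime R D y, ¬DifferentiableAt ℝ (profile R D y) ξ := by
  obtain ⟨B, hB⟩ := hy.exists_le_travelTime A hδ hlarge
  obtain ⟨ξ, hξw, hξ⟩ := hy.exists_mem_frontier_of_le_travelTime A hB
  have hR : profile R D y ξ = R := (hy.isClosed_profile_preimage_right A).frontier_subset hξ
  refine ⟨ξ, hξw, fun hd => ?_⟩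
  have hmax : IsLocalMax (profile R D y) ξ :=
    Eventually.of_forall fun η => (A.profile_mem y η).2.trans_eq hR.symm
  have hslope := (hmax.deriv_eq_zero ▸ hd.hasDerivAt).tendsto_slope.mono_left
    (nhdsWithin_mono ξ (fun _ hx => ne_of_gt hx : Ioi ξ ⊆ {ξ}ᶜ))
  exact (neg_neg_of_pos hδ).not_ge
    (le_of_tendsto hslope (hy.eventually_slope_profile_le A hlarge hξ hξw))

end IsPhase

end Regularity

section Classification

variable {R : ℝ} {f D g : ℝ → ℝ} {c w : ℝ} {y φ : ℝ → ℝ}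

namespace IsSemiWavefrontFrom

section ProfileRegularity

variable (h : IsSemiWavefrontFrom R f D g c R w φ) (hy : IsPhase R f D g c y)
  (A : IsAdmissible R f D g)
include h hy A

theorem isClassicalOn_of_differentiableAt {J : Set ℝ} (hJ : IsOpen J) (hJw : J ⊆ Iio w)
    (hd : ∀ ξ ∈ J, DifferentiableAt ℝ φ ξ) : IsClassicalOn R f D g c J φ :=
  (h.isIntegratedWave A hy).isClassicalOn A h.antitoneOn hJ hJw hd

theorem isClassicalOn_of_differentiableAt_profile
    (hd : ∀ ξ < endTime R D y, DifferentiableAt ℝ (profile R D y) ξ) :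
    IsClassicalOn R f D g c (Iio w) φ := by
  obtain ⟨s, hws, hs⟩ := h.exists_eq_profile_sub hy A
  refine h.isClassicalOn_of_differentiableAt hy A isOpen_Iio subset_rfl fun ξ hξ => ?_
  have hshift : DifferentiableAt ℝ (fun η => profile R D y (η - s)) ξ :=
    differentiableAt_comp_sub_const.2 (hd _ (sub_lt_iff_lt_add.2 (lt_of_lt_of_le hξ hws)))
  exact hshift.congr_of_eventuallyEq (eventually_of_mem (Iio_mem_nhds hξ) hs)

theorem isSharpAt_of_not_differentiableAt_profile {ξ : ℝ} (hξ : ξ < endTime R D y)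
    (hd : ¬DifferentiableAt ℝ (profile R D y) ξ) : IsSharpAt R f D g c (Iio w) φ R := by
  obtain ⟨s, hws, hs⟩ := h.exists_eq_profile_sub hy A
  have hdiff : ∀ η < w, DifferentiableAt ℝ φ η ↔ DifferentiableAt ℝ (profile R D y) (η - s) :=
    fun η hη => (EventuallyEq.differentiableAt_iff
      (eventually_of_mem (Iio_mem_nhds hη) hs)).trans differentiableAt_comp_sub_const
  have hfront : ξ ∈ frontier (profile R D y ⁻¹' {R}) :=
    not_not.1 fun hne => hd (hy.profile_differentiableAt A hξ hne)
  have hR : profile R D y ξ = R := (hy.isClosed_profile_preimage_right A).frontier_subset hfront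
  have hξw : ξ + s < w := by
    obtain ⟨ξ₁, hξ₁, hlt⟩ := h.exists_lt
    rw [hs ξ₁ hξ₁] at hlt
    linarith [(A.profile_antitone y).reflect_lt (hlt.trans_eq hR.symm)]
  refine ⟨A.g_right, ξ + s, hξw, by rw [hs _ hξw, add_sub_cancel_right, hR],
    h.isClassicalOn_of_differentiableAt hy A (isOpen_Iio.sdiff isClosed_singleton) sdiff_subset
      fun η hη => (hdiff η hη.1).2 (hy.profile_differentiableAt A ?_ fun hη' => hη.2 ?_),
    fun hφ => hd ?_⟩
  · exact sub_lt_iff_lt_add.2 (lt_of_lt_of_le hη.1 hws)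
  · exact sub_eq_iff_eq_add.1 (subsingleton_frontier_of_isLowerSet
      (A.isLowerSet_profile_preimage_right y) hη' hfront)
  · simpa only [add_sub_cancel_right] using (hdiff _ hξw).1 hφ

end ProfileRegularity

variable (h : IsSemiWavefrontFrom R f D g c R w φ) (A : IsAdmissible R f D g)
include h A

theorem isClassicalOrSharp : IsClassicalOrSharp R f D g c (Iio w) φ := by
  obtain ⟨y, hy⟩ := A.exists_isPhase c
  by_cases hd : ∀ ξ < endTime R D y, DifferentiableAt ℝ (profile R D y) ξ
  · exact Or.inl (h.isClassicalOn_of_differentiableAt_profile hy A hd)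
  · push Not at hd
    obtain ⟨ξ, hξ, hnd⟩ := hd
    exact Or.inr ⟨R, h.isSharpAt_of_not_differentiableAt_profile hy A hξ hnd⟩

theorem isSharpAt_of_lt_advSpeed (hD : CondD R D) (hc : c < advSpeed R f R) :
    IsSharpAt R f D g c (Iio w) φ R := by
  obtain ⟨y, hy⟩ := A.exists_isPhase c
  obtain ⟨δ, hδ, hlarge⟩ := hy.exists_eventually_mul_le A hD hc
  obtain ⟨ξ, hξ, hnd⟩ := hy.exists_not_differentiableAt_profile A hδ hlarge
  exact h.isSharpAt_of_not_differentiableAt_profile hy A hξ hnd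

theorem isClassicalOn_of_mul_derivWithin_lt (hD : CondD R D)
    (hlt : ∀ ε > 0, ε * derivWithin D (Icc 0 R) R < c - advSpeed R f R) :
    IsClassicalOn R f D g c (Iio w) φ := by
  obtain ⟨y, hy⟩ := A.exists_isPhase c
  exact h.isClassicalOn_of_differentiableAt_profile hy A fun ξ hξ =>
    hy.profile_differentiableAt_of_eventually_le A
      (fun ε hε => hy.eventually_le_mul A hD hε (hlt ε hε)) hξ

theorem isClassicalOn_of_advSpeed_lt (hD : CondD R D) (hc : advSpeed R f R < c) :
    IsClassicalOn R f D g c (Iio w) φ :=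
  h.isClassicalOn_of_mul_derivWithin_lt A hD fun _ hε =>
    (mul_nonpos_of_nonneg_of_nonpos (le_of_lt hε) (hD.derivWithin_nonpos A.R_pos)).trans_lt
      (sub_pos.2 hc)

theorem isClassicalOn_of_eq_advSpeed (hD : CondD R D) (hc : c = advSpeed R f R)
    (hd : derivWithin D (Icc 0 R) R < 0) : IsClassicalOn R f D g c (Iio w) φ :=
  h.isClassicalOn_of_mul_derivWithin_lt A hD fun _ hε =>
    (mul_neg_of_pos_of_neg hε hd).trans_eq (sub_eq_zero.2 hc).symm

theorem isClassicalOn_of_condDTilde (hD : CondDTilde R D g) :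
    IsClassicalOn R f D g c (Iio w) φ := by
  obtain ⟨y, hy⟩ := A.exists_isPhase c
  exact h.isClassicalOn_of_differentiableAt_profile hy A fun ξ hξ =>
    hy.profile_differentiableAt_of_eventually_le A
      (fun ε hε => hy.eventually_le_mul_of_condDTilde A hD hε) hξ

end IsSemiWavefrontFrom

theorem IsAdmissible.exists_profileFrom (A : IsAdmissible R f D g) (c : ℝ) :
    ∃ (w : ℝ) (φ : ℝ → ℝ), ProfileFrom R f D g c w φ ∧
      ∀ (w' : ℝ) (φ' : ℝ → ℝ), IsSemiWavefrontFrom R f D g c R w' φ' →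
        ∃ s : ℝ, w' ≤ w + s ∧ ∀ ξ < w', φ' ξ = φ (ξ - s) := by
  obtain ⟨y, hy⟩ := A.exists_isPhase c
  have h := hy.isSemiWavefrontFrom_profile A
  exact ⟨_, _, ⟨h, h.isClassicalOrSharp A⟩, fun w' φ' h' => h'.exists_eq_profile_sub hy A⟩

end Classification

section Reflection

open scoped Pointwise

theorem ae_restrict_comp_neg {I : Set ℝ} (hI : MeasurableSet I) {p : ℝ → Prop}
    (h : ∀ᵐ x ∂volume.restrict I, p x) : ∀ᵐ x ∂volume.restrict (-I), p (-x) := by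
  rw [ae_restrict_iff' hI] at h
  rw [ae_restrict_iff' hI.neg]
  exact (Measure.measurePreserving_neg (volume : Measure ℝ)).quasiMeasurePreserving.ae h

theorem locallyIntegrableOn_comp_neg {E : Type*} [NormedAddCommGroup E] {F : ℝ → E} {I : Set ℝ}
    (h : LocallyIntegrableOn F I) : LocallyIntegrableOn (fun x => F (-x)) (-I) := by
  intro x hx
  obtain ⟨u, hu, hFu⟩ := h (-x) hx
  have hneg : Tendsto Neg.neg (𝓝[-I] x) (𝓝[I] (-x)) :=
    continuous_neg.continuousWithinAt.tendsto_nhdsWithin fun _ hη => hη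
  exact ⟨Neg.neg ⁻¹' u, hneg hu,
    ((Measure.measurePreserving_neg volume).integrableOn_comp_preimage
      (MeasurableEquiv.neg ℝ).measurableEmbedding).2 hFu⟩

theorem flux_comp_neg (D φ : ℝ → ℝ) : flux D (fun x => φ (-x)) = fun x => -flux D φ (-x) := by
  funext ξ
  simp only [flux, deriv_comp_neg, mul_neg]

theorem advSpeed_neg (R : ℝ) (f : ℝ → ℝ) (s : ℝ) :
    advSpeed R (fun x => -f x) s = -advSpeed R f s :=
  derivWithin.fun_neg

variable {R : ℝ} {f D g : ℝ → ℝ} {c l w : ℝ} {φ : ℝ → ℝ} {I : Set ℝ}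

theorem IsAdmissible.neg (A : IsAdmissible R f D g) : IsAdmissible R (fun s => -f s) D g :=
  { A with f_contDiffOn := A.f_contDiffOn.neg }

theorem IsTravelingWave.weak_eq_comp_neg (h : IsTravelingWave R f D g c I φ) {ψ : ℝ → ℝ}
    (hψ : ContDiff ℝ ∞ ψ) (hψc : HasCompactSupport ψ) (hψI : tsupport ψ ⊆ -I) :
    ∫ ξ in -I, ((flux D (fun x => φ (-x)) ξ - -f (φ (-ξ)) + -c * φ (-ξ)) * deriv ψ ξ
      - g (φ (-ξ)) * ψ ξ) = 0 := by
  have hsupp : tsupport (fun x => ψ (-x)) = Neg.neg ⁻¹' tsupport ψ :=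
    tsupport_comp_eq_preimage ψ (Homeomorph.neg ℝ)
  have hweak := h.weak_eq (fun x => ψ (-x)) (hψ.comp contDiff_neg)
    (hψc.comp_homeomorph (Homeomorph.neg ℝ))
    (hsupp.trans_subset fun x hx => by simpa using hψI hx)
  rw [← (Measure.measurePreserving_neg volume).setIntegral_preimage_emb
    (MeasurableEquiv.neg ℝ).measurableEmbedding] at hweak
  refine Eq.trans (setIntegral_congr_fun h.isOpen.neg.measurableSet fun ξ _ => ?_) hweak
  simp only [flux_comp_neg, deriv_comp_neg, neg_neg]
  ring

theorem IsTravelingWave.comp_neg (h : IsTravelingWave R f D g c I φ) :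
    IsTravelingWave R (fun s => -f s) D g (-c) (-I) (fun ξ => φ (-ξ)) where
  isOpen := h.isOpen.neg
  ordConnected := ⟨fun _ ha _ hb _ hx =>
    h.ordConnected.out hb ha ⟨neg_le_neg hx.2, neg_le_neg hx.1⟩⟩
  mapsTo := fun _ hξ => h.mapsTo hξ
  continuous := h.continuous.comp continuous_neg.continuousOn fun _ hξ => hξ
  ae_differentiable := (ae_restrict_comp_neg h.isOpen.measurableSet h.ae_differentiable).mono
    fun _ hξ => differentiableAt_comp_neg.2 hξ
  flux_locallyIntegrable :=
    flux_comp_neg D φ ▸ (locallyIntegrableOn_comp_neg h.flux_locallyIntegrable).neg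
  flux_weak := fun a ha b hb => by
    rw [h.flux_weak (-a) ha (-b) hb, flux_comp_neg, intervalIntegral.integral_neg,
      intervalIntegral.integral_comp_neg, intervalIntegral.integral_symm]
  weak_eq := fun _ hψ hψc hψI => h.weak_eq_comp_neg hψ hψc hψI

theorem IsClassicalOn.comp_neg (hI : IsOpen I) (h : IsClassicalOn R f D g c I φ) :
    IsClassicalOn R (fun s => -f s) D g (-c) (-I) (fun ξ => φ (-ξ)) where
  differentiable := fun ξ hξ => differentiableAt_comp_neg.2 (h.differentiable (-ξ) hξ)
  flux_ac := fun a b hab => by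
    rw [flux_comp_neg]
    refine (absolutelyContinuousOnInterval_comp_neg (h.flux_ac (-a) (-b) ?_)).neg
    rw [← neg_neg I, ← image_neg_eq_neg, ← image_neg_uIcc]
    exact image_mono hab
  ae_eq := by
    filter_upwards [ae_restrict_comp_neg hI.measurableSet h.ae_eq] with ξ hξ
    rw [flux_comp_neg, deriv.fun_neg, deriv_comp_neg, deriv_comp_neg, advSpeed_neg]
    linarith

theorem IsSharpAt.comp_neg (hI : IsOpen I) (h : IsSharpAt R f D g c I φ l) :
    IsSharpAt R (fun s => -f s) D g (-c) (-I) (fun ξ => φ (-ξ)) l := by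
  obtain ⟨hg, ξ, hξ, hφ, hcl, hnd⟩ := h
  have hdiff : -(I \ {ξ}) = -I \ {-ξ} := by
    ext x
    simp [neg_eq_iff_eq_neg]
  exact ⟨hg, -ξ, by simpa using hξ, by simpa using hφ,
    hdiff ▸ hcl.comp_neg (hI.sdiff isClosed_singleton),
    fun hd => hnd (differentiableAt_iff_comp_neg.2 hd)⟩

theorem IsClassicalOrSharp.comp_neg (hI : IsOpen I) (h : IsClassicalOrSharp R f D g c I φ) :
    IsClassicalOrSharp R (fun s => -f s) D g (-c) (-I) (fun ξ => φ (-ξ)) :=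
  h.imp (fun h => h.comp_neg hI) fun ⟨l, hl⟩ => ⟨l, hl.comp_neg hI⟩

theorem IsStrict.comp_neg (h : IsStrict R f D g c I φ) :
    IsStrict R (fun s => -f s) D g (-c) (-I) (fun ξ => φ (-ξ)) := by
  refine ⟨fun he => h.1 (by rw [← neg_neg I, he, neg_univ]), ?_⟩
  rintro ⟨φ', hφ', heq⟩
  exact h.2 ⟨fun ξ => φ' (-ξ), by simpa using hφ'.comp_neg,
    fun ξ hξ => by simpa using heq (show -ξ ∈ -I by simpa using hξ)⟩

theorem IsMonotonicNonconst.comp_neg (h : IsMonotonicNonconst I φ) :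
    IsMonotonicNonconst (-I) (fun ξ => φ (-ξ)) := by
  obtain ⟨hmono, ξ₁, h₁, ξ₂, h₂, hne⟩ := h
  exact ⟨hmono.symm.imp (fun h _ ha _ hb hab => h hb ha (neg_le_neg hab))
    (fun h _ ha _ hb hab => h hb ha (neg_le_neg hab)), -ξ₁, by simpa using h₁, -ξ₂,
    by simpa using h₂, by simpa using hne⟩

theorem IsSemiWavefrontFrom.comp_neg (h : IsSemiWavefrontFrom R f D g c l w φ) :
    IsSemiWavefrontTo R (fun s => -f s) D g (-c) l (-w) (fun ξ => φ (-ξ)) where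
  wave := neg_Iio w ▸ h.wave.comp_neg
  mem := h.mem
  zero := h.zero
  monotonic := neg_Iio w ▸ h.monotonic.comp_neg
  tendsto := h.tendsto.comp tendsto_neg_atTop_atBot

theorem IsSemiWavefrontTo.comp_neg (h : IsSemiWavefrontTo R f D g c l w φ) :
    IsSemiWavefrontFrom R (fun s => -f s) D g (-c) l (-w) (fun ξ => φ (-ξ)) where
  wave := neg_Ioi w ▸ h.wave.comp_neg
  mem := h.mem
  zero := h.zero
  monotonic := neg_Ioi w ▸ h.monotonic.comp_neg
  tendsto := h.tendsto.comp tendsto_neg_atBot_atTop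

theorem ProfileFrom.comp_neg (h : ProfileFrom R f D g c w φ) :
    ProfileTo R (fun s => -f s) D g (-c) (-w) (fun ξ => φ (-ξ)) :=
  ⟨h.1.comp_neg, neg_Iio w ▸ h.2.comp_neg isOpen_Iio⟩

theorem IsAdmissible.exists_profileTo (A : IsAdmissible R f D g) (c : ℝ) :
    ∃ (w : ℝ) (φ : ℝ → ℝ), ProfileTo R f D g c w φ ∧
      ∀ (w' : ℝ) (φ' : ℝ → ℝ), IsSemiWavefrontTo R f D g c R w' φ' →
        ∃ s : ℝ, w + s ≤ w' ∧ ∀ ξ > w', φ' ξ = φ (ξ - s) := by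
  obtain ⟨w, φ, h, huniq⟩ := A.neg.exists_profileFrom (-c)
  refine ⟨-w, fun ξ => φ (-ξ), by simpa using h.comp_neg, fun w' φ' h' => ?_⟩
  obtain ⟨s, hs, heq⟩ := huniq _ _ h'.comp_neg
  refine ⟨-s, by linarith, fun ξ hξ => ?_⟩
  have hshift := heq (-ξ) (neg_lt_neg hξ)
  rwa [neg_neg, ← neg_add', ← sub_neg_eq_add] at hshift

theorem isClassicalOn_Ioi_of_comp_neg
    (h : IsClassicalOn R (fun s => -f s) D g (-c) (Iio (-w)) (fun ξ => φ (-ξ))) :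
    IsClassicalOn R f D g c (Ioi w) φ := by
  simpa using h.comp_neg isOpen_Iio

theorem isSharpAt_Ioi_of_comp_neg
    (h : IsSharpAt R (fun s => -f s) D g (-c) (Iio (-w)) (fun ξ => φ (-ξ)) l) :
    IsSharpAt R f D g c (Ioi w) φ l := by
  simpa using h.comp_neg isOpen_Iio

namespace IsSemiWavefrontTo

variable (h : IsSemiWavefrontTo R f D g c R w φ) (A : IsAdmissible R f D g)
include h A

theorem isStrict : IsStrict R f D g c (Ioi w) φ := by
  simpa using (h.comp_neg.isStrict A.neg).comp_neg

theorem isClassicalOn_of_lt_advSpeed (hD : CondD R D) (hc : c < advSpeed R f R) :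
    IsClassicalOn R f D g c (Ioi w) φ :=
  isClassicalOn_Ioi_of_comp_neg (h.comp_neg.isClassicalOn_of_advSpeed_lt A.neg hD
    ((advSpeed_neg R f R).trans_lt (neg_lt_neg hc)))

theorem isSharpAt_of_advSpeed_lt (hD : CondD R D) (hc : advSpeed R f R < c) :
    IsSharpAt R f D g c (Ioi w) φ R :=
  isSharpAt_Ioi_of_comp_neg (h.comp_neg.isSharpAt_of_lt_advSpeed A.neg hD
    ((neg_lt_neg hc).trans_eq (advSpeed_neg R f R).symm))

theorem isClassicalOn_of_eq_advSpeed (hD : CondD R D) (hc : c = advSpeed R f R)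
    (hd : derivWithin D (Icc 0 R) R < 0) : IsClassicalOn R f D g c (Ioi w) φ :=
  isClassicalOn_Ioi_of_comp_neg (h.comp_neg.isClassicalOn_of_eq_advSpeed A.neg hD
    ((congrArg Neg.neg hc).trans (advSpeed_neg R f R).symm) hd)

theorem isClassicalOn_of_condDTilde (hD : CondDTilde R D g) :
    IsClassicalOn R f D g c (Ioi w) φ :=
  isClassicalOn_Ioi_of_comp_neg (h.comp_neg.isClassicalOn_of_condDTilde A.neg hD)

end IsSemiWavefrontTo

end Reflection

section Borderline

theorem advSpeed_zero (R s : ℝ) : advSpeed R (fun _ => 0) s = 0 := by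
  simp [advSpeed]

theorem hasDerivAt_sub_pow (R : ℝ) (n : ℕ) (s : ℝ) :
    HasDerivAt (fun t => (R - t) ^ n) (-(n * (R - s) ^ (n - 1))) s :=
  (((hasDerivAt_id s).const_sub R).pow n).congr_deriv (by simp)

theorem condD_sub_sq (R : ℝ) : CondD R (fun s => (R - s) ^ 2) where
  contDiff := by fun_prop
  zero := by simp
  pos := fun _ hs => pow_pos (sub_pos.2 hs.2) 2

theorem derivWithin_sub_sq {R : ℝ} (hR : 0 < R) :
    derivWithin (fun s => (R - s) ^ 2) (Icc 0 R) R = 0 := by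
  rw [(hasDerivAt_sub_pow R 2 R).hasDerivWithinAt.derivWithin
    (uniqueDiffOn_Icc hR R (right_mem_Icc.2 hR.le))]
  simp

/-- The source term for which, with `f = 0` and `D s = (R - s) ^ 2`, the phase function of speed
`0` is `(R - s) ^ (n + 2)`. -/
def borderlineSource (R : ℝ) (n : ℕ) (s : ℝ) : ℝ := (n + 2) * (R - s) ^ (2 * n + 1)

theorem standing_borderlineSource (R : ℝ) (n : ℕ) :
    Standing R (fun _ => 0) (borderlineSource R n) where
  f_contDiff := contDiffOn_const
  f_zero := rfl
  g_continuous := by unfold borderlineSource; fun_prop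

theorem condG_borderlineSource (R : ℝ) (n : ℕ) : CondG R (borderlineSource R n) where
  pos := fun _ hs => mul_pos (by positivity) (pow_pos (sub_pos.2 hs.2) _)
  zero := by simp [borderlineSource]

theorem isPhase_borderlineSource (R : ℝ) (n : ℕ) :
    IsPhase R (fun _ => 0) (fun s => (R - s) ^ 2) (borderlineSource R n) 0
      (fun s => (R - s) ^ (n + 2)) where
  continuousOn := by fun_prop
  terminal := by simp
  pos := fun _ hs => pow_pos (sub_pos.2 hs.2) _
  hasDerivAt := fun s hs => by
    refine (hasDerivAt_sub_pow R (n + 2) s).congr_deriv ?_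
    have := (sub_pos.2 hs.2).ne'
    rw [advSpeed_zero, borderlineSource]
    field_simp
    push_cast
    ring
  bounded := ⟨R ^ (n + 2), fun _ hs =>
    pow_le_pow_left₀ (sub_nonneg.2 hs.2) (sub_le_self R hs.1.le) _⟩

variable {R : ℝ} (hR : 0 < R)
include hR

theorem isAdmissible_borderlineSource (n : ℕ) :
    IsAdmissible R (fun _ => 0) (fun s => (R - s) ^ 2) (borderlineSource R n) :=
  (standing_borderlineSource R n).isAdmissible hR (condG_borderlineSource R n)
    (Or.inl (condD_sub_sq R))

theorem exists_isClassicalOn_borderlineSource : ∃ (w : ℝ) (φ : ℝ → ℝ),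
    IsSemiWavefrontFrom R (fun _ => 0) (fun s => (R - s) ^ 2) (borderlineSource R 1) 0 R w φ ∧
    IsClassicalOn R (fun _ => 0) (fun s => (R - s) ^ 2) (borderlineSource R 1) 0 (Iio w) φ := by
  have A := isAdmissible_borderlineSource hR 1
  have hy := isPhase_borderlineSource R 1
  have h := hy.isSemiWavefrontFrom_profile A
  refine ⟨_, _, h, h.isClassicalOn_of_differentiableAt_profile hy A fun ξ hξ =>
    hy.profile_differentiableAt_of_eventually_le A (fun ε hε => ?_) hξ⟩
  filter_upwards [Ioo_mem_nhdsLT (sub_lt_self R hε)] with s hs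
  rw [pow_add, pow_one]
  exact mul_le_mul_of_nonneg_right (sub_le_comm.1 hs.1.le) (sq_nonneg (R - s))

theorem exists_isSharpAt_borderlineSource : ∃ (w : ℝ) (φ : ℝ → ℝ),
    IsSemiWavefrontFrom R (fun _ => 0) (fun s => (R - s) ^ 2) (borderlineSource R 0) 0 R w φ ∧
    IsSharpAt R (fun _ => 0) (fun s => (R - s) ^ 2) (borderlineSource R 0) 0 (Iio w) φ R := by
  have A := isAdmissible_borderlineSource hR 0
  have hy := isPhase_borderlineSource R 0
  have h := hy.isSemiWavefrontFrom_profile A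
  obtain ⟨ξ, hξ, hd⟩ := hy.exists_not_differentiableAt_profile A one_pos
    (Eventually.of_forall fun s => by simp)
  exact ⟨_, _, h, h.isSharpAt_of_not_differentiableAt_profile hy A hξ hd⟩

theorem exists_borderline_isClassicalOn :
    ∃ f D g : ℝ → ℝ, Standing R f g ∧ CondG R g ∧ CondD R D ∧
      derivWithin D (Icc 0 R) R = 0 ∧
      (∃ (w : ℝ) (φ : ℝ → ℝ), IsSemiWavefrontFrom R f D g (advSpeed R f R) R w φ ∧
        IsClassicalOn R f D g (advSpeed R f R) (Iio w) φ) ∧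
      (∃ (w : ℝ) (φ : ℝ → ℝ), IsSemiWavefrontTo R f D g (advSpeed R f R) R w φ ∧
        IsClassicalOn R f D g (advSpeed R f R) (Ioi w) φ) := by
  obtain ⟨w, φ, h, hφ⟩ := exists_isClassicalOn_borderlineSource hR
  refine ⟨fun _ => 0, fun s => (R - s) ^ 2, borderlineSource R 1, standing_borderlineSource R 1,
    condG_borderlineSource R 1, condD_sub_sq R, derivWithin_sub_sq hR, ?_⟩
  rw [advSpeed_zero]
  exact ⟨⟨w, φ, h, hφ⟩, -w, fun ξ => φ (-ξ), by simpa using h.comp_neg,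
    by simpa using hφ.comp_neg isOpen_Iio⟩

theorem exists_borderline_isSharpAt :
    ∃ f D g : ℝ → ℝ, Standing R f g ∧ CondG R g ∧ CondD R D ∧
      derivWithin D (Icc 0 R) R = 0 ∧
      (∃ (w : ℝ) (φ : ℝ → ℝ), IsSemiWavefrontFrom R f D g (advSpeed R f R) R w φ ∧
        IsSharpAt R f D g (advSpeed R f R) (Iio w) φ R) ∧
      (∃ (w : ℝ) (φ : ℝ → ℝ), IsSemiWavefrontTo R f D g (advSpeed R f R) R w φ ∧
        IsSharpAt R f D g (advSpeed R f R) (Ioi w) φ R) := by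
  obtain ⟨w, φ, h, hφ⟩ := exists_isSharpAt_borderlineSource hR
  refine ⟨fun _ => 0, fun s => (R - s) ^ 2, borderlineSource R 0, standing_borderlineSource R 0,
    condG_borderlineSource R 0, condD_sub_sq R, derivWithin_sub_sq hR, ?_⟩
  rw [advSpeed_zero]
  exact ⟨⟨w, φ, h, hφ⟩, -w, fun ξ => φ (-ξ), by simpa using h.comp_neg,
    by simpa using hφ.comp_neg isOpen_Iio⟩

end Borderline

end SemiWavefront

end

open SemiWavefront in
theorem mainTheorem1_general {R : ℝ} {f D g : ℝ → ℝ} (A : IsAdmissible R f D g) (c : ℝ) :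
    (∃ (w : ℝ) (φ : ℝ → ℝ), ProfileFrom R f D g c w φ ∧
      ∀ (w' : ℝ) (φ' : ℝ → ℝ), IsSemiWavefrontFrom R f D g c R w' φ' →
        ∃ s : ℝ, w' ≤ w + s ∧ ∀ ξ < w', φ' ξ = φ (ξ - s)) ∧
    (∃ (w : ℝ) (φ : ℝ → ℝ), ProfileTo R f D g c w φ ∧
      ∀ (w' : ℝ) (φ' : ℝ → ℝ), IsSemiWavefrontTo R f D g c R w' φ' →
        ∃ s : ℝ, w + s ≤ w' ∧ ∀ ξ > w', φ' ξ = φ (ξ - s)) ∧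
    (∀ (w : ℝ) (φ : ℝ → ℝ), IsSemiWavefrontFrom R f D g c R w φ →
      IsStrict R f D g c (Iio w) φ ∧
      (CondD R D →
        (c < advSpeed R f R → IsSharpAt R f D g c (Iio w) φ R) ∧
        (advSpeed R f R < c → IsClassicalOn R f D g c (Iio w) φ) ∧
        (c = advSpeed R f R → derivWithin D (Icc 0 R) R < 0 →
          IsClassicalOn R f D g c (Iio w) φ)) ∧
      (CondDTilde R D g → IsClassicalOn R f D g c (Iio w) φ)) ∧
    (∀ (w : ℝ) (φ : ℝ → ℝ), IsSemiWavefrontTo R f D g c R w φ →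
      IsStrict R f D g c (Ioi w) φ ∧
      (CondD R D →
        (c < advSpeed R f R → IsClassicalOn R f D g c (Ioi w) φ) ∧
        (advSpeed R f R < c → IsSharpAt R f D g c (Ioi w) φ R) ∧
        (c = advSpeed R f R → derivWithin D (Icc 0 R) R < 0 →
          IsClassicalOn R f D g c (Ioi w) φ)) ∧
      (CondDTilde R D g → IsClassicalOn R f D g c (Ioi w) φ)) :=
  ⟨A.exists_profileFrom c, A.exists_profileTo c,
    fun _ _ h => ⟨h.isStrict A, fun hD => ⟨h.isSharpAt_of_lt_advSpeed A hD,
      h.isClassicalOn_of_advSpeed_lt A hD, h.isClassicalOn_of_eq_advSpeed A hD⟩,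
      h.isClassicalOn_of_condDTilde A⟩,
    fun _ _ h => ⟨h.isStrict A, fun hD => ⟨h.isClassicalOn_of_lt_advSpeed A hD,
      h.isSharpAt_of_advSpeed_lt A hD, h.isClassicalOn_of_eq_advSpeed A hD⟩,
      h.isClassicalOn_of_condDTilde A⟩⟩

open SemiWavefront in
theorem mainTheorem1 (R : ℝ) (hR : 0 < R) :
    (∀ f D g : ℝ → ℝ, Standing R f g → CondG R g → (CondD R D ∨ CondDTilde R D g) → ∀ c : ℝ,
      -- existence and uniqueness up to shifts (a profile may be restricted to a smaller half-line)
      (∃ (w : ℝ) (φ : ℝ → ℝ), ProfileFrom R f D g c w φ ∧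
        ∀ (w' : ℝ) (φ' : ℝ → ℝ), ProfileFrom R f D g c w' φ' →
          ∃ s : ℝ, w' ≤ w + s ∧ ∀ ξ < w', φ' ξ = φ (ξ - s)) ∧
      (∃ (w : ℝ) (φ : ℝ → ℝ), ProfileTo R f D g c w φ ∧
        ∀ (w' : ℝ) (φ' : ℝ → ℝ), ProfileTo R f D g c w' φ' →
          ∃ s : ℝ, w + s ≤ w' ∧ ∀ ξ > w', φ' ξ = φ (ξ - s)) ∧
      -- properties of all profiles from `R`
      (∀ (w : ℝ) (φ : ℝ → ℝ), ProfileFrom R f D g c w φ →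
        IsStrict R f D g c (Iio w) φ ∧
        (CondD R D →
          (c < advSpeed R f R → IsSharpAt R f D g c (Iio w) φ R) ∧
          (advSpeed R f R < c → IsClassicalOn R f D g c (Iio w) φ) ∧
          (c = advSpeed R f R → derivWithin D (Icc 0 R) R < 0 →
            IsClassicalOn R f D g c (Iio w) φ)) ∧
        (CondDTilde R D g → IsClassicalOn R f D g c (Iio w) φ)) ∧
      -- properties of all profiles to `R`
      (∀ (w : ℝ) (φ : ℝ → ℝ), ProfileTo R f D g c w φ →
        IsStrict R f D g c (Ioi w) φ ∧
        (CondD R D →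
          (c < advSpeed R f R → IsClassicalOn R f D g c (Ioi w) φ) ∧
          (advSpeed R f R < c → IsSharpAt R f D g c (Ioi w) φ R) ∧
          (c = advSpeed R f R → derivWithin D (Icc 0 R) R < 0 →
            IsClassicalOn R f D g c (Ioi w) φ)) ∧
        (CondDTilde R D g → IsClassicalOn R f D g c (Ioi w) φ))) ∧
    -- in the borderline case with vanishing derivative of `D`, classical profiles do occur
    (∃ f D g : ℝ → ℝ, Standing R f g ∧ CondG R g ∧ CondD R D ∧
      derivWithin D (Icc 0 R) R = 0 ∧
      (∃ (w : ℝ) (φ : ℝ → ℝ), IsSemiWavefrontFrom R f D g (advSpeed R f R) R w φ ∧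
        IsClassicalOn R f D g (advSpeed R f R) (Iio w) φ) ∧
      (∃ (w : ℝ) (φ : ℝ → ℝ), IsSemiWavefrontTo R f D g (advSpeed R f R) R w φ ∧
        IsClassicalOn R f D g (advSpeed R f R) (Ioi w) φ)) ∧
    -- and so do sharp ones
    (∃ f D g : ℝ → ℝ, Standing R f g ∧ CondG R g ∧ CondD R D ∧
      derivWithin D (Icc 0 R) R = 0 ∧
      (∃ (w : ℝ) (φ : ℝ → ℝ), IsSemiWavefrontFrom R f D g (advSpeed R f R) R w φ ∧
        IsSharpAt R f D g (advSpeed R f R) (Iio w) φ R) ∧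
      (∃ (w : ℝ) (φ : ℝ → ℝ), IsSemiWavefrontTo R f D g (advSpeed R f R) R w φ ∧
        IsSharpAt R f D g (advSpeed R f R) (Ioi w) φ R)) := by
  refine ⟨fun f D g hs hg hD c => ?_, exists_borderline_isClassicalOn hR,
    exists_borderline_isSharpAt hR⟩
  obtain ⟨⟨w, φ, h, huniq⟩, ⟨w', φ', h', huniq'⟩, hfrom, hto⟩ :=
    mainTheorem1_general (hs.isAdmissible hR hg hD) c
  exact ⟨⟨w, φ, h, fun _ _ hψ => huniq _ _ hψ.1⟩, ⟨w', φ', h', fun _ _ hψ => huniq' _ _ hψ.1⟩,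
    fun _ _ hψ => hfrom _ _ hψ.1, fun _ _ hψ => hto _ _ hψ.1⟩
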